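/- Let $N,k\ge 1$, let $m_1,\dots,m_N,a,\gamma,k_B,T>0$ and put $\beta=1/(k_BT)$. Let $U:(\mathbf R^k)^N\to[0,\infty]$ be continuous (as a map into $[0,\infty]$) and normal, i.e.: (A1) $\mathcal O=\{U<\infty\}$ is non-empty, open and connected; (A2) for every $n\in\mathbf N$ the set $\{U<n\}$ has compact closure in $(\mathbf R^k)^N$; (A3) $U\in C^\infty(\mathcal O)$ and $\int_{\mathcal O}e^{-\beta U(q)}\,dq<\infty$; (A4) there is $\zeta\in(1,2)$ such that $|\nabla U(z_n)|\to\infty$ and $|\nabla^2U(z_n)|/|\nabla U(z_n)|^{\zeta}\to0$ for every sequence $(z_n)$ in $\mathcal O$ with $U(z_n)\to\infty$. Put $\mathcal X=\mathcal O\times(\mathbf R^k)^N\times\mathbf R$, with points $x=(q,p,\xi)$, write $\|p\|_m^2=\sum_i|p_i|^2/m_i$ and $H(q,p,\xi)=\tfrac12\|p\|_m^2+U(q)+\tfrac a2\xi^2$, and let $\mathscr L$ be the generator of the stochastic Nosé–Hoover system $$dq_i=\frac{p_i}{m_i}\,dt,\qquad dp_i=-\xi p_i\,dt-\frac{\gamma}{m_i}p_i\,dt-\nabla_{q_i}U(q)\,dt+\sqrt{2\gamma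 k_BT}\,dB_i,\qquad d\xi=\sum_{i=1}^N\frac{|p_i|^2}{am_i}\,dt-\frac{k_BTkN}{a}\,dt,$$ that is, $$\mathscr L=\sum_i\frac{p_i}{m_i}\cdot\nabla_{q_i}-\sum_i\Big(\xi+\frac{\gamma}{m_i}\Big)p_i\cdot\nabla_{p_i}-\nabla U\cdot\nabla_p+\frac1a\Big(\|p\|_m^2-\frac{kN}{\beta}\Big)\partial_\xi+\frac{\gamma}{\beta}\Delta_p .$$ Let $D_{\max}$ be the maximum over $z\in\mathbf R$ of Dawson's integral $D(z)=e^{-z^2}\int_0^ze^{y^2}\,dy$, and put $\beta_*=\beta/(8D_{\max}^2)$. Then for every $\epsilon>0$ and every $\beta_0$ with $0<\beta_0<\beta_*$ there exist $\psi_0,\psi_1,\psi_2\in C^2(\mathcal X)$ such that, with $V=\beta_0H+\psi_0+\psi_1+\psi_2$ and $W=e^V\in C^2(\mathcal X)$: 1. $|\psi_0+\psi_1+\psi_2|\le\epsilon H$ on $\mathcal X$; 2. there are a compact set $A\subseteq\mathcal X$ and constants $\alpha,K>0$ with $\mathscr LV+\gamma k_BT\,|\nabla_pV|^2\le-\alpha+K\mathbf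 1_A$ on $\mathcal X$; 3. $\exp((\beta_0-\epsilon)H)\le W\le\exp((\beta_0+\epsilon)H)$ on $\mathcal X$; 4. there are constants $\alpha,K>0$ with $\mathscr LW\le-\alpha W+K$ on $\mathcal X$. -/

import Mathlib

open Set Filter Topology MeasureTheory
open scoped ENNReal ContDiff

noncomputable section

namespace NHB

/-- Dawson's integral `D(z) = exp(-z²) ∫₀ᶻ exp(y²) dy`. -/
def dawson (z : ℝ) : ℝ := Real.exp (-z ^ 2) * ∫ y in (0 : ℝ)..z, Real.exp (y ^ 2)

/-- The maximum of Dawson's integral over the real line (it is attained,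
see `isGreatest_dawsonMax`). -/
def dawsonMax : ℝ := sSup (range dawson)

theorem continuous_dawson : Continuous dawson := by
  unfold dawson
  refine Continuous.mul (by fun_prop) ?_
  exact intervalIntegral.continuous_primitive
    (fun a b => Continuous.intervalIntegrable (by fun_prop) a b) 0

theorem dawson_neg_le {z : ℝ} (hz : z ≤ 0) : dawson z ≤ 0 := by
  unfold dawson
  refine mul_nonpos_of_nonneg_of_nonpos (Real.exp_pos _).le ?_
  rw [intervalIntegral.integral_symm, neg_nonpos]
  exact intervalIntegral.integral_nonneg hz fun y _ => (Real.exp_pos _).le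

theorem dawson_mul_le {z : ℝ} (hz : 0 < z) : z * dawson z ≤ 1 := by
  have hle : (∫ y in (0 : ℝ)..z, Real.exp (y ^ 2)) ≤ ∫ y in (0 : ℝ)..z, Real.exp (z * y) := by
    refine intervalIntegral.integral_mono_on hz.le
      (Continuous.intervalIntegrable (by fun_prop) _ _)
      (Continuous.intervalIntegrable (by fun_prop) _ _) fun y hy => ?_
    apply Real.exp_le_exp.mpr
    nlinarith [hy.1, hy.2]
  have hint : z * (∫ y in (0 : ℝ)..z, Real.exp (z * y)) = Real.exp (z ^ 2) - 1 := by
    rw [intervalIntegral.mul_integral_comp_mul_left]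
    simp [integral_exp, sq]
  have hpos := Real.exp_pos (-z ^ 2)
  have hmul : Real.exp (-z ^ 2) * Real.exp (z ^ 2) = 1 := by
    rw [← Real.exp_add]; simp
  have h2 := mul_le_mul_of_nonneg_left (mul_le_mul_of_nonneg_left hle hz.le) hpos.le
  rw [hint] at h2
  unfold dawson
  nlinarith

theorem dawson_one_pos : 0 < dawson 1 := by
  unfold dawson
  refine mul_pos (Real.exp_pos _) ?_
  exact intervalIntegral.intervalIntegral_pos_of_pos
    (Continuous.intervalIntegrable (by fun_prop) _ _) (fun y => Real.exp_pos _) one_pos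

/-- `dawsonMax` is the largest value of Dawson's integral. -/
theorem isGreatest_dawsonMax : IsGreatest (range dawson) dawsonMax := by
  have h1 := dawson_one_pos
  set R : ℝ := max 1 (1 / dawson 1)
  obtain ⟨z₀, hz₀, hmax⟩ := (isCompact_Icc (a := (0 : ℝ)) (b := R)).exists_isMaxOn
    ⟨0, by simp [R]⟩ continuous_dawson.continuousOn
  have hone : dawson 1 ≤ dawson z₀ := hmax ⟨zero_le_one, le_max_left _ _⟩
  have key : IsGreatest (range dawson) (dawson z₀) := by
    refine ⟨⟨z₀, rfl⟩, ?_⟩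
    rintro _ ⟨z, rfl⟩
    rcases le_or_gt z 0 with h | h
    · exact (dawson_neg_le h).trans (h1.le.trans hone)
    rcases le_or_gt z R with h' | h'
    · exact hmax ⟨h.le, h'⟩
    · refine le_trans ?_ hone
      have h3 : 1 / dawson 1 < z := lt_of_le_of_lt (le_max_right _ _) h'
      rw [div_lt_iff₀ h1] at h3
      have h4 := dawson_mul_le h
      nlinarith
  unfold dawsonMax
  rw [key.csSup_eq]
  exact key

/-- `(ℝᵏ)ᴺ` with its Euclidean norm; the coordinate `(i, l)` is the `l`-th component of the
`i`-th particle. -/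
abbrev Conf (N k : ℕ) : Type := EuclideanSpace ℝ (Fin N × Fin k)

/-- Ambient space of the points `(q, p, ξ)`. -/
abbrev Phase (N k : ℕ) : Type := Conf N k × Conf N k × ℝ

/-- The positive constants of the system: the masses `m i`, and the auxiliary, friction,
Boltzmann and temperature constants. -/
structure Params (N : ℕ) where
  m : Fin N → ℝ
  a : ℝ
  γ : ℝ
  kB : ℝ
  T : ℝ
  m_pos : ∀ i, 0 < m i
  a_pos : 0 < a
  γ_pos : 0 < γ
  kB_pos : 0 < kB
  T_pos : 0 < T

variable {N k : ℕ}

/-- The inverse temperature `β = 1 / (k_B T)`. -/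
def Params.β (P : Params N) : ℝ := 1 / (P.kB * P.T)

/-- The threshold `β_* = β / (8 D_max²)`. -/
def Params.βStar (P : Params N) : ℝ := P.β / (8 * dawsonMax ^ 2)

/-- The set `𝒪 = {U < ∞}`. -/
def finiteSet (U : Conf N k → ℝ≥0∞) : Set (Conf N k) := {q | U q < ⊤}

/-- The real-valued potential; it is only used on `𝒪`. -/
def pot (U : Conf N k → ℝ≥0∞) (q : Conf N k) : ℝ := (U q).toReal

/-- Normal potentials `U : (ℝᵏ)ᴺ → [0, ∞]`. -/
structure IsNormal (P : Params N) (U : Conf N k → ℝ≥0∞) : Prop where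
  /-- `U` is continuous as a map into `[0, ∞]`, i.e. (given smoothness on the open set `𝒪`)
  `U(q) → ∞` as `q` approaches the boundary of `𝒪`. -/
  continuous : Continuous U
  isOpen : IsOpen (finiteSet U)
  isConnected : IsConnected (finiteSet U)
  compact_sublevel : ∀ n : ℕ, IsCompact (closure {q | U q < n})
  smooth : ContDiffOn ℝ ∞ (pot U) (finiteSet U)
  integrable : IntegrableOn (fun q => Real.exp (-P.β * pot U q)) (finiteSet U) volume
  growth : ∃ ζ : ℝ, 1 < ζ ∧ ζ < 2 ∧ ∀ z : ℕ → Conf N k, (∀ n, z n ∈ finiteSet U) →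
    Tendsto (fun n => U (z n)) atTop (𝓝 ⊤) →
      Tendsto (fun n => ‖gradient (pot U) (z n)‖) atTop atTop ∧
      Tendsto (fun n => ‖fderiv ℝ (gradient (pot U)) (z n)‖ / ‖gradient (pot U) (z n)‖ ^ ζ)
        atTop (𝓝 0)

/-- The state space `𝒳 = 𝒪 × (ℝᵏ)ᴺ × ℝ`. -/
def stateSpace (U : Conf N k → ℝ≥0∞) : Set (Phase N k) := {x | x.1 ∈ finiteSet U}

/-- `‖p‖_m² = ∑ᵢ |pᵢ|² / mᵢ`, twice the kinetic energy. -/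
def massNormSq (P : Params N) (p : Conf N k) : ℝ := ∑ i, (∑ l, p (i, l) ^ 2) / P.m i

/-- The Hamiltonian `H(q, p, ξ) = ‖p‖_m² / 2 + U(q) + a ξ² / 2`. -/
def hamiltonian (P : Params N) (U : Conf N k → ℝ≥0∞) (x : Phase N k) : ℝ :=
  massNormSq P x.2.1 / 2 + pot U x.1 + P.a * x.2.2 ^ 2 / 2

/-- The drift vector field of the stochastic differential equation. -/
def drift (P : Params N) (U : Conf N k → ℝ≥0∞) (x : Phase N k) : Phase N k :=
  (WithLp.toLp 2 fun j => x.2.1 j / P.m j.1,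
   WithLp.toLp 2 fun j =>
     -x.2.2 * x.2.1 j - P.γ / P.m j.1 * x.2.1 j - gradient (pot U) x.1 j,
   massNormSq P x.2.1 / P.a - P.kB * P.T * k * N / P.a)

/-- The unit vector of `Phase N k` in the direction of the momentum coordinate `j`. -/
def momentumDir (j : Fin N × Fin k) : Phase N k := (0, EuclideanSpace.single j 1, 0)

/-- The (constant) vector field that multiplies the `j`-th scalar Brownian motion. -/
def noise (P : Params N) (j : Fin N × Fin k) : Phase N k :=
  √(2 * P.γ * P.kB * P.T) • momentumDir j

/-- The generator `ℒ f = Df · drift + ½ ∑ⱼ D²f(noiseⱼ, noiseⱼ)` of the diffusion, acting on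
functions that are `C²` on the open set `𝒳`. -/
def generator (P : Params N) (U : Conf N k → ℝ≥0∞) (f : Phase N k → ℝ) (x : Phase N k) : ℝ :=
  fderiv ℝ f x (drift P U x) +
    1 / 2 * ∑ j : Fin N × Fin k, fderiv ℝ (fun y => fderiv ℝ f y (noise P j)) x (noise P j)

/-- `|∇_p f|²`. -/
def gradMomentumSq (f : Phase N k → ℝ) (x : Phase N k) : ℝ :=
  ∑ j : Fin N × Fin k, (fderiv ℝ f x (momentumDir j)) ^ 2

end NHB

end

/-! The quantity to control is `ℒV + σ|∇_p V|²` with `σ = γ k_B T`; once it is at most `-1` off a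
compact set and bounded on it, the chain rule `generator_exp` yields the drift bound for `exp V`.
For `V = β₀H` the conservative exchanges cancel, leaving a damping `-c|p|²`, a linear term `-θξ`
with `θ = β₀ k_B T kN`, and a constant. This is already good for large `ξ > 0`, and for large `|p|`
with `ξ ≥ 0`. Three regions remain bad, and each perturbation repairs one.

When `ξ` is very negative and `|p|` is not small, a function of `ξ` alone (`thermostatFun`) produces
`-δκ|ξ||p|²`, which beats the bad term `θ|ξ|` as soon as `|p|` exceeds a fixed radius `ϖ`.

When `|p| ≤ ϖ` and `|∇U|` is large compared with `1 + |ξ|`, the momentum is driven along `-∇U`. A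
bounded regularization of `p·∇U/|∇U|²` (`virialFun`) has a generator as negative as desired, while
the function itself and its momentum gradient are of size `K/C` and can be made small
(`exists_virial_perturbation`).

When `ξ ≈ -n` and `|∇U| ≤ C|ξ|`, the momentum equation is close to `p' = n(p - g(q))` with `g =
∇U/n` bounded: `p` is repelled from a slow manifold `{p = c(q)}`. The distance `w = p - c(q)` then
behaves like an expanding Ornstein–Uhlenbeck process in dimension `kN`, and minus a truncated
logarithm of a quadratic polynomial in `n|w|²/σ` gains `kN n/2`, up to small errors. These
functions, of size `log n`, are glued over `n` by a partition of unity in `ξ`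
(`exists_expanding_perturbation`). The Hessian growth exponent `ζ < 2` is what makes the slow
manifold exist and the cutoff errors `o(n)`.

The gain `kN/2` per unit of `|ξ|` must exceed `θ`, i.e. `β₀ k_B T < 1/2`. The Dawson threshold
implies this because `D_max ≥ 1/2`; nothing else about Dawson's integral is needed. -/

noncomputable section

namespace NHB

/-! ### Approximate slow manifolds by a discretized graph transform. -/

section SlowManifold

variable {E : Type*} [NormedAddCommGroup E] [NormedSpace ℝ E]

/-- A map with controlled values, derivative and modulus of continuity of the derivative. -/
structure IsTame (G L M : ℝ) (c : E → E) : Prop where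
  contDiff : ContDiff ℝ 2 c
  norm_le : ∀ x, ‖c x‖ ≤ G
  fderiv_le : ∀ x, ‖fderiv ℝ c x‖ ≤ L
  fderiv_sub_le : ∀ x y, ‖fderiv ℝ c x - fderiv ℝ c y‖ ≤ M * ‖x - y‖

theorem IsTame.differentiable {G L M : ℝ} {c : E → E} (hc : IsTame G L M c) :
    Differentiable ℝ c := hc.contDiff.differentiable (by norm_num)

theorem IsTame.norm_sub_le {G L M : ℝ} {c : E → E} (hc : IsTame G L M c) (x y : E) :
    ‖c x - c y‖ ≤ L * ‖x - y‖ :=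
  convex_univ.norm_image_sub_le_of_norm_fderiv_le (𝕜 := ℝ)
    (fun z _ => hc.differentiable z) (fun z _ => hc.fderiv_le z) (mem_univ y) (mem_univ x)

theorem IsTame.norm_taylor_le {G L M : ℝ} {c : E → E} (hc : IsTame G L M c) (hM : 0 ≤ M)
    (x v : E) : ‖c (x + v) - c x - fderiv ℝ c x v‖ ≤ M * ‖v‖ * ‖v‖ := by
  have h := (convex_segment x (x + v)).norm_image_sub_le_of_norm_fderiv_le' (𝕜 := ℝ) (f := c)
    (φ := fderiv ℝ c x) (C := M * ‖v‖) (fun z _ => hc.differentiable z) (fun z hz => ?_)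
    (left_mem_segment ℝ x (x + v)) (right_mem_segment ℝ x (x + v))
  · simpa using h
  · refine (hc.fderiv_sub_le z x).trans (mul_le_mul_of_nonneg_left ?_ hM)
    have := norm_sub_le_of_mem_segment hz
    simpa using this

/-- One step of the graph transform for the field `x ↦ A (c x)` with time step `h`. -/
def graphStep (A : E →L[ℝ] E) (g : E → E) (n h : ℝ) (c : E → E) (x : E) : E :=
  (n * h / (1 + n * h)) • g x + (1 / (1 + n * h)) • c (x + h • A (c x))

/-- The step averages `g` with `c` pulled back along one Euler step. The pull-back enlarges
derivative bounds by factors `1 + O(X)` with `X = 2hμL`, while `g` enters with weight proportional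
to `nh` and only half the allowed bounds. Since `8X ≤ nh`, the averaging wins, so the doubled bounds
are preserved. The largest demand is `2(3X + X²) ≤ nh` for the modulus of the derivative; it uses `X
≤ 1` and fixes the constant `16`. -/
theorem IsTame.graphStep {A : E →L[ℝ] E} {g c : E → E} {μ G L M n h : ℝ} (hh : 0 < h)
    (hL : 0 ≤ L) (hM : 0 ≤ M) (hA : ‖A‖ ≤ μ) (hn : 16 * μ * L ≤ n) (hn0 : 0 < n)
    (hx : h * (2 * μ * L) ≤ 1)
    (hg : IsTame G L M g) (hc : IsTame G (2 * L) (2 * M) c) :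
    IsTame G (2 * L) (2 * M) (graphStep A g n h c) := by
  have hμ : 0 ≤ μ := (norm_nonneg A).trans hA
  have hnh : 0 < n * h := mul_pos hn0 hh
  have hden : 0 < 1 + n * h := by linarith
  set lam : ℝ := n * h / (1 + n * h) with hlam
  set om : ℝ := 1 / (1 + n * h) with hom
  have hom0 : 0 ≤ om := by positivity
  have hlam0 : 0 ≤ lam := by positivity
  set Φ : E → E := fun x => x + h • A (c x) with hΦ
  have hΦd : ∀ x, HasFDerivAt Φ (ContinuousLinearMap.id ℝ E + h • A.comp (fderiv ℝ c x)) x := by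
    intro x
    exact (hasFDerivAt_id x).add
      ((A.hasFDerivAt.comp x (hc.differentiable x).hasFDerivAt).const_smul h)
  have hder : ∀ x, fderiv ℝ (NHB.graphStep A g n h c) x = lam • fderiv ℝ g x +
      om • (fderiv ℝ c (Φ x)).comp
        (ContinuousLinearMap.id ℝ E + h • A.comp (fderiv ℝ c x)) := by
    intro x
    exact (((hg.differentiable x).hasFDerivAt.const_smul lam).add
      (((hc.differentiable (Φ x)).hasFDerivAt.comp x (hΦd x)).const_smul om)).fderiv
  set X : ℝ := h * (2 * μ * L) with hX
  have hX0 : 0 ≤ X := by positivity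
  have hB : ∀ x, ‖h • A.comp (fderiv ℝ c x)‖ ≤ X := by
    intro x
    rw [norm_smul, Real.norm_of_nonneg hh.le, hX]
    refine mul_le_mul_of_nonneg_left ((A.opNorm_comp_le _).trans ?_) hh.le
    calc ‖A‖ * ‖fderiv ℝ c x‖ ≤ μ * (2 * L) :=
          mul_le_mul hA (hc.fderiv_le x) (norm_nonneg _) hμ
      _ = 2 * μ * L := by ring
  have hJ : ∀ x, ‖ContinuousLinearMap.id ℝ E + h • A.comp (fderiv ℝ c x)‖ ≤ 1 + X := fun x =>
    (norm_add_le _ _).trans (add_le_add ContinuousLinearMap.norm_id_le (hB x))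
  have hXn : 8 * X ≤ n * h := by rw [hX]; nlinarith
  have hAB : ∀ x y, ‖A (c x) - A (c y)‖ ≤ 2 * μ * L * ‖x - y‖ := by
    intro x y
    rw [← map_sub]
    calc ‖A (c x - c y)‖ ≤ μ * (2 * L * ‖x - y‖) :=
          (A.le_opNorm _).trans (mul_le_mul hA (hc.norm_sub_le x y) (norm_nonneg _) hμ)
      _ = _ := by ring
  have hΦl : ∀ x y, ‖Φ x - Φ y‖ ≤ (1 + X) * ‖x - y‖ := by
    intro x y
    have : Φ x - Φ y = (x - y) + h • (A (c x) - A (c y)) := by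
      simp only [hΦ, smul_sub]; abel
    rw [this]
    refine (norm_add_le _ _).trans ?_
    rw [norm_smul, Real.norm_of_nonneg hh.le]
    have := mul_le_mul_of_nonneg_left (hAB x y) hh.le
    rw [hX]; nlinarith
  have hsum : lam + om = 1 := by rw [hlam, hom]; field_simp; ring
  have hlamom : lam = n * h * om := by rw [hlam, hom]; ring
  refine ⟨?_, fun x => ?_, fun x => ?_, fun x y => ?_⟩
  · have h1 : ContDiff ℝ 2 Φ := contDiff_id.add ((A.contDiff.comp hc.contDiff).const_smul h)
    exact (hg.contDiff.const_smul lam).add ((hc.contDiff.comp h1).const_smul om)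
  · refine (norm_add_le _ _).trans ?_
    rw [norm_smul, norm_smul, Real.norm_of_nonneg hlam0, Real.norm_of_nonneg hom0]
    calc lam * ‖g x‖ + om * ‖c _‖ ≤ lam * G + om * G :=
          add_le_add (mul_le_mul_of_nonneg_left (hg.norm_le x) hlam0)
            (mul_le_mul_of_nonneg_left (hc.norm_le _) hom0)
      _ = G := by rw [← add_mul, hsum, one_mul]
  · rw [hder]
    refine (norm_add_le _ _).trans ?_
    rw [norm_smul, norm_smul, Real.norm_of_nonneg hlam0, Real.norm_of_nonneg hom0]
    have h1 : ‖(fderiv ℝ c (Φ x)).comp (ContinuousLinearMap.id ℝ E + h • A.comp (fderiv ℝ c x))‖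
        ≤ 2 * L * (1 + X) :=
      (ContinuousLinearMap.opNorm_comp_le _ _).trans
        (mul_le_mul (hc.fderiv_le _) (hJ x) (norm_nonneg _) (by positivity))
    have h2 := mul_le_mul_of_nonneg_left (hg.fderiv_le x) hlam0
    have h3 := mul_le_mul_of_nonneg_left h1 hom0
    have h4 : om * (2 * L * X) ≤ lam * L := by
      rw [hlamom]
      have := mul_le_mul_of_nonneg_left hXn (mul_nonneg hom0 hL)
      nlinarith [mul_nonneg (mul_nonneg hom0 hL) hX0]
    calc _ ≤ lam * L + om * (2 * L * (1 + X)) := add_le_add h2 h3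
      _ ≤ 2 * L * (lam + om) := by linarith
      _ = 2 * L := by rw [hsum, mul_one]
  · rw [hder, hder]
    have e : lam • fderiv ℝ g x +
        om • (fderiv ℝ c (Φ x)).comp (ContinuousLinearMap.id ℝ E + h • A.comp (fderiv ℝ c x)) -
        (lam • fderiv ℝ g y +
        om • (fderiv ℝ c (Φ y)).comp (ContinuousLinearMap.id ℝ E + h • A.comp (fderiv ℝ c y))) =
        lam • (fderiv ℝ g x - fderiv ℝ g y) + om •
          ((fderiv ℝ c (Φ x) - fderiv ℝ c (Φ y)).comp
            (ContinuousLinearMap.id ℝ E + h • A.comp (fderiv ℝ c x)) +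
          (fderiv ℝ c (Φ y)).comp (h • A.comp (fderiv ℝ c x - fderiv ℝ c y))) := by
      ext v
      simp only [add_apply, sub_apply,
        smul_apply, ContinuousLinearMap.comp_apply,
        ContinuousLinearMap.id_apply, map_add, map_sub, map_smul, smul_add, smul_sub]
      abel
    rw [e]
    refine (norm_add_le _ _).trans ?_
    rw [norm_smul, norm_smul, Real.norm_of_nonneg hlam0, Real.norm_of_nonneg hom0]
    set D := ‖x - y‖ with hD
    have hD0 : 0 ≤ D := norm_nonneg _
    have h1 : ‖(fderiv ℝ c (Φ x) - fderiv ℝ c (Φ y)).comp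
        (ContinuousLinearMap.id ℝ E + h • A.comp (fderiv ℝ c x))‖ ≤
        2 * M * ((1 + X) * D) * (1 + X) := by
      refine (ContinuousLinearMap.opNorm_comp_le _ _).trans
        (mul_le_mul ?_ (hJ x) (norm_nonneg _) (by positivity))
      exact (hc.fderiv_sub_le _ _).trans
        (mul_le_mul_of_nonneg_left (hΦl x y) (by positivity))
    have h2 : ‖(fderiv ℝ c (Φ y)).comp (h • A.comp (fderiv ℝ c x - fderiv ℝ c y))‖ ≤
        2 * L * (h * (μ * (2 * M * D))) := by
      refine (ContinuousLinearMap.opNorm_comp_le _ _).trans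
        (mul_le_mul (hc.fderiv_le _) ?_ (norm_nonneg _) (by positivity))
      rw [norm_smul, Real.norm_of_nonneg hh.le]
      refine mul_le_mul_of_nonneg_left ((A.opNorm_comp_le _).trans ?_) hh.le
      exact mul_le_mul hA (hc.fderiv_sub_le _ _) (norm_nonneg _) hμ
    have h3 := mul_le_mul_of_nonneg_left ((norm_add_le _ _).trans (add_le_add h1 h2)) hom0
    have h4 := mul_le_mul_of_nonneg_left (hg.fderiv_sub_le x y) hlam0
    have h5 : 2 * L * (h * (μ * (2 * M * D))) = 2 * M * X * D := by rw [hX]; ring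
    have h6 : om * (2 * M * (3 * X + X ^ 2) * D) ≤ lam * (M * D) := by
      rw [hlamom]
      have hMD : 0 ≤ om * (M * D) := by positivity
      have : 2 * (3 * X + X ^ 2) ≤ n * h := by nlinarith
      have := mul_le_mul_of_nonneg_left this hMD
      nlinarith
    rw [h5] at h3
    calc _ ≤ lam * (M * D) + om * (2 * M * ((1 + X) * D) * (1 + X) + 2 * M * X * D) :=
          add_le_add h4 h3
      _ = lam * (M * D) + om * (2 * M * (3 * X + X ^ 2) * D) + om * (2 * M * D) := by ring
      _ ≤ lam * (M * D) + lam * (M * D) + om * (2 * M * D) := by gcongr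
      _ = 2 * M * D * (lam + om) := by ring
      _ = 2 * M * D := by rw [hsum, mul_one]

/-- Changing `c` moves both the evaluated map and the evaluation point; the second effect costs the
Lipschitz constant `2L` times `hμΔ`. The resulting factor is below `1` when `2μL < n`. -/
theorem graphStep_sub_le {A : E →L[ℝ] E} {g c c' : E → E} {μ G L M n h Δ : ℝ} (hh : 0 < h)
    (hL : 0 ≤ L) (hA : ‖A‖ ≤ μ) (hn0 : 0 < n)
    (hc : IsTame G (2 * L) (2 * M) c) (hΔ : ∀ x, ‖c x - c' x‖ ≤ Δ) (x : E) :
    ‖graphStep A g n h c x - graphStep A g n h c' x‖ ≤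
      (1 + h * (2 * μ * L)) / (1 + n * h) * Δ := by
  have hμ : 0 ≤ μ := (norm_nonneg A).trans hA
  have hnh : 0 < n * h := mul_pos hn0 hh
  have hden : 0 < 1 + n * h := by linarith
  have e : graphStep A g n h c x - graphStep A g n h c' x = (1 / (1 + n * h)) •
      ((c (x + h • A (c x)) - c (x + h • A (c' x))) +
        (c (x + h • A (c' x)) - c' (x + h • A (c' x)))) := by
    simp only [graphStep, smul_add, smul_sub]; abel
  have h1 : ‖c (x + h • A (c x)) - c (x + h • A (c' x))‖ ≤ 2 * L * (h * (μ * Δ)) := by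
    refine (hc.norm_sub_le _ _).trans (mul_le_mul_of_nonneg_left ?_ (by positivity))
    rw [add_sub_add_left_eq_sub, ← smul_sub, ← map_sub, norm_smul, Real.norm_of_nonneg hh.le]
    exact mul_le_mul_of_nonneg_left ((A.le_opNorm _).trans
      (mul_le_mul hA (hΔ x) (norm_nonneg _) hμ)) hh.le
  rw [e, norm_smul, Real.norm_of_nonneg (by positivity)]
  calc 1 / (1 + n * h) * _ ≤ 1 / (1 + n * h) * (2 * L * (h * (μ * Δ)) + Δ) :=
        mul_le_mul_of_nonneg_left ((norm_add_le _ _).trans (add_le_add h1 (hΔ _)))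
          (by positivity)
    _ = _ := by ring

/-- A bounded slow vector field `g` has approximate slow manifolds `{p = c q}` for the fast
expanding dynamics `q' = A p`, `p' = n (p - g q)`. -/
theorem exists_slow_manifold {A : E →L[ℝ] E} {g : E → E} {μ G L M n ε : ℝ}
    (hL : 0 ≤ L) (hM : 0 ≤ M) (hA : ‖A‖ ≤ μ) (hn : 16 * μ * L ≤ n) (hn0 : 0 < n)
    (hε : 0 < ε) (hg : IsTame G L M g) :
    ∃ c : E → E, IsTame G (2 * L) (2 * M) c ∧
      ∀ x, ‖fderiv ℝ c x (A (c x)) - n • (c x - g x)‖ ≤ ε := by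
  have hμ : 0 ≤ μ := (norm_nonneg A).trans hA
  have hG : 0 ≤ G := (norm_nonneg _).trans (hg.norm_le 0)
  -- The time step is chosen after `M`, so `M` may be arbitrarily large: it enters only through the
  -- Taylor remainder of the Euler step.
  obtain ⟨h, hh, hx, hhε⟩ : ∃ h : ℝ, 0 < h ∧ h * (2 * μ * L) ≤ 1 ∧
      2 * M * h * (μ * G) ^ 2 ≤ ε / 2 := by
    refine ⟨min (1 / (2 * μ * L + 1)) (ε / 2 / (2 * M * (μ * G) ^ 2 + 1)), by positivity, ?_, ?_⟩
    · have : min (1 / (2 * μ * L + 1)) (ε / 2 / (2 * M * (μ * G) ^ 2 + 1)) ≤ 1 / (2 * μ * L + 1) :=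
        min_le_left _ _
      refine (mul_le_mul_of_nonneg_right this (by positivity)).trans ?_
      rw [div_mul_eq_mul_div, div_le_one (by positivity)]; linarith
    · have : min (1 / (2 * μ * L + 1)) (ε / 2 / (2 * M * (μ * G) ^ 2 + 1)) ≤
        ε / 2 / (2 * M * (μ * G) ^ 2 + 1) := min_le_right _ _
      calc _ = min (1 / (2 * μ * L + 1)) (ε / 2 / (2 * M * (μ * G) ^ 2 + 1)) *
            (2 * M * (μ * G) ^ 2) := by ring
        _ ≤ ε / 2 / (2 * M * (μ * G) ^ 2 + 1) * (2 * M * (μ * G) ^ 2) :=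
            mul_le_mul_of_nonneg_right this (by positivity)
        _ ≤ ε / 2 := by
            rw [div_mul_eq_mul_div, div_le_iff₀ (by positivity)]
            nlinarith
  have hnh : 0 < n * h := mul_pos hn0 hh
  set ρ : ℝ := (1 + h * (2 * μ * L)) / (1 + n * h) with hρ
  have hρ0 : 0 ≤ ρ := by positivity
  have hρ1 : ρ < 1 := by
    rw [hρ, div_lt_one (by positivity)]
    have : 0 ≤ μ * L := by positivity
    nlinarith
  set c : ℕ → E → E := fun k => (graphStep A g n h)^[k] 0 with hcdef
  have hc0 : IsTame G (2 * L) (2 * M) (c 0) := by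
    refine ⟨contDiff_const, fun x => by simpa [hcdef] using hG, fun x => ?_, fun x y => ?_⟩
    · have : c 0 = fun _ => (0 : E) := rfl
      rw [this, fderiv_fun_const]; simp; positivity
    · have : c 0 = fun _ => (0 : E) := rfl
      rw [this, fderiv_fun_const]; simp; positivity
  have hsucc : ∀ k, c (k + 1) = graphStep A g n h (c k) := fun k =>
    Function.iterate_succ_apply' _ _ _
  have hc : ∀ k, IsTame G (2 * L) (2 * M) (c k) := by
    intro k
    induction k with
    | zero => exact hc0
    | succ k ih => rw [hsucc]; exact IsTame.graphStep hh hL hM hA hn hn0 hx hg ih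
  have hdiff : ∀ k x, ‖c (k + 1) x - c k x‖ ≤ ρ ^ k * (2 * G) := by
    intro k
    induction k with
    | zero =>
      intro x
      have := (norm_sub_le _ _).trans (add_le_add ((hc (0 + 1)).norm_le x) ((hc 0).norm_le x))
      linarith
    | succ k ih =>
      intro x
      rw [hsucc (k + 1)]
      nth_rewrite 2 [hsucc k]
      refine (graphStep_sub_le hh hL hA hn0 (hc (k + 1)) ih x).trans (le_of_eq ?_)
      rw [pow_succ]; ring
  -- A late iterate is already invariant up to `ε`. Stopping there keeps `C²` regularity without
  -- passing to a limit.
  obtain ⟨k, hk⟩ : ∃ k : ℕ, (1 + n * h) / h * (ρ ^ k * (2 * G)) ≤ ε / 2 := by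
    have ht : Tendsto (fun k : ℕ => (1 + n * h) / h * (ρ ^ k * (2 * G))) atTop (𝓝 0) := by
      have := ((tendsto_pow_atTop_nhds_zero_of_lt_one hρ0 hρ1).mul_const (2 * G)).const_mul
        ((1 + n * h) / h)
      simpa using this
    exact ((ht.eventually_lt_const (half_pos hε)).exists).imp fun k hk => hk.le
  refine ⟨c k, hc k, fun x => ?_⟩
  set v := A (c k x) with hv
  have hvn : ‖v‖ ≤ μ * G := (A.le_opNorm _).trans
    (mul_le_mul hA ((hc k).norm_le x) (norm_nonneg _) hμ)
  have htay := (hc k).norm_taylor_le (by positivity) x (h • v)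
  have hstep : c k (x + h • v) - c k x =
      (1 + n * h) • (c (k + 1) x - c k x) + (n * h) • (c k x - g x) := by
    rw [hsucc]
    have h1 : (1 + n * h) * (n * h / (1 + n * h)) = n * h := by field_simp
    have h2 : (1 + n * h) * (1 / (1 + n * h)) = 1 := by field_simp
    simp only [graphStep, smul_sub, smul_add, smul_smul, h1, h2, ← hv]
    module
  -- The residual of the invariance equation splits into the increment of the iteration, amplified
  -- by `(1 + nh)/h`, and the Taylor remainder divided by `h`.
  have key : fderiv ℝ (c k) x v - n • (c k x - g x) =
      ((1 + n * h) / h) • (c (k + 1) x - c k x) -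
        (1 / h) • (c k (x + h • v) - c k x - fderiv ℝ (c k) x (h • v)) := by
    rw [hstep, map_smul]
    match_scalars <;> field_simp <;> ring
  rw [key]
  refine (norm_sub_le _ _).trans ?_
  rw [norm_smul, norm_smul, Real.norm_of_nonneg (by positivity : 0 ≤ (1 + n * h) / h),
    Real.norm_of_nonneg (by positivity : 0 ≤ 1 / h)]
  have h1 := (mul_le_mul_of_nonneg_left (hdiff k x)
    (by positivity : 0 ≤ (1 + n * h) / h)).trans hk
  have h2 : 1 / h * ‖c k (x + h • v) - c k x - fderiv ℝ (c k) x (h • v)‖ ≤ ε / 2 := by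
    refine le_trans (mul_le_mul_of_nonneg_left htay (by positivity)) (le_trans ?_ hhε)
    rw [norm_smul, Real.norm_of_nonneg hh.le]
    have h3 : ‖v‖ ^ 2 ≤ (μ * G) ^ 2 := pow_le_pow_left₀ (norm_nonneg _) hvn 2
    calc 1 / h * (2 * M * (h * ‖v‖) * (h * ‖v‖)) = 2 * M * h * ‖v‖ ^ 2 := by
          field_simp
      _ ≤ _ := mul_le_mul_of_nonneg_left h3 (by positivity)
  linarith

end SlowManifold

/-! ### Directional derivatives computed along lines. -/

section LineDerivatives

variable {E : Type*} [NormedAddCommGroup E] [NormedSpace ℝ E]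

theorem hasDerivAt_line (x v : E) (t : ℝ) : HasDerivAt (fun t : ℝ => x + t • v) v t := by
  simpa using ((hasDerivAt_id t).smul_const v).const_add x

theorem fderiv_apply_eq_of_line {f : E → ℝ} {x v : E} {D : ℝ} (hf : DifferentiableAt ℝ f x)
    (h : HasDerivAt (fun t : ℝ => f (x + t • v)) D 0) : fderiv ℝ f x v = D := by
  have h0 : HasFDerivAt f (fderiv ℝ f x) (x + (0 : ℝ) • v) := by simpa using hf.hasFDerivAt
  exact (h0.comp_hasDerivAt (0 : ℝ) (hasDerivAt_line x v 0)).unique h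

theorem differentiableAt_fderiv_apply {f : E → ℝ} {x : E} (hf : ContDiffAt ℝ 2 f x) (v : E) :
    DifferentiableAt ℝ (fun y => fderiv ℝ f y v) x :=
  ((hf.fderiv_right (m := 1) (by norm_num)).differentiableAt (by norm_num)).clm_apply
    (differentiableAt_const v)

theorem eventually_differentiableAt {f : E → ℝ} {x : E} (hf : ContDiffAt ℝ 2 f x) :
    ∀ᶠ y in 𝓝 x, DifferentiableAt ℝ f y :=
  (hf.eventually (by simp)).mono fun _ hy => hy.differentiableAt (by norm_num)

/-- Lets every momentum Laplacian be computed by one-variable calculus on `t ↦ f (x + t • v)`. -/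
theorem fderiv_fderiv_eq_of_line {f : E → ℝ} {x v : E} {g : ℝ → ℝ} {D : ℝ}
    (hf : ContDiffAt ℝ 2 f x)
    (h : ∀ t, HasDerivAt (fun s : ℝ => f (x + s • v)) (g t) t) (hg : HasDerivAt g D 0) :
    fderiv ℝ (fun y => fderiv ℝ f y v) x v = D := by
  refine fderiv_apply_eq_of_line (differentiableAt_fderiv_apply hf v)
    (hg.congr_of_eventuallyEq ?_)
  have hc : Tendsto (fun t : ℝ => x + t • v) (𝓝 0) (𝓝 x) := by
    have := (hasDerivAt_line x v 0).continuousAt.tendsto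
    simpa using this
  filter_upwards [hc.eventually (eventually_differentiableAt hf)] with t ht
  refine fderiv_apply_eq_of_line ht ?_
  have h0 : HasDerivAt (fun s : ℝ => f (x + s • v)) (g t) (t + 0) := by simpa using h t
  have := h0.comp_const_add t 0
  refine this.congr_of_eventuallyEq (Eventually.of_forall fun s => ?_)
  simp only [add_smul, add_assoc]

end LineDerivatives

/-! ### Algebra of the generator. -/

section Generator

variable {N k : ℕ}

/-- `Δ_p f`. -/
def momentumLaplacian (f : Phase N k → ℝ) (x : Phase N k) : ℝ :=
  ∑ j : Fin N × Fin k, fderiv ℝ (fun y => fderiv ℝ f y (momentumDir j)) x (momentumDir j)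

/-- The diffusivity `γ k_B T`. -/
def Params.σ (P : Params N) : ℝ := P.γ * P.kB * P.T

theorem Params.σ_pos (P : Params N) : 0 < P.σ :=
  mul_pos (mul_pos P.γ_pos P.kB_pos) P.T_pos

theorem generator_eq {P : Params N} {U : Conf N k → ℝ≥0∞} {f : Phase N k → ℝ} {x : Phase N k}
    (hf : ContDiffAt ℝ 2 f x) :
    generator P U f x = fderiv ℝ f x (drift P U x) + P.σ * momentumLaplacian f x := by
  have hs : √(2 * P.γ * P.kB * P.T) * √(2 * P.γ * P.kB * P.T) = 2 * P.σ := by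
    have := P.σ_pos
    rw [Real.mul_self_sqrt] <;> unfold Params.σ at * <;> linarith
  unfold generator momentumLaplacian
  rw [Finset.mul_sum, Finset.mul_sum]
  congr 1
  refine Finset.sum_congr rfl fun j _ => ?_
  have e : (fun y => fderiv ℝ f y (noise P j)) =
      fun y => √(2 * P.γ * P.kB * P.T) * fderiv ℝ f y (momentumDir j) := by
    ext y; simp [noise]
  rw [e, fderiv_const_mul (differentiableAt_fderiv_apply hf _)]
  simp only [noise, map_smul, smul_apply, smul_eq_mul]
  linear_combination (1 / 2 * fderiv ℝ (fun y => fderiv ℝ f y (momentumDir j)) x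
    (momentumDir j)) * hs

theorem generator_congr {P : Params N} {U : Conf N k → ℝ≥0∞} {f g : Phase N k → ℝ}
    {x : Phase N k} (h : f =ᶠ[𝓝 x] g) : generator P U f x = generator P U g x := by
  unfold generator
  rw [h.fderiv_eq]
  congr 2
  refine Finset.sum_congr rfl fun j _ => ?_
  have : (fun y => fderiv ℝ f y (noise P j)) =ᶠ[𝓝 x] fun y => fderiv ℝ g y (noise P j) := by
    filter_upwards [h.fderiv (𝕜 := ℝ)] with y hy
    rw [hy]
  rw [this.fderiv_eq]

theorem fderiv_fderiv_add {f g : Phase N k → ℝ} {x v : Phase N k} (hf : ContDiffAt ℝ 2 f x)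
    (hg : ContDiffAt ℝ 2 g x) :
    fderiv ℝ (fun y => fderiv ℝ (fun z => f z + g z) y v) x =
      fderiv ℝ (fun y => fderiv ℝ f y v) x + fderiv ℝ (fun y => fderiv ℝ g y v) x := by
  rw [← fderiv_fun_add (differentiableAt_fderiv_apply hf v) (differentiableAt_fderiv_apply hg v)]
  refine Filter.EventuallyEq.fderiv_eq ?_
  filter_upwards [eventually_differentiableAt hf, eventually_differentiableAt hg] with y h1 h2
  rw [fderiv_fun_add h1 h2, add_apply]

theorem generator_add {P : Params N} {U : Conf N k → ℝ≥0∞} {f g : Phase N k → ℝ}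
    {x : Phase N k} (hf : ContDiffAt ℝ 2 f x) (hg : ContDiffAt ℝ 2 g x) :
    generator P U (fun y => f y + g y) x = generator P U f x + generator P U g x := by
  unfold generator
  rw [fderiv_fun_add (hf.differentiableAt (by norm_num)) (hg.differentiableAt (by norm_num))]
  simp only [fderiv_fderiv_add hf hg, add_apply, Finset.sum_add_distrib]
  ring

theorem generator_const (P : Params N) (U : Conf N k → ℝ≥0∞) (c : ℝ) (x : Phase N k) :
    generator P U (fun _ => c) x = 0 := by
  simp [generator]

theorem generator_sum {P : Params N} {U : Conf N k → ℝ≥0∞} {F : ℕ → Phase N k → ℝ}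
    {x : Phase N k} (s : Finset ℕ) (hF : ∀ n ∈ s, ContDiffAt ℝ 2 (F n) x) :
    generator P U (fun y => ∑ n ∈ s, F n y) x = ∑ n ∈ s, generator P U (F n) x := by
  classical
  induction s using Finset.induction_on with
  | empty => simpa using generator_const P U 0 x
  | insert a s ha ih =>
    simp only [Finset.sum_insert ha]
    rw [generator_add (hF a (Finset.mem_insert_self _ _))
      (ContDiffAt.sum fun n hn => hF n (Finset.mem_insert_of_mem hn)),
      ih fun n hn => hF n (Finset.mem_insert_of_mem hn)]

/-- The second derivative of the exponential adds the square of the first; only noise directions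
contribute, hence `σ|∇_p V|²`. This turns a bound on the exponent into a Lyapunov bound. -/
theorem generator_exp {P : Params N} {U : Conf N k → ℝ≥0∞} {V : Phase N k → ℝ}
    {x : Phase N k} (hV : ContDiffAt ℝ 2 V x) :
    generator P U (fun y => Real.exp (V y)) x =
      Real.exp (V x) * (generator P U V x + P.σ * gradMomentumSq V x) := by
  have hW : ContDiffAt ℝ 2 (fun y => Real.exp (V y)) x := hV.exp
  rw [generator_eq hW, generator_eq hV, fderiv_exp (hV.differentiableAt (by norm_num))]
  have key : ∀ v, fderiv ℝ (fun y => fderiv ℝ (fun z => Real.exp (V z)) y v) x v =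
      Real.exp (V x) * (fderiv ℝ (fun y => fderiv ℝ V y v) x v + (fderiv ℝ V x v) ^ 2) := by
    intro v
    have e : (fun y => fderiv ℝ (fun z => Real.exp (V z)) y v) =ᶠ[𝓝 x]
        fun y => Real.exp (V y) * fderiv ℝ V y v := by
      filter_upwards [eventually_differentiableAt hV] with y hy
      rw [fderiv_exp hy]; simp
    rw [e.fderiv_eq, fderiv_fun_mul (hV.differentiableAt (by norm_num)).exp
      (differentiableAt_fderiv_apply hV v), fderiv_exp (hV.differentiableAt (by norm_num))]
    simp only [add_apply, smul_apply, smul_eq_mul]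
    ring
  simp only [momentumLaplacian, key, gradMomentumSq, smul_apply, smul_eq_mul,
    Finset.mul_sum, mul_add, Finset.sum_add_distrib]
  ring_nf

end Generator

/-! ### The Dawson bound and the radial profile for the expanding Ornstein–Uhlenbeck operator. -/

section Profile

/-- Integrating `exp(y²) ≥ 1 + y² + y⁴/2` over `[0, 1]` gives `43/30`, and `exp(-1) ≥ 100/272`; the
product exceeds `1/2`. -/
theorem half_le_dawson_one : 1 / 2 ≤ dawson 1 := by
  have h1 : (43 / 30 : ℝ) ≤ ∫ y in (0 : ℝ)..1, Real.exp (y ^ 2) := by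
    have h2 : (∫ y in (0 : ℝ)..1, (1 + y ^ 2 + y ^ 4 / 2)) = 43 / 30 := by
      rw [intervalIntegral.integral_add, intervalIntegral.integral_add,
        intervalIntegral.integral_div] <;>
        first
        | exact Continuous.intervalIntegrable (by fun_prop) _ _
        | (simp only [integral_pow, intervalIntegral.integral_const]; norm_num)
    rw [← h2]
    refine intervalIntegral.integral_mono_on zero_le_one
      (Continuous.intervalIntegrable (by fun_prop) _ _)
      (Continuous.intervalIntegrable (by fun_prop) _ _) fun y _ => ?_
    have := Real.quadratic_le_exp_of_nonneg (sq_nonneg y)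
    nlinarith
  have h3 : Real.exp (-(1 : ℝ) ^ 2) * Real.exp 1 = 1 := by rw [← Real.exp_add]; norm_num
  have h4 := Real.exp_one_lt_d9
  have h5 := Real.exp_pos (-(1 : ℝ) ^ 2)
  have h6 : (100 / 272 : ℝ) ≤ Real.exp (-(1 : ℝ) ^ 2) := by
    rw [eq_inv_of_mul_eq_one_left h3, le_inv_comm₀ (by norm_num) (Real.exp_pos 1)]
    exact h4.le.trans (by norm_num)
  calc (1 / 2 : ℝ) ≤ 100 / 272 * (43 / 30) := by norm_num
    _ ≤ dawson 1 := mul_le_mul h6 h1 (by norm_num) h5.le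

theorem half_le_dawsonMax : 1 / 2 ≤ dawsonMax :=
  half_le_dawson_one.trans (isGreatest_dawsonMax.2 ⟨1, rfl⟩)

/-- From `D_max ≥ 1/2` one has `8 D_max² ≥ 2`, so `β_* ≤ β/2`. This is the only form in which the
threshold is used. -/
theorem mul_lt_half_of_lt_βStar {N : ℕ} {P : Params N} {β₀ : ℝ} (h : β₀ < P.βStar) :
    β₀ * (P.kB * P.T) < 1 / 2 := by
  have hk : 0 < P.kB * P.T := mul_pos P.kB_pos P.T_pos
  have hD := half_le_dawsonMax
  have h1 : P.βStar * (P.kB * P.T) ≤ 1 / 2 := by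
    unfold Params.βStar Params.β
    rw [div_div, div_mul_eq_mul_div, div_le_iff₀ (by positivity)]
    have h2 : 1 / 4 ≤ dawsonMax ^ 2 := by nlinarith
    nlinarith [mul_le_mul_of_nonneg_left h2 hk.le]
  nlinarith

/-- The quadratic polynomial whose logarithm is used as a radial profile. -/
def profilePoly (ρ : ℝ) : ℝ := 1 + 3 / 5 * ρ + 1 / 4 * ρ ^ 2

theorem profilePoly_pos (ρ : ℝ) : 0 < profilePoly ρ := by
  unfold profilePoly; nlinarith [sq_nonneg (ρ + 6 / 5)]

/-- The logarithmic derivative of `profilePoly`. -/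
def profileLogDeriv (ρ : ℝ) : ℝ := (3 / 5 + 1 / 2 * ρ) / profilePoly ρ

/-- The derivative of `profileLogDeriv`. -/
def profileLogDeriv' (ρ : ℝ) : ℝ :=
  (1 / 2 * profilePoly ρ - (3 / 5 + 1 / 2 * ρ) * (3 / 5 + 1 / 2 * ρ)) / profilePoly ρ ^ 2

theorem hasDerivAt_profilePoly (ρ : ℝ) : HasDerivAt profilePoly (3 / 5 + 1 / 2 * ρ) ρ := by
  have h : HasDerivAt profilePoly
      (3 / 5 * 1 + 1 / 4 * (2 * ρ ^ 1 * 1)) ρ :=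
    (((hasDerivAt_id ρ).const_mul (3 / 5 : ℝ)).const_add 1).add
      (((hasDerivAt_id ρ).pow 2).const_mul (1 / 4 : ℝ))
  exact h.congr_deriv (by ring)

theorem hasDerivAt_log_profilePoly (ρ : ℝ) :
    HasDerivAt (fun ρ => Real.log (profilePoly ρ)) (profileLogDeriv ρ) ρ :=
  (hasDerivAt_profilePoly ρ).log (profilePoly_pos ρ).ne'

theorem hasDerivAt_profileLogDeriv (ρ : ℝ) :
    HasDerivAt profileLogDeriv (profileLogDeriv' ρ) ρ := by
  have h1 : HasDerivAt (fun ρ : ℝ => 3 / 5 + 1 / 2 * ρ) (1 / 2 : ℝ) ρ := by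
    simpa using ((hasDerivAt_id ρ).const_mul (1 / 2 : ℝ)).const_add (3 / 5 : ℝ)
  exact h1.div (hasDerivAt_profilePoly ρ) (profilePoly_pos ρ).ne'

theorem contDiff_log_profilePoly : ContDiff ℝ 2 (fun ρ => Real.log (profilePoly ρ)) := by
  refine ContDiff.log ?_ fun ρ => (profilePoly_pos ρ).ne'
  unfold profilePoly; fun_prop

theorem profileLogDeriv_bounds {ρ : ℝ} (hρ : 0 ≤ ρ) :
    0 ≤ profileLogDeriv ρ ∧ profileLogDeriv ρ ≤ 1 ∧ ρ * profileLogDeriv ρ ≤ 2 ∧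
      |profileLogDeriv' ρ| ≤ 1 := by
  have hq := profilePoly_pos ρ
  refine ⟨by unfold profileLogDeriv; positivity, ?_, ?_, ?_⟩
  · unfold profileLogDeriv
    rw [div_le_one hq]; unfold profilePoly; nlinarith
  · unfold profileLogDeriv
    rw [← mul_div_assoc, div_le_iff₀ hq]; unfold profilePoly; nlinarith
  · unfold profileLogDeriv'
    rw [abs_le, le_div_iff₀ (by positivity), div_le_iff₀ (by positivity)]
    have h1 : 1 + 3 / 5 * ρ ≤ profilePoly ρ := by unfold profilePoly; nlinarith
    constructor <;> nlinarith

/-- In the scaled variable `ρ = r/d` this is the generator inequality for `Φ = -(d/2) log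
profilePoly`. It is affine in `d`, so it suffices that the value at `d = 1` and the slope have the
right sign. After clearing denominators both are polynomial inequalities on `ρ ≥ 0`, and the
coefficients `3/5` and `1/4` make them true. -/
theorem profile_inequality {d ρ : ℝ} (hd : 1 ≤ d) (hρ : 0 ≤ ρ) :
    -d * (ρ + 1) * profileLogDeriv ρ - 2 * ρ * profileLogDeriv' ρ +
      d * ρ * profileLogDeriv ρ ^ 2 ≤ -d / 2 := by
  have hq := profilePoly_pos ρ
  have h0 : 0 ≤ (ρ + 1) * (3 / 5 + 1 / 2 * ρ) * profilePoly ρ - ρ * (3 / 5 + 1 / 2 * ρ) ^ 2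
      - 1 / 2 * profilePoly ρ ^ 2 := by
    unfold profilePoly
    nlinarith [pow_nonneg hρ 2, pow_nonneg hρ 3, pow_nonneg hρ 4, mul_nonneg hρ (sq_nonneg (ρ - 1)),
      sq_nonneg (ρ - 1), sq_nonneg (ρ ^ 2 - ρ), sq_nonneg (ρ ^ 2 - 1)]
  have h1 : 0 ≤ (ρ + 1) * (3 / 5 + 1 / 2 * ρ) * profilePoly ρ - ρ * (3 / 5 + 1 / 2 * ρ) ^ 2
      - 1 / 2 * profilePoly ρ ^ 2 +
      2 * ρ * (1 / 2 * profilePoly ρ - (3 / 5 + 1 / 2 * ρ) * (3 / 5 + 1 / 2 * ρ)) := by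
    unfold profilePoly
    nlinarith [pow_nonneg hρ 2, pow_nonneg hρ 3, pow_nonneg hρ 4, mul_nonneg hρ (sq_nonneg (ρ - 1)),
      sq_nonneg (ρ - 1), sq_nonneg (ρ ^ 2 - ρ), sq_nonneg (ρ ^ 2 - 1)]
  have h2 := add_nonneg (mul_nonneg (sub_nonneg.2 hd) h0) h1
  have e : -d * (ρ + 1) * profileLogDeriv ρ - 2 * ρ * profileLogDeriv' ρ +
      d * ρ * profileLogDeriv ρ ^ 2 - -d / 2 =
      -((d - 1) * ((ρ + 1) * (3 / 5 + 1 / 2 * ρ) * profilePoly ρ -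
        ρ * (3 / 5 + 1 / 2 * ρ) ^ 2 - 1 / 2 * profilePoly ρ ^ 2) +
      ((ρ + 1) * (3 / 5 + 1 / 2 * ρ) * profilePoly ρ - ρ * (3 / 5 + 1 / 2 * ρ) ^ 2
      - 1 / 2 * profilePoly ρ ^ 2 +
      2 * ρ * (1 / 2 * profilePoly ρ - (3 / 5 + 1 / 2 * ρ) * (3 / 5 + 1 / 2 * ρ)))) /
      profilePoly ρ ^ 2 := by
    unfold profileLogDeriv profileLogDeriv'
    field_simp
    ring
  have h3 : -d * (ρ + 1) * profileLogDeriv ρ - 2 * ρ * profileLogDeriv' ρ +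
      d * ρ * profileLogDeriv ρ ^ 2 - -d / 2 ≤ 0 := by
    rw [e]
    exact div_nonpos_of_nonpos_of_nonneg (by linarith) (by positivity)
  linarith

/-- Data of a radial profile `Φ(r)`, `r = |y|²`, for the `d`-dimensional expanding
Ornstein–Uhlenbeck operator. -/
structure IsProfile (d C M : ℝ) (Φ Φ' Φ'' : ℝ → ℝ) : Prop where
  contDiff : ContDiff ℝ 2 Φ
  hasDerivAt : ∀ r, HasDerivAt Φ (Φ' r) r
  hasDerivAt' : ∀ r, HasDerivAt Φ' (Φ'' r) r
  abs_le : ∀ r, 0 ≤ r → |Φ r| ≤ C * (1 + Real.log M)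
  abs_deriv_le : ∀ r, 0 ≤ r → |Φ' r| ≤ C
  abs_mul_deriv_le : ∀ r, 0 ≤ r → |r * Φ' r| ≤ C
  ineq : ∀ r, 0 ≤ r →
    2 * (r + d) * Φ' r + 4 * r * Φ'' r + 4 * r * Φ' r ^ 2 ≤ -d / 2 + C * (1 + r) / M

theorem exists_profile {d : ℝ} (hd : 1 ≤ d) :
    ∃ C : ℝ, 0 < C ∧ ∀ M : ℝ, 1 ≤ M → ∃ Φ Φ' Φ'' : ℝ → ℝ, IsProfile d C M Φ Φ' Φ'' := by
  have hd0 : 0 < d := by linarith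
  refine ⟨4 + 2 * d, by positivity, fun M hM => ?_⟩
  have hM0 : 0 < M := by linarith
  set L : ℝ → ℝ := fun ρ => Real.log (profilePoly ρ) with hL
  have hsc : ∀ c r : ℝ, HasDerivAt (fun r : ℝ => r / c) (1 / c) r := fun c r => by
    simpa using (hasDerivAt_id r).div_const c
  -- Subtracting the same logarithm at scale `dM` makes the unbounded profile bounded by a multiple
  -- of `log M`; far inside that scale the correction is negligible.
  refine ⟨fun r => -(d / 2) * (L (r / d) - L (r / (d * M))),
    fun r => -(d / 2) * (profileLogDeriv (r / d) * (1 / d) -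
      profileLogDeriv (r / (d * M)) * (1 / (d * M))),
    fun r => -(d / 2) * (profileLogDeriv' (r / d) * (1 / d) * (1 / d) -
      profileLogDeriv' (r / (d * M)) * (1 / (d * M)) * (1 / (d * M))), ?_⟩
  refine ⟨?_, fun r => ?_, fun r => ?_, fun r hr => ?_, fun r hr => ?_, fun r hr => ?_,
    fun r hr => ?_⟩
  · have h1 : ∀ c : ℝ, ContDiff ℝ 2 fun r : ℝ => L (r / c) := fun c =>
      contDiff_log_profilePoly.comp (contDiff_id.div_const c)
    exact contDiff_const.mul ((h1 d).sub (h1 (d * M)))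
  · have h1 : ∀ c : ℝ, HasDerivAt (fun r : ℝ => L (r / c)) (profileLogDeriv (r / c) * (1 / c)) r :=
      fun c => HasDerivAt.comp (h₂ := L) r (hasDerivAt_log_profilePoly (r / c)) (hsc c r)
    exact ((h1 d).sub (h1 (d * M))).const_mul _
  · have h1 : ∀ c : ℝ, HasDerivAt (fun r : ℝ => profileLogDeriv (r / c) * (1 / c))
        (profileLogDeriv' (r / c) * (1 / c) * (1 / c)) r :=
      fun c => ((hasDerivAt_profileLogDeriv (r / c)).comp r (hsc c r)).mul_const _
    exact ((h1 d).sub (h1 (d * M))).const_mul _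
  · have hlogM : 0 ≤ Real.log M := Real.log_nonneg hM
    have e : r / (d * M) = r / d / M := by rw [div_div]
    rw [e]
    have hρ : 0 ≤ r / d := by positivity
    generalize r / d = ρ at hρ
    have h0 : 0 ≤ ρ / M := by positivity
    have h1 : ρ / M ≤ ρ := div_le_self hρ hM
    have hlow : L (ρ / M) ≤ L ρ := by
      refine Real.log_le_log (profilePoly_pos _) ?_
      unfold profilePoly; nlinarith
    have hup : L ρ ≤ 2 * Real.log M + L (ρ / M) := by
      have : 2 * Real.log M = Real.log (M ^ 2) := by rw [Real.log_pow]; norm_num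
      rw [this, hL]
      simp only
      rw [← Real.log_mul (by positivity) (profilePoly_pos _).ne']
      refine Real.log_le_log (profilePoly_pos _) ?_
      have e2 : M ^ 2 * profilePoly (ρ / M) = M ^ 2 + 3 / 5 * (M * ρ) + 1 / 4 * ρ ^ 2 := by
        unfold profilePoly; field_simp
      rw [e2]; unfold profilePoly; nlinarith
    rw [abs_le]
    constructor <;> nlinarith
  · obtain ⟨a0, a1, a2, a3⟩ := profileLogDeriv_bounds (ρ := r / d) (by positivity)
    obtain ⟨b0, b1, b2, b3⟩ := profileLogDeriv_bounds (ρ := r / (d * M)) (by positivity)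
    have e : -(d / 2) * (profileLogDeriv (r / d) * (1 / d) -
        profileLogDeriv (r / (d * M)) * (1 / (d * M))) =
        -(1 / 2) * (profileLogDeriv (r / d) - profileLogDeriv (r / (d * M)) / M) := by
      field_simp
    have h1 : profileLogDeriv (r / (d * M)) / M ≤ 1 := (div_le_self b0 hM).trans b1
    have h2 : 0 ≤ profileLogDeriv (r / (d * M)) / M := by positivity
    rw [e, abs_le]
    constructor <;> linarith
  · obtain ⟨a0, a1, a2, a3⟩ := profileLogDeriv_bounds (ρ := r / d) (by positivity)
    obtain ⟨b0, b1, b2, b3⟩ := profileLogDeriv_bounds (ρ := r / (d * M)) (by positivity)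
    have e : r * (-(d / 2) * (profileLogDeriv (r / d) * (1 / d) -
        profileLogDeriv (r / (d * M)) * (1 / (d * M)))) =
        -(d / 2) * (r / d * profileLogDeriv (r / d) -
          r / (d * M) * profileLogDeriv (r / (d * M))) := by ring
    have h1 : 0 ≤ r / d * profileLogDeriv (r / d) := by positivity
    have h2 : 0 ≤ r / (d * M) * profileLogDeriv (r / (d * M)) := by positivity
    rw [e, abs_le]
    constructor <;> nlinarith
  · obtain ⟨a0, a1, a2, a3⟩ := profileLogDeriv_bounds (ρ := r / d) (by positivity)
    obtain ⟨b0, b1, b2, b3⟩ := profileLogDeriv_bounds (ρ := r / (d * M)) (by positivity)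
    have hi := profile_inequality hd (ρ := r / d) (by positivity)
    set a := profileLogDeriv (r / d)
    set a' := profileLogDeriv' (r / d)
    set b := profileLogDeriv (r / (d * M))
    set b' := profileLogDeriv' (r / (d * M))
    have e : 2 * (r + d) * (-(d / 2) * (a * (1 / d) - b * (1 / (d * M)))) +
        4 * r * (-(d / 2) * (a' * (1 / d) * (1 / d) - b' * (1 / (d * M)) * (1 / (d * M)))) +
        4 * r * (-(d / 2) * (a * (1 / d) - b * (1 / (d * M)))) ^ 2 =
        (-d * (r / d + 1) * a - 2 * (r / d) * a' + d * (r / d) * a ^ 2) +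
        ((r + d) * b + 2 * (r * b' / (d * M)) - 2 * r * (a * b) + r * (b ^ 2 / M)) / M := by
      field_simp
      ring
    rw [e]
    refine add_le_add hi ?_
    refine div_le_div_of_nonneg_right ?_ hM0.le
    have hb' : r * b' / (d * M) ≤ r := by
      rw [div_le_iff₀ (by positivity)]
      refine mul_le_mul_of_nonneg_left ?_ hr
      have : 1 ≤ d * M := by nlinarith
      exact (le_abs_self _).trans (b3.trans this)
    have hb2 : b ^ 2 / M ≤ 1 := by
      rw [div_le_one hM0]; nlinarith
    have h1 : (r + d) * b ≤ r + d := by nlinarith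
    -- The cross term of the squared gradient, between the two scales, is favourable and is dropped.
    have h2 : 0 ≤ r * (a * b) := by positivity
    nlinarith [mul_le_mul_of_nonneg_left hb2 hr]

end Profile

/-! ### The derivative of the smooth step. -/

section SmoothTransition

theorem differentiable_smoothTransition : Differentiable ℝ Real.smoothTransition :=
  (Real.smoothTransition.contDiff (n := 1)).differentiable (by norm_num)

theorem deriv_smoothTransition_of_one_lt {x : ℝ} (hx : 1 < x) :
    deriv Real.smoothTransition x = 0 := by
  have : Real.smoothTransition =ᶠ[𝓝 x] fun _ => 1 := by
    filter_upwards [lt_mem_nhds hx] with y hy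
    exact Real.smoothTransition.one_of_one_le hy.le
  rw [this.deriv_eq]; simp

theorem deriv_smoothTransition_of_neg {x : ℝ} (hx : x < 0) :
    deriv Real.smoothTransition x = 0 := by
  have : Real.smoothTransition =ᶠ[𝓝 x] fun _ => 0 := by
    filter_upwards [gt_mem_nhds hx] with y hy
    exact Real.smoothTransition.zero_of_nonpos hy.le
  rw [this.deriv_eq]; simp

theorem exists_abs_deriv_smoothTransition_le :
    ∃ B : ℝ, 0 < B ∧ ∀ x, |deriv Real.smoothTransition x| ≤ B := by
  have hc : Continuous (deriv Real.smoothTransition) :=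
    (Real.smoothTransition.contDiff (n := 1)).continuous_deriv le_rfl
  obtain ⟨B, hB⟩ := (isCompact_Icc (a := (0 : ℝ)) (b := 1)).exists_bound_of_continuousOn
    hc.continuousOn
  refine ⟨|B| + 1, by positivity, fun x => ?_⟩
  have h0 := abs_nonneg B
  rcases lt_or_ge x 0 with h | h
  · rw [deriv_smoothTransition_of_neg h, abs_zero]; linarith
  rcases lt_or_ge 1 x with h' | h'
  · rw [deriv_smoothTransition_of_one_lt h', abs_zero]; linarith
  · have := hB x ⟨h, h'⟩
    rw [Real.norm_eq_abs] at this
    linarith [le_abs_self B]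

end SmoothTransition

/-! ### Consequences of normality; cutoffs at a level of `|∇U|`. -/

section Potential

variable {N k : ℕ} {P : Params N} {U : Conf N k → ℝ≥0∞}

theorem IsNormal.contDiffAt_pot (hU : IsNormal P U) {q : Conf N k} (hq : q ∈ finiteSet U) :
    ContDiffAt ℝ ∞ (pot U) q :=
  hU.smooth.contDiffAt (hU.isOpen.mem_nhds hq)

theorem IsNormal.contDiffAt_gradient (hU : IsNormal P U) {q : Conf N k}
    (hq : q ∈ finiteSet U) : ContDiffAt ℝ ∞ (gradient (pot U)) q :=
  (InnerProductSpace.toDual ℝ (Conf N k)).symm.contDiff.contDiffAt.comp q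
    ((hU.contDiffAt_pot hq).fderiv_right (m := ∞) (by simp))

theorem IsNormal.hasFDerivAt_gradient (hU : IsNormal P U) {q : Conf N k}
    (hq : q ∈ finiteSet U) :
    HasFDerivAt (gradient (pot U)) (fderiv ℝ (gradient (pot U)) q) q :=
  ((hU.contDiffAt_gradient hq).differentiableAt (by simp)).hasFDerivAt

theorem fderiv_pot_apply (U : Conf N k → ℝ≥0∞) (q v : Conf N k) : fderiv ℝ (pot U) q v = inner ℝ (gradient (pot U) q) v :=
  (inner_gradient_left).symm

theorem pot_nonneg (U : Conf N k → ℝ≥0∞) (q : Conf N k) : 0 ≤ pot U q := ENNReal.toReal_nonneg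

theorem IsNormal.isCompact_le (hU : IsNormal P U) (M : ℕ) : IsCompact {q | U q ≤ M} := by
  refine (hU.compact_sublevel (M + 1)).of_isClosed_subset
    (isClosed_le hU.continuous continuous_const) fun q hq => subset_closure ?_
  have hq' : U q ≤ M := hq
  refine lt_of_le_of_lt hq' ?_
  exact_mod_cast Nat.lt_succ_self M

theorem le_subset_finiteSet (U : Conf N k → ℝ≥0∞) (M : ℕ) : {q | U q ≤ M} ⊆ finiteSet U :=
  fun q hq => by
    have hq' : U q ≤ M := hq
    exact lt_of_le_of_lt hq' (ENNReal.natCast_lt_top M)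

theorem IsNormal.continuousOn_gradient (hU : IsNormal P U) :
    ContinuousOn (gradient (pot U)) (finiteSet U) :=
  fun _ hq => (hU.contDiffAt_gradient hq).continuousAt.continuousWithinAt

theorem IsNormal.continuousOn_fderiv_gradient (hU : IsNormal P U) :
    ContinuousOn (fderiv ℝ (gradient (pot U))) (finiteSet U) :=
  fun _ hq => ((hU.contDiffAt_gradient hq).fderiv_right (m := 0)
    (by simp)).continuousAt.continuousWithinAt

theorem tendsto_top_of_natCast_lt {z : ℕ → Conf N k} (hz : ∀ n : ℕ, (n : ℝ≥0∞) < U (z n)) :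
    Tendsto (fun n => U (z n)) atTop (𝓝 ⊤) := by
  rw [ENNReal.tendsto_nhds_top_iff_nat]
  intro n
  filter_upwards [eventually_ge_atTop n] with m hm
  exact lt_of_le_of_lt (by exact_mod_cast hm) (hz m)

theorem IsNormal.exists_lt_norm_gradient (hU : IsNormal P U) (ρ : ℝ) :
    ∃ M : ℕ, ∀ q ∈ finiteSet U, (M : ℝ≥0∞) < U q → ρ < ‖gradient (pot U) q‖ := by
  obtain ⟨ζ, -, -, hζ⟩ := hU.growth
  by_contra! h
  choose z hz hz1 hz2 using h
  have := (hζ z hz (tendsto_top_of_natCast_lt hz1)).1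
  obtain ⟨n, hn⟩ := (this.eventually_gt_atTop ρ).exists
  exact absurd (hz2 n) (not_le.2 hn)

theorem IsNormal.exists_hessian_le (hU : IsNormal P U) :
    ∃ ζ C : ℝ, 1 < ζ ∧ ζ < 2 ∧ 0 ≤ C ∧ ∀ q ∈ finiteSet U,
      ‖fderiv ℝ (gradient (pot U)) q‖ ≤ C + ‖gradient (pot U) q‖ ^ ζ := by
  obtain ⟨ζ, h1, h2, hζ⟩ := hU.growth
  have hM : ∃ M : ℕ, ∀ q ∈ finiteSet U, (M : ℝ≥0∞) < U q →
      ‖fderiv ℝ (gradient (pot U)) q‖ ≤ ‖gradient (pot U) q‖ ^ ζ := by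
    by_contra! h
    choose z hz hz1 hz2 using h
    obtain ⟨ht1, ht2⟩ := hζ z hz (tendsto_top_of_natCast_lt hz1)
    obtain ⟨n, hn1, hn2⟩ :=
      ((ht1.eventually_gt_atTop 0).and (ht2.eventually_lt_const one_pos)).exists
    rw [div_lt_one (Real.rpow_pos_of_pos hn1 ζ)] at hn2
    exact absurd (hz2 n) (not_lt.2 hn2.le)
  obtain ⟨M, hM⟩ := hM
  obtain ⟨C, hC⟩ := (hU.isCompact_le M).exists_bound_of_continuousOn
    (hU.continuousOn_fderiv_gradient.mono (le_subset_finiteSet U M))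
  refine ⟨ζ, |C|, h1, h2, abs_nonneg _, fun q hq => ?_⟩
  have h3 : 0 ≤ ‖gradient (pot U) q‖ ^ ζ := by positivity
  rcases lt_or_ge (M : ℝ≥0∞) (U q) with h | h
  · linarith [hM q hq h, abs_nonneg C]
  · linarith [hC q h, le_abs_self C]

/-- The Hessian is negligible with respect to the square of the gradient. -/
theorem IsNormal.exists_hessian_le_sq (hU : IsNormal P U) {η : ℝ} (hη : 0 < η) :
    ∃ C : ℝ, 0 ≤ C ∧ ∀ q ∈ finiteSet U,
      ‖fderiv ℝ (gradient (pot U)) q‖ ≤ η * ‖gradient (pot U) q‖ ^ 2 + C := by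
  obtain ⟨ζ, C, h1, h2, hC, hle⟩ := hU.exists_hessian_le
  -- This is where `ζ < 2` matters: `y^ζ = y^(-(2-ζ)) y²` is eventually below `η y²`.
  obtain ⟨Y, hY⟩ := eventually_atTop.1
    ((tendsto_rpow_neg_atTop (sub_pos.2 h2)).eventually_lt_const hη)
  refine ⟨C + (max Y 1) ^ ζ, by positivity, fun q hq => (hle q hq).trans ?_⟩
  set y := ‖gradient (pot U) q‖ with hy
  have hy0 : 0 ≤ y := norm_nonneg _
  have h3 : 0 ≤ (max Y 1) ^ ζ := by positivity
  have h4 : 0 ≤ η * y ^ 2 := by positivity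
  rcases le_total (max Y 1) y with h | h
  · have := hY y ((le_max_left _ _).trans h)
    have hy1 : 0 < y := lt_of_lt_of_le (by positivity) h
    have e : y ^ ζ = y ^ (-(2 - ζ)) * y ^ 2 := by
      rw [← Real.rpow_two, ← Real.rpow_add hy1]; congr 1; ring
    have := mul_le_mul_of_nonneg_right this.le (sq_nonneg y)
    rw [e]
    linarith
  · have : y ^ ζ ≤ (max Y 1) ^ ζ := Real.rpow_le_rpow hy0 h (by linarith)
    linarith

/-- A bound for the Hessian where the gradient is at most `R n`, negligible even against
`n² / log n`. -/
theorem IsNormal.exists_hessian_bound (hU : IsNormal P U) {R : ℝ} (hR : 0 < R) :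
    ∃ H : ℕ → ℝ, (∀ n, 0 ≤ H n) ∧ (∀ n : ℕ, ∀ q ∈ finiteSet U,
      ‖gradient (pot U) q‖ ≤ R * n → ‖fderiv ℝ (gradient (pot U)) q‖ ≤ H n) ∧
      Tendsto (fun n : ℕ => H n * (1 + Real.log n) / (n : ℝ) ^ 2) atTop (𝓝 0) := by
  obtain ⟨ζ, C, h1, h2, hC, hle⟩ := hU.exists_hessian_le
  refine ⟨fun n => C + (R * n) ^ ζ, fun n => by positivity, fun n q hq h => ?_, ?_⟩
  · have : ‖gradient (pot U) q‖ ^ ζ ≤ (R * n) ^ ζ :=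
      Real.rpow_le_rpow (norm_nonneg _) h (by linarith)
    linarith [hle q hq]
  -- The Hessian bound is `O(n^ζ)`, so the quotient is of order `(log n)/n^(2-ζ)`. The spare
  -- logarithm pays for the size of the profile.
  · have hp : ∀ s : ℝ, 0 < s →
        Tendsto (fun x : ℝ => (1 + Real.log x) / x ^ s) atTop (𝓝 0) := by
      intro s hs
      have t1 := tendsto_rpow_neg_atTop hs
      have t2 := (isLittleO_log_rpow_atTop hs).tendsto_div_nhds_zero
      have := t1.add t2
      rw [add_zero] at this
      refine this.congr' ?_
      filter_upwards [eventually_gt_atTop 0] with x hx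
      rw [add_div, Real.rpow_neg hx.le, one_div]
    have h3 : Tendsto (fun x : ℝ => C * ((1 + Real.log x) / x ^ (2 : ℝ)) +
        R ^ ζ * ((1 + Real.log x) / x ^ (2 - ζ))) atTop (𝓝 0) := by
      simpa using ((hp 2 (by norm_num)).const_mul C).add
        ((hp (2 - ζ) (by linarith)).const_mul (R ^ ζ))
    refine (h3.comp tendsto_natCast_atTop_atTop).congr' ?_
    filter_upwards [eventually_gt_atTop 0] with n hn
    have hn' : (0 : ℝ) < n := by exact_mod_cast hn
    simp only [Function.comp]
    rw [Real.mul_rpow hR.le hn'.le, Real.rpow_sub hn', Real.rpow_two]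
    have : (0 : ℝ) < (n : ℝ) ^ ζ := Real.rpow_pos_of_pos hn' ζ
    field_simp

/-- A smooth cutoff, equal to `1` where `|∇U| ≤ ρ` and to `0` where `|∇U| ≥ 2ρ`. -/
def gradCut (U : Conf N k → ℝ≥0∞) (ρ : ℝ) (q : Conf N k) : ℝ :=
  1 - Real.smoothTransition (‖gradient (pot U) q‖ ^ 2 / ρ ^ 2 - 1)

theorem gradCut_nonneg (U : Conf N k → ℝ≥0∞) (ρ : ℝ) (q : Conf N k) : 0 ≤ gradCut U ρ q :=
  sub_nonneg.2 (Real.smoothTransition.le_one _)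

theorem gradCut_le_one (U : Conf N k → ℝ≥0∞) (ρ : ℝ) (q : Conf N k) : gradCut U ρ q ≤ 1 :=
  sub_le_self _ (Real.smoothTransition.nonneg _)

theorem gradCut_eq_one {ρ : ℝ} (hρ : 0 < ρ) {q : Conf N k} (h : ‖gradient (pot U) q‖ ≤ ρ) :
    gradCut U ρ q = 1 := by
  unfold gradCut
  rw [Real.smoothTransition.zero_of_nonpos, sub_zero]
  rw [sub_nonpos, div_le_one (by positivity)]
  exact pow_le_pow_left₀ (norm_nonneg _) h 2

theorem one_lt_of_two_mul_le {ρ y : ℝ} (hρ : 0 < ρ) (h : 2 * ρ ≤ y) :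
    1 < y ^ 2 / ρ ^ 2 - 1 := by
  rw [lt_sub_iff_add_lt, lt_div_iff₀ (by positivity)]
  nlinarith

theorem gradCut_eq_zero {ρ : ℝ} (hρ : 0 < ρ) {q : Conf N k}
    (h : 2 * ρ ≤ ‖gradient (pot U) q‖) : gradCut U ρ q = 0 := by
  unfold gradCut
  rw [Real.smoothTransition.one_of_one_le (one_lt_of_two_mul_le hρ h).le, sub_self]

theorem IsNormal.contDiffAt_gradCut (hU : IsNormal P U) (ρ : ℝ) {q : Conf N k}
    (hq : q ∈ finiteSet U) : ContDiffAt ℝ 2 (gradCut U ρ) q := by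
  have h : ContDiffAt ℝ 2 (fun q => ‖gradient (pot U) q‖ ^ 2 / ρ ^ 2 - 1) q :=
    ((((hU.contDiffAt_gradient hq).of_le (by norm_cast)).norm_sq ℝ).div_const _).sub
      contDiffAt_const
  exact contDiffAt_const.sub ((Real.smoothTransition.contDiffAt (n := 2)).comp q h)

/-- Differentiating `|∇U|²/ρ²` gives `2∇U·∇²U/ρ²`, and `|∇U| ≤ 2ρ` wherever the derivative of the
cutoff is not zero: one power of `ρ` cancels. -/
theorem IsNormal.norm_fderiv_gradCut_le (hU : IsNormal P U) {ρ B : ℝ} (hρ : 0 < ρ)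
    (hB : ∀ x, |deriv Real.smoothTransition x| ≤ B) {q : Conf N k} (hq : q ∈ finiteSet U) :
    (2 * ρ ≤ ‖gradient (pot U) q‖ → fderiv ℝ (gradCut U ρ) q = 0) ∧
    ‖fderiv ℝ (gradCut U ρ) q‖ ≤ 4 * B * ‖fderiv ℝ (gradient (pot U)) q‖ / ρ := by
  set G := gradient (pot U) with hG
  have hB0 : 0 ≤ B := (abs_nonneg _).trans (hB 0)
  have h1 : HasFDerivAt (fun q => ‖G q‖ ^ 2) (2 • (innerSL ℝ (G q)).comp (fderiv ℝ G q)) q :=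
    (hU.hasFDerivAt_gradient hq).norm_sq
  have h2 : HasFDerivAt (fun q => ‖G q‖ ^ 2 / ρ ^ 2 - 1)
      ((ρ ^ 2)⁻¹ • 2 • (innerSL ℝ (G q)).comp (fderiv ℝ G q)) q := by
    have := (h1.const_mul (ρ ^ 2)⁻¹).sub_const 1
    refine this.congr_of_eventuallyEq (Eventually.of_forall fun y => ?_)
    simp only; ring
  have h3 := ((differentiable_smoothTransition
    (‖G q‖ ^ 2 / ρ ^ 2 - 1)).hasDerivAt.comp_hasFDerivAt q h2).const_sub 1
  have h4 : fderiv ℝ (gradCut U ρ) q =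
      -(deriv Real.smoothTransition (‖G q‖ ^ 2 / ρ ^ 2 - 1) •
        (ρ ^ 2)⁻¹ • 2 • (innerSL ℝ (G q)).comp (fderiv ℝ G q)) := h3.fderiv
  have hz : 2 * ρ ≤ ‖G q‖ → fderiv ℝ (gradCut U ρ) q = 0 := by
    intro h
    rw [h4, deriv_smoothTransition_of_one_lt (one_lt_of_two_mul_le hρ h)]
    simp
  refine ⟨hz, ?_⟩
  rcases le_total (2 * ρ) ‖G q‖ with h | h
  · rw [hz h, norm_zero]; positivity
  refine ContinuousLinearMap.opNorm_le_bound _ (by positivity) fun v => ?_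
  rw [h4]
  simp only [neg_apply, smul_apply, ContinuousLinearMap.comp_apply, innerSL_apply_apply,
    smul_eq_mul, nsmul_eq_mul, norm_neg, norm_mul, Nat.cast_ofNat]
  rw [Real.norm_eq_abs, Real.norm_of_nonneg (by positivity : 0 ≤ (ρ ^ 2)⁻¹),
    Real.norm_of_nonneg (by norm_num : (0 : ℝ) ≤ 2)]
  have h5 : ‖inner ℝ (G q) (fderiv ℝ G q v)‖ ≤ 2 * ρ * (‖fderiv ℝ G q‖ * ‖v‖) :=
    (norm_inner_le_norm _ _).trans (mul_le_mul h ((fderiv ℝ G q).le_opNorm v)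
      (norm_nonneg _) (by positivity))
  calc |deriv Real.smoothTransition (‖G q‖ ^ 2 / ρ ^ 2 - 1)| *
        ((ρ ^ 2)⁻¹ * (2 * ‖inner ℝ (G q) (fderiv ℝ G q v)‖)) ≤
        B * ((ρ ^ 2)⁻¹ * (2 * (2 * ρ * (‖fderiv ℝ G q‖ * ‖v‖)))) := by
          gcongr
          exact hB _
    _ = _ := by field_simp; ring

open Classical in
/-- The gradient of the potential, cut off where it is large and extended by zero. -/
def clippedGradient (U : Conf N k → ℝ≥0∞) (ρ : ℝ) (q : Conf N k) : Conf N k :=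
  if q ∈ finiteSet U then gradCut U ρ q • gradient (pot U) q else 0

theorem clippedGradient_eq {ρ : ℝ} (hρ : 0 < ρ) {q : Conf N k} (hq : q ∈ finiteSet U)
    (h : ‖gradient (pot U) q‖ ≤ ρ) : clippedGradient U ρ q = gradient (pot U) q := by
  simp [clippedGradient, hq, gradCut_eq_one hρ h]

theorem IsNormal.exists_clippedGradient_eq_zero (hU : IsNormal P U) {ρ : ℝ} (hρ : 0 < ρ) :
    ∃ M : ℕ, ∀ q, q ∉ {q | U q ≤ M} → clippedGradient U ρ q = 0 := by
  obtain ⟨M, hM⟩ := hU.exists_lt_norm_gradient (2 * ρ)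
  refine ⟨M, fun q hq => ?_⟩
  unfold clippedGradient
  split_ifs with h
  · rw [gradCut_eq_zero hρ (hM q h (not_le.1 hq)).le, zero_smul]
  · rfl

theorem clippedGradient_eventuallyEq (hU : IsNormal P U) (ρ : ℝ) {q : Conf N k}
    (hq : q ∈ finiteSet U) :
    clippedGradient U ρ =ᶠ[𝓝 q] fun q => gradCut U ρ q • gradient (pot U) q := by
  filter_upwards [hU.isOpen.mem_nhds hq] with y hy
  simp [clippedGradient, hy]

theorem clippedGradient_eventuallyEq_zero (hU : IsNormal P U) {ρ : ℝ} (hρ : 0 < ρ)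
    {q : Conf N k} (hq : q ∉ finiteSet U) : clippedGradient U ρ =ᶠ[𝓝 q] fun _ => 0 := by
  obtain ⟨M, hM⟩ := hU.exists_clippedGradient_eq_zero hρ
  have ho : IsOpen {q | U q ≤ M}ᶜ := (hU.isCompact_le M).isClosed.isOpen_compl
  filter_upwards [ho.mem_nhds fun h => hq (le_subset_finiteSet U M h)] with y hy
  exact hM y hy

/-- The cutoff vanishes off a compact sublevel set inside `𝒪`, so extension by zero is smooth. A
globally defined field is needed because the graph transform evaluates its maps at points that may
lie outside `𝒪`. -/
theorem contDiff_clippedGradient (hU : IsNormal P U) {ρ : ℝ} (hρ : 0 < ρ) :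
    ContDiff ℝ 2 (clippedGradient U ρ) := by
  rw [contDiff_iff_contDiffAt]
  intro q
  by_cases hq : q ∈ finiteSet U
  · exact ((hU.contDiffAt_gradCut ρ hq).smul ((hU.contDiffAt_gradient hq).of_le
      (by norm_cast))).congr_of_eventuallyEq (clippedGradient_eventuallyEq hU ρ hq)
  · exact contDiffAt_const.congr_of_eventuallyEq (clippedGradient_eventuallyEq_zero hU hρ hq)

theorem norm_clippedGradient_le {ρ : ℝ} (hρ : 0 < ρ) (q : Conf N k) :
    ‖clippedGradient U ρ q‖ ≤ 2 * ρ := by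
  unfold clippedGradient
  split_ifs with h
  · rcases le_total (2 * ρ) ‖gradient (pot U) q‖ with h' | h'
    · rw [gradCut_eq_zero hρ h', zero_smul, norm_zero]; positivity
    · rw [norm_smul, Real.norm_of_nonneg (gradCut_nonneg _ _ _)]
      nlinarith [gradCut_le_one U ρ q, gradCut_nonneg U ρ q, norm_nonneg (gradient (pot U) q)]
  · rw [norm_zero]; positivity

theorem norm_fderiv_clippedGradient_le (hU : IsNormal P U) {ρ B H : ℝ} (hρ : 0 < ρ)
    (hB : ∀ x, |deriv Real.smoothTransition x| ≤ B) (hH0 : 0 ≤ H)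
    (hH : ∀ q ∈ finiteSet U, ‖gradient (pot U) q‖ ≤ 2 * ρ →
      ‖fderiv ℝ (gradient (pot U)) q‖ ≤ H) (q : Conf N k) :
    ‖fderiv ℝ (clippedGradient U ρ) q‖ ≤ (1 + 8 * B) * H := by
  have hB0 : 0 ≤ B := (abs_nonneg _).trans (hB 0)
  by_cases hq : q ∈ finiteSet U
  swap
  · rw [(clippedGradient_eventuallyEq_zero hU hρ hq).fderiv_eq]
    simp; positivity
  obtain ⟨hz, hle⟩ := hU.norm_fderiv_gradCut_le hρ hB hq
  rw [(clippedGradient_eventuallyEq hU ρ hq).fderiv_eq, fderiv_fun_smul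
    ((hU.contDiffAt_gradCut ρ hq).differentiableAt (by norm_num))
    (hU.hasFDerivAt_gradient hq).differentiableAt]
  refine (norm_add_le _ _).trans ?_
  rw [norm_smul, ContinuousLinearMap.norm_smulRight_apply,
    Real.norm_of_nonneg (gradCut_nonneg _ _ _)]
  rcases le_total (2 * ρ) ‖gradient (pot U) q‖ with h | h
  · rw [gradCut_eq_zero hρ h, hz h]; simp; positivity
  · have h1 := hH q hq h
    have h2 : gradCut U ρ q * ‖fderiv ℝ (gradient (pot U)) q‖ ≤ 1 * H :=
      mul_le_mul (gradCut_le_one _ _ _) h1 (norm_nonneg _) zero_le_one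
    have h3 : ‖fderiv ℝ (gradCut U ρ) q‖ * ‖gradient (pot U) q‖ ≤ 4 * B * H / ρ * (2 * ρ) := by
      refine mul_le_mul (hle.trans ?_) h (norm_nonneg _) (by positivity)
      gcongr
    have h4 : 4 * B * H / ρ * (2 * ρ) = 8 * B * H := by field_simp; ring
    linarith

/-- The rescaled clipped gradient is tame, uniformly in the gradient bound. -/
theorem exists_isTame_clippedGradient (hU : IsNormal P U) {ρ B H n : ℝ} (hρ : 0 < ρ)
    (hn : 0 < n) (hB : ∀ x, |deriv Real.smoothTransition x| ≤ B) (hH0 : 0 ≤ H)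
    (hH : ∀ q ∈ finiteSet U, ‖gradient (pot U) q‖ ≤ 2 * ρ →
      ‖fderiv ℝ (gradient (pot U)) q‖ ≤ H) :
    ∃ M : ℝ, 0 ≤ M ∧ IsTame (2 * ρ / n) ((1 + 8 * B) * H / n) M
      (fun q => n⁻¹ • clippedGradient U ρ q) := by
  have hg := contDiff_clippedGradient hU hρ
  have hsm : ContDiff ℝ 2 (fun q => n⁻¹ • clippedGradient U ρ q) := hg.const_smul _
  obtain ⟨M, hM⟩ := hU.exists_clippedGradient_eq_zero hρ
  have hcs : HasCompactSupport (fun q => n⁻¹ • clippedGradient U ρ q) :=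
    HasCompactSupport.intro (hU.isCompact_le M) fun q hq => by rw [hM q hq, smul_zero]
  -- The constant for the derivative comes from compactness alone and depends on `n` and `ρ` in an
  -- uncontrolled way; this is harmless, as it enters no later estimate.
  obtain ⟨C, hC⟩ := ContDiff.lipschitzWith_of_hasCompactSupport (𝕂 := ℝ) (n := 1)
    (hcs.fderiv ℝ) (hsm.fderiv_right (by norm_num)) (by norm_num)
  refine ⟨C, C.2, hsm, fun q => ?_, fun q => ?_, fun q q' => hC.norm_sub_le q q'⟩
  · rw [norm_smul, Real.norm_of_nonneg (by positivity), div_eq_inv_mul]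
    exact mul_le_mul_of_nonneg_left (norm_clippedGradient_le hρ q) (by positivity)
  · rw [fderiv_fun_const_smul (hg.differentiable (by norm_num) q), norm_smul,
      Real.norm_of_nonneg (by positivity), div_eq_inv_mul]
    exact mul_le_mul_of_nonneg_left (norm_fderiv_clippedGradient_le hU hρ hB hH0 hH q)
      (by positivity)

end Potential

/-! ### A partition of unity in `ξ`. -/

section Window

/-- A smooth window supported in `[-1, 1]`; its integer translates form a partition of unity. -/
def window (x : ℝ) : ℝ := Real.smoothTransition (x + 1) - Real.smoothTransition x

theorem window_nonneg (x : ℝ) : 0 ≤ window x :=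
  sub_nonneg.2 (Real.smoothTransition.monotone (by linarith))

theorem window_le_one (x : ℝ) : window x ≤ 1 := by
  have := Real.smoothTransition.le_one (x + 1)
  have := Real.smoothTransition.nonneg x
  unfold window; linarith

theorem window_eq_zero {x : ℝ} (h : 1 ≤ |x|) : window x = 0 := by
  unfold window
  rcases le_abs'.1 h with h | h
  · rw [Real.smoothTransition.zero_of_nonpos (by linarith),
      Real.smoothTransition.zero_of_nonpos (by linarith), sub_zero]
  · rw [Real.smoothTransition.one_of_one_le (by linarith),
      Real.smoothTransition.one_of_one_le (by linarith), sub_self]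

theorem contDiff_window : ContDiff ℝ 2 window :=
  ((Real.smoothTransition.contDiff (n := 2)).comp (contDiff_id.add contDiff_const)).sub
    (Real.smoothTransition.contDiff (n := 2))

theorem abs_deriv_window_le {B : ℝ} (hB : ∀ x, |deriv Real.smoothTransition x| ≤ B) (x : ℝ) :
    |deriv window x| ≤ 2 * B := by
  have h1 : HasDerivAt window (deriv Real.smoothTransition (x + 1) -
      deriv Real.smoothTransition x) x :=
    ((differentiable_smoothTransition (x + 1)).hasDerivAt.comp_add_const x 1).sub
      (differentiable_smoothTransition x).hasDerivAt
  rw [h1.deriv]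
  refine (abs_sub _ _).trans ?_
  linarith [hB (x + 1), hB x]

/-- A window is a difference of consecutive translates of the smooth step, so the sum telescopes. -/
theorem sum_window (x : ℝ) (m n : ℕ) (h : m ≤ n) :
    ∑ i ∈ Finset.Ico m n, window (x + i) =
      Real.smoothTransition (x + n) - Real.smoothTransition (x + m) := by
  rw [← Finset.sum_Ico_sub (fun i : ℕ => Real.smoothTransition (x + i)) h]
  refine Finset.sum_congr rfl fun i _ => ?_
  simp [window, add_assoc]

end Window

/-! ### The mass matrix and the drift in vector form. -/

variable {N k : ℕ}

/-- The inverse mass matrix. -/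
def massInv (P : Params N) : Conf N k →L[ℝ] Conf N k :=
  LinearMap.toContinuousLinearMap
    { toFun := fun p => WithLp.toLp 2 fun j => p j / P.m j.1
      map_add' := fun p p' => by ext j; simp [add_div]
      map_smul' := fun c p => by ext j; simp [mul_div_assoc] }

theorem massInv_apply (P : Params N) (p : Conf N k) (j : Fin N × Fin k) :
    massInv P p j = p j / P.m j.1 := rfl

theorem massNormSq_eq_inner (P : Params N) (p : Conf N k) :
    massNormSq P p = inner ℝ p (massInv P p) := by
  rw [PiLp.inner_apply, Fintype.sum_prod_type]
  refine Finset.sum_congr rfl fun i _ => ?_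
  rw [Finset.sum_div]
  refine Finset.sum_congr rfl fun l _ => ?_
  simp [massInv_apply]; ring

theorem massNormSq_nonneg (P : Params N) (p : Conf N k) : 0 ≤ massNormSq P p :=
  Finset.sum_nonneg fun i _ => div_nonneg (Finset.sum_nonneg fun _ _ => sq_nonneg _) (P.m_pos i).le

theorem massNormSq_le (P : Params N) (p : Conf N k) :
    massNormSq P p ≤ ‖massInv (k := k) P‖ * ‖p‖ ^ 2 := by
  rw [massNormSq_eq_inner]
  refine (real_inner_le_norm _ _).trans ?_
  have := mul_le_mul_of_nonneg_left ((massInv P).le_opNorm p) (norm_nonneg p)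
  linarith

theorem drift_eq (P : Params N) (U : Conf N k → ℝ≥0∞) (x : Phase N k) :
    drift P U x = (massInv P x.2.1,
      -x.2.2 • x.2.1 - P.γ • massInv P x.2.1 - gradient (pot U) x.1,
      (massNormSq P x.2.1 - P.kB * P.T * (k * N)) / P.a) := by
  unfold drift
  refine Prod.ext rfl (Prod.ext ?_ ?_)
  · ext j
    simp [massInv_apply]
    ring
  · simp only
    ring

theorem abs_drift_snd_snd_le (P : Params N) (U : Conf N k → ℝ≥0∞) (x : Phase N k) :
    |(drift P U x).2.2| ≤
      (‖massInv (k := k) P‖ + P.kB * P.T * (k * N)) / P.a * (1 + ‖x.2.1‖ ^ 2) := by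
  rw [drift_eq]
  have h1 := massNormSq_nonneg P x.2.1
  have h2 := massNormSq_le P x.2.1
  have h3 : 0 ≤ P.kB * P.T * (k * N) := by
    have := P.kB_pos; have := P.T_pos; positivity
  have h4 := norm_nonneg (massInv (k := k) P)
  have h5 := sq_nonneg ‖x.2.1‖
  rw [abs_div, abs_of_pos P.a_pos, div_mul_eq_mul_div]
  refine div_le_div_of_nonneg_right ?_ P.a_pos.le
  rw [abs_le]
  constructor <;> nlinarith

/-! ### The localized perturbation at `ξ ≈ -n` and its derivatives. -/

section WindowFunction

/-- A profile of the rescaled distance of the momentum to the slow manifold `{p = c q}`,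
localized to `|∇U| ≤ 2R` and `|ξ + n| ≤ 1`. -/
def windowFun (U : Conf N k → ℝ≥0∞) (R n s : ℝ) (c : Conf N k → Conf N k) (Φ : ℝ → ℝ)
    (x : Phase N k) : ℝ :=
  window (x.2.2 + n) * (gradCut U R x.1 * Φ (s * ‖x.2.1 - c x.1‖ ^ 2))

variable {P : Params N} {U : Conf N k → ℝ≥0∞} {R n s d C M : ℝ} {c : Conf N k → Conf N k}
  {Φ Φ' Φ'' : ℝ → ℝ} {x : Phase N k}

theorem contDiffAt_windowFun (hU : IsNormal P U) (hc : ContDiff ℝ 2 c) (hΦ : ContDiff ℝ 2 Φ)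
    (hx : x ∈ stateSpace U) : ContDiffAt ℝ 2 (windowFun U R n s c Φ) x := by
  have h1 : ContDiffAt ℝ 2 (fun x : Phase N k => x.1) x := contDiffAt_fst
  have h2 : ContDiffAt ℝ 2 (fun x : Phase N k => x.2.1) x := contDiffAt_fst.comp x contDiffAt_snd
  have h3 : ContDiffAt ℝ 2 (fun x : Phase N k => x.2.2) x := contDiffAt_snd.comp x contDiffAt_snd
  have hw : ContDiffAt ℝ 2 (fun x : Phase N k => x.2.1 - c x.1) x :=
    h2.sub (hc.contDiffAt.comp x h1)
  exact (contDiff_window.contDiffAt.comp x (h3.add contDiffAt_const)).mul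
    (((hU.contDiffAt_gradCut R hx).comp x h1).mul
      (hΦ.contDiffAt.comp x (contDiffAt_const.mul (hw.norm_sq ℝ))))

theorem fderiv_windowFun_apply (hU : IsNormal P U) (hc : ContDiff ℝ 2 c)
    (hΦ : IsProfile d C M Φ Φ' Φ'') (hx : x ∈ stateSpace U) (v : Phase N k) :
    fderiv ℝ (windowFun U R n s c Φ) x v =
      deriv window (x.2.2 + n) * v.2.2 *
        (gradCut U R x.1 * Φ (s * ‖x.2.1 - c x.1‖ ^ 2)) +
      window (x.2.2 + n) * (fderiv ℝ (gradCut U R) x.1 v.1 * Φ (s * ‖x.2.1 - c x.1‖ ^ 2) +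
        gradCut U R x.1 * (Φ' (s * ‖x.2.1 - c x.1‖ ^ 2) *
          (s * (2 * inner ℝ (x.2.1 - c x.1) (v.2.1 - fderiv ℝ c x.1 v.1))))) := by
  refine fderiv_apply_eq_of_line ((contDiffAt_windowFun hU hc hΦ.contDiff hx).differentiableAt
    (by norm_num)) ?_
  have l1 : HasDerivAt (fun t : ℝ => window (x.2.2 + t • v.2.2 + n))
      (deriv window (x.2.2 + n) * v.2.2) 0 := by
    have h1 : HasDerivAt (fun t : ℝ => x.2.2 + t • v.2.2 + n) v.2.2 0 :=
      (hasDerivAt_line x.2.2 v.2.2 0).add_const n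
    have h2 : HasDerivAt window (deriv window (x.2.2 + n)) (x.2.2 + (0 : ℝ) • v.2.2 + n) := by
      simpa using (contDiff_window.differentiable (by norm_num) (x.2.2 + n)).hasDerivAt
    exact h2.comp 0 h1
  have l2 : HasDerivAt (fun t : ℝ => gradCut U R (x.1 + t • v.1))
      (fderiv ℝ (gradCut U R) x.1 v.1) 0 := by
    have h2 : HasFDerivAt (gradCut U R) (fderiv ℝ (gradCut U R) x.1)
        (x.1 + (0 : ℝ) • v.1) := by
      simpa using ((hU.contDiffAt_gradCut R hx).differentiableAt (by norm_num)).hasFDerivAt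
    exact h2.comp_hasDerivAt 0 (hasDerivAt_line x.1 v.1 0)
  have l3 : HasDerivAt (fun t : ℝ => c (x.1 + t • v.1)) (fderiv ℝ c x.1 v.1) 0 := by
    have h2 : HasFDerivAt c (fderiv ℝ c x.1) (x.1 + (0 : ℝ) • v.1) := by
      simpa using (hc.differentiable (by norm_num) x.1).hasFDerivAt
    exact h2.comp_hasDerivAt 0 (hasDerivAt_line x.1 v.1 0)
  have l4 := (((hasDerivAt_line x.2.1 v.2.1 0).sub l3).norm_sq).const_mul s
  have l5 := (hΦ.hasDerivAt _).comp (0 : ℝ) l4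
  have := l1.mul (l2.mul l5)
  simp only [zero_smul, add_zero, Pi.sub_apply, Pi.mul_apply, Function.comp] at this
  exact this

theorem fderiv_windowFun_momentumDir (hU : IsNormal P U) (hc : ContDiff ℝ 2 c)
    (hΦ : IsProfile d C M Φ Φ' Φ'') (hx : x ∈ stateSpace U) (j : Fin N × Fin k) :
    fderiv ℝ (windowFun U R n s c Φ) x (momentumDir j) =
      window (x.2.2 + n) * ((gradCut U R x.1 * (2 * s * Φ' (s * ‖x.2.1 - c x.1‖ ^ 2))) •
        (x.2.1 - c x.1)) j := by
  rw [fderiv_windowFun_apply hU hc hΦ hx]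
  simp only [momentumDir, map_zero, sub_zero, EuclideanSpace.inner_single_right, PiLp.smul_apply,
    smul_eq_mul, conj_trivial]
  ring

theorem momentumLaplacian_windowFun (hU : IsNormal P U) (hc : ContDiff ℝ 2 c)
    (hΦ : IsProfile d C M Φ Φ' Φ'') (hx : x ∈ stateSpace U) :
    momentumLaplacian (windowFun U R n s c Φ) x =
      window (x.2.2 + n) * (gradCut U R x.1 * (s *
        (4 * (s * ‖x.2.1 - c x.1‖ ^ 2) * Φ'' (s * ‖x.2.1 - c x.1‖ ^ 2) +
          2 * (k * N) * Φ' (s * ‖x.2.1 - c x.1‖ ^ 2)))) := by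
  set w := x.2.1 - c x.1 with hw
  have key : ∀ j : Fin N × Fin k,
      fderiv ℝ (fun y => fderiv ℝ (windowFun U R n s c Φ) y (momentumDir j)) x (momentumDir j) =
      window (x.2.2 + n) * (gradCut U R x.1 *
        (Φ'' (s * ‖w‖ ^ 2) * (s * (2 * w j)) * (s * (2 * w j)) + Φ' (s * ‖w‖ ^ 2) * (s * 2))) := by
    intro j
    set e : Conf N k := EuclideanSpace.single j 1 with he
    have hn : ∀ t : ℝ, HasDerivAt (fun t : ℝ => s * ‖w + t • e‖ ^ 2)
        (s * (2 * inner ℝ (w + t • e) e)) t := fun t =>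
      ((hasDerivAt_line w e t).norm_sq).const_mul s
    refine fderiv_fderiv_eq_of_line (g := fun t => window (x.2.2 + n) * (gradCut U R x.1 *
      (Φ' (s * ‖w + t • e‖ ^ 2) * (s * (2 * inner ℝ (w + t • e) e)))))
      (contDiffAt_windowFun hU hc hΦ.contDiff hx) (fun t => ?_) ?_
    · have h1 := (((hΦ.hasDerivAt _).comp t (hn t)).const_mul (gradCut U R x.1)).const_mul
        (window (x.2.2 + n))
      refine h1.congr_of_eventuallyEq (Eventually.of_forall fun t => ?_)
      simp only [windowFun, momentumDir, Function.comp, Prod.fst_add, Prod.snd_add,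
        Prod.smul_fst, Prod.smul_snd, smul_zero, add_zero]
      rw [hw, sub_add_eq_add_sub, he]
    · have h2 : HasDerivAt (fun t : ℝ => inner ℝ (w + t • e) e) (inner ℝ e e) 0 := by
        have := (hasDerivAt_line w e 0).inner ℝ (hasDerivAt_const (0 : ℝ) e)
        simpa using this
      have h3 := (((hΦ.hasDerivAt' _).comp (0 : ℝ) (hn 0)).mul
        ((h2.const_mul 2).const_mul s)).const_mul (gradCut U R x.1)
      have h4 := h3.const_mul (window (x.2.2 + n))
      refine h4.congr_deriv ?_
      have h5 : inner ℝ w e = w j := by simp [he, EuclideanSpace.inner_single_right]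
      have h6 : inner ℝ e e = (1 : ℝ) := by simp [he]
      simp only [zero_smul, add_zero, h5, h6, Function.comp]
      ring
  unfold momentumLaplacian
  rw [Finset.sum_congr rfl fun j _ => key j, ← Finset.mul_sum, ← Finset.mul_sum,
    Finset.sum_add_distrib]
  have h7 : ∀ b : ℝ, ∑ j : Fin N × Fin k, b * (s * (2 * w j)) * (s * (2 * w j)) =
      4 * s ^ 2 * b * ‖w‖ ^ 2 := by
    intro b
    rw [EuclideanSpace.real_norm_sq_eq, Finset.mul_sum]
    exact Finset.sum_congr rfl fun j _ => by ring
  rw [h7]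
  simp only [Finset.sum_const, Finset.card_univ, Fintype.card_prod, Fintype.card_fin, nsmul_eq_mul]
  push_cast
  ring

end WindowFunction

/-! ### The generator on the localized perturbation. -/

variable {N k : ℕ} {P : Params N} {U : Conf N k → ℝ≥0∞}

/-- The momentum gradient of `windowFun`, without the window factor. -/
def windowGrad (U : Conf N k → ℝ≥0∞) (R s : ℝ) (c : Conf N k → Conf N k) (Φ' : ℝ → ℝ)
    (x : Phase N k) : Conf N k :=
  (gradCut U R x.1 * (2 * s * Φ' (s * ‖x.2.1 - c x.1‖ ^ 2))) • (x.2.1 - c x.1)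

/-- The remainder in the estimate of `windowFun`. -/
def windowError (k : ℕ) (P : Params N) (μ Λ B Cφ Gc Lc R H n : ℝ) : ℝ :=
  2 * B * ((μ + P.kB * P.T * (k * N)) / P.a) * (Cφ * (1 + 2 * Real.log n)) +
  4 * B * H / R * μ * (Cφ * (1 + 2 * Real.log n)) +
  (Cφ / n + 2 * Cφ * (1 + Gc ^ 2) / P.σ) +
  (2 * (Cφ * √(n / P.σ)) * (1 + (1 + P.γ * μ) * Gc + Λ * (1 + Gc)) +
    2 * Cφ * (1 + P.γ * μ + Lc * μ + Λ))

/-- Near the slow manifold the drift of the momentum relative to it is expanding. -/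
theorem inner_drift_le {c g : Conf N k → Conf N k} {n Gc Lc Mc : ℝ} {x : Phase N k}
    (hc : IsTame Gc Lc Mc c)
    (hres : ‖fderiv ℝ c x.1 (massInv P (c x.1)) - n • (c x.1 - g x.1)‖ ≤ 1)
    (hg : n • g x.1 = gradient (pot U) x.1) (hξ : |x.2.2 + n| ≤ 1) :
    |inner ℝ (x.2.1 - c x.1)
        ((drift P U x).2.1 - fderiv ℝ c x.1 (drift P U x).1) - n * ‖x.2.1 - c x.1‖ ^ 2| ≤
      ‖x.2.1 - c x.1‖ * (1 + (1 + P.γ * ‖massInv (k := k) P‖) * Gc +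
        (1 + P.γ * ‖massInv (k := k) P‖ + Lc * ‖massInv (k := k) P‖) * ‖x.2.1 - c x.1‖) := by
  set A := massInv (k := k) P with hA
  set p := x.2.1 with hp
  set w := p - c x.1 with hw
  set μ := ‖A‖ with hμ
  have hγ := P.γ_pos.le
  have hLc : 0 ≤ Lc := (norm_nonneg _).trans (hc.fderiv_le 0)
  -- With `p = c + w`, the drift of `w` is `n w` plus the error of replacing `-ξ` by `n`, the
  -- friction, the residual of the invariance equation, and the shear `Dc(Aw)`.
  have e : (drift P U x).2.1 - fderiv ℝ c x.1 (drift P U x).1 =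
      n • w + (-(x.2.2 + n) • p - P.γ • A p -
        (fderiv ℝ c x.1 (A (c x.1)) - n • (c x.1 - g x.1)) - fderiv ℝ c x.1 (A w)) := by
    rw [drift_eq, ← hg, hw]
    simp only [map_sub]
    module
  rw [e, inner_add_right, real_inner_smul_right, real_inner_self_eq_norm_sq, add_sub_cancel_left]
  refine (abs_real_inner_le_norm _ _).trans (mul_le_mul_of_nonneg_left ?_ (norm_nonneg _))
  have hpn : ‖p‖ ≤ ‖w‖ + Gc := by
    have : p = w + c x.1 := by rw [hw]; abel
    rw [this]
    exact (norm_add_le _ _).trans (add_le_add_right (hc.norm_le _) _)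
  have h1 : ‖-(x.2.2 + n) • p‖ ≤ ‖p‖ := by
    rw [norm_smul, Real.norm_eq_abs, abs_neg]
    exact mul_le_of_le_one_left (norm_nonneg _) hξ
  have h2 : ‖P.γ • A p‖ ≤ P.γ * μ * ‖p‖ := by
    rw [norm_smul, Real.norm_of_nonneg hγ, mul_assoc]
    exact mul_le_mul_of_nonneg_left (A.le_opNorm p) hγ
  have h3 : ‖fderiv ℝ c x.1 (A w)‖ ≤ Lc * μ * ‖w‖ := by
    rw [mul_assoc]
    exact (ContinuousLinearMap.le_opNorm _ _).trans
      (mul_le_mul (hc.fderiv_le _) (A.le_opNorm w) (norm_nonneg _) hLc)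
  have h4 := norm_sub_le (-(x.2.2 + n) • p - P.γ • A p -
    (fderiv ℝ c x.1 (A (c x.1)) - n • (c x.1 - g x.1))) (fderiv ℝ c x.1 (A w))
  have h5 := norm_sub_le (-(x.2.2 + n) • p - P.γ • A p)
    (fderiv ℝ c x.1 (A (c x.1)) - n • (c x.1 - g x.1))
  have h6 := norm_sub_le (-(x.2.2 + n) • p) (P.γ • A p)
  have h7 : (1 + P.γ * μ) * ‖p‖ ≤ (1 + P.γ * μ) * (‖w‖ + Gc) :=
    mul_le_mul_of_nonneg_left hpn (by positivity)
  linarith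

-- In the variable `r = (n/σ)|w|²`, expansion, Laplacian and squared gradient combine to `n(2(r +
-- d)Φ' + 4rΦ'' + 4rΦ'²)` with `d = kN`, to which the profile inequality applies. All the rest is
-- error: derivatives of the window and of the cutoff cost `log n`, the non-expanding part of the
-- drift costs `√n`, and the truncation of the profile costs `O(1 + |p|²)`. The extra term with `Λ`
-- anticipates the cross terms with the momentum gradients of `β₀H` and of the virial perturbation.
set_option maxHeartbeats 1600000 in
theorem windowFun_estimate (hU : IsNormal P U) {c g : Conf N k → Conf N k} {Φ Φ' Φ'' : ℝ → ℝ}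
    {R n Λ B Cφ Gc Lc Mc H : ℝ} (hR : 0 < R) (hn : 1 ≤ n) (hΛ : 0 ≤ Λ)
    (hB : ∀ x, |deriv Real.smoothTransition x| ≤ B) (hCφ : 0 < Cφ)
    (hΦ : IsProfile (k * N) Cφ (n ^ 2) Φ Φ' Φ'') (hc : IsTame Gc Lc Mc c)
    (hres : ∀ q, ‖fderiv ℝ c q (massInv P (c q)) - n • (c q - g q)‖ ≤ 1)
    (hg : ∀ q ∈ finiteSet U, ‖gradient (pot U) q‖ ≤ 2 * R → n • g q = gradient (pot U) q)
    (hH0 : 0 ≤ H) (hH : ∀ q ∈ finiteSet U, ‖gradient (pot U) q‖ ≤ 2 * R →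
      ‖fderiv ℝ (gradient (pot U)) q‖ ≤ H)
    {x : Phase N k} (hx : x ∈ stateSpace U) (hξ : |x.2.2 + n| ≤ 1) :
    generator P U (windowFun U R n (n / P.σ) c Φ) x + window (x.2.2 + n) *
      (P.σ * ‖windowGrad U R (n / P.σ) c Φ' x‖ ^ 2 +
        Λ * (1 + ‖x.2.1‖) * ‖windowGrad U R (n / P.σ) c Φ' x‖) ≤
      -(window (x.2.2 + n) * gradCut U R x.1 * (k * N / 2 * n)) +
        windowError k P ‖massInv (k := k) P‖ Λ B Cφ Gc Lc R H n * (1 + ‖x.2.1‖ ^ 2) := by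
  have hσ := P.σ_pos
  have hγ := P.γ_pos.le
  have hn0 : 0 < n := by linarith
  have hB0 : 0 ≤ B := (abs_nonneg _).trans (hB 0)
  have hGc : 0 ≤ Gc := (norm_nonneg _).trans (hc.norm_le 0)
  have hLc : 0 ≤ Lc := (norm_nonneg _).trans (hc.fderiv_le 0)
  have hlog : 0 ≤ Real.log n := Real.log_nonneg hn
  set A := massInv (k := k) P with hA
  set μ := ‖A‖ with hμ
  have hμ0 : 0 ≤ μ := norm_nonneg _
  set p := x.2.1 with hp
  set w := p - c x.1 with hw
  set s := n / P.σ with hs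
  have hs0 : 0 < s := div_pos hn0 hσ
  have hσs : P.σ * s = n := by rw [hs]; field_simp
  set r := s * ‖w‖ ^ 2 with hr
  have hr0 : 0 ≤ r := by positivity
  set χ := window (x.2.2 + n) with hχ
  have hχ0 : 0 ≤ χ := window_nonneg _
  have hχ1 : χ ≤ 1 := window_le_one _
  set θ := gradCut U R x.1 with hθ
  have hθ0 : 0 ≤ θ := gradCut_nonneg _ _ _
  have hθ1 : θ ≤ 1 := gradCut_le_one _ _ _
  set LM := Cφ * (1 + 2 * Real.log n) with hLM
  have hLM0 : 0 ≤ LM := by positivity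
  have hΦb : |Φ r| ≤ LM := by
    have := hΦ.abs_le r hr0
    rwa [Real.log_pow, Nat.cast_ofNat] at this
  have hp1 : ‖p‖ ≤ 1 + ‖p‖ ^ 2 := by linarith [sq_nonneg (‖p‖ - 1), sq_nonneg (‖p‖ + 1)]
  have hp0 : 0 ≤ ‖p‖ := norm_nonneg _
  have hp2 : 1 ≤ 1 + ‖p‖ ^ 2 := le_add_of_nonneg_right (sq_nonneg _)
  have hpw : ‖p‖ ≤ ‖w‖ + Gc := by
    have : p = w + c x.1 := by rw [hw]; abel
    rw [this]
    exact (norm_add_le _ _).trans (add_le_add_right (hc.norm_le _) _)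
  have hwp : ‖w‖ ≤ ‖p‖ + Gc := (norm_sub_le _ _).trans (add_le_add_right (hc.norm_le _) _)
  set y := s * |Φ' r| * ‖w‖ with hy
  have hy0 : 0 ≤ y := by positivity
  have hyw : y * ‖w‖ ≤ Cφ := by
    have := hΦ.abs_mul_deriv_le r hr0
    rw [abs_mul, abs_of_nonneg hr0] at this
    calc y * ‖w‖ = r * |Φ' r| := by rw [hy, hr]; ring
      _ ≤ Cφ := this
  -- Interpolation between `|Φ'| ≤ Cφ` and `|rΦ'| ≤ Cφ`; this is the source of the error of order
  -- `√n`.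
  have hys : y ≤ Cφ * √s := by
    have h1 : y ^ 2 ≤ Cφ ^ 2 * s := by
      calc y ^ 2 = (y * ‖w‖) * (s * |Φ' r|) := by rw [hy]; ring
        _ ≤ Cφ * (s * Cφ) := mul_le_mul hyw
            (mul_le_mul_of_nonneg_left (hΦ.abs_deriv_le r hr0) hs0.le) (by positivity) hCφ.le
        _ = Cφ ^ 2 * s := by ring
    refine le_of_sq_le_sq ?_ (by positivity)
    rwa [mul_pow Cφ, Real.sq_sqrt hs0.le]
  have hG : ‖windowGrad U R s c Φ' x‖ = θ * (2 * y) := by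
    unfold windowGrad
    rw [norm_smul, Real.norm_eq_abs, abs_mul, abs_mul, abs_mul, abs_of_nonneg hθ0,
      abs_of_pos hs0, abs_of_pos (two_pos : (0 : ℝ) < 2)]
    rw [hy]; ring
  -- The gradient carries `θ²`; one factor is bounded by `1`, so that `θ` multiplies the whole
  -- profile inequality.
  have hG2 : P.σ * ‖windowGrad U R s c Φ' x‖ ^ 2 ≤ θ * (n * (4 * r * Φ' r ^ 2)) := by
    have e : P.σ * ‖windowGrad U R s c Φ' x‖ ^ 2 = θ * (θ * (n * (4 * r * Φ' r ^ 2))) := by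
      rw [hG, hy, hr, ← hσs]
      linear_combination (4 * θ ^ 2 * P.σ * s ^ 2 * ‖w‖ ^ 2) * sq_abs (Φ' r)
    rw [e]
    exact mul_le_mul_of_nonneg_left (mul_le_of_le_one_left (by positivity) hθ1) hθ0
  have hG1 : Λ * (1 + ‖p‖) * ‖windowGrad U R s c Φ' x‖ ≤
      θ * (2 * (Λ * (1 + Gc)) * y + 2 * Λ * (y * ‖w‖)) := by
    rw [hG]
    have : Λ * (1 + ‖p‖) * (θ * (2 * y)) ≤ Λ * (1 + (‖w‖ + Gc)) * (θ * (2 * y)) := by gcongr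
    linarith
  -- the window derivative
  have e1 : deriv window (x.2.2 + n) * (drift P U x).2.2 * (θ * Φ r) ≤
      2 * B * ((μ + P.kB * P.T * (k * N)) / P.a) * LM * (1 + ‖p‖ ^ 2) := by
    have h1 := abs_deriv_window_le hB (x.2.2 + n)
    have h2 := abs_drift_snd_snd_le P U x
    have h3 : |θ * Φ r| ≤ LM := by
      rw [abs_mul, abs_of_nonneg hθ0]
      exact (mul_le_of_le_one_left (abs_nonneg _) hθ1).trans hΦb
    have h4 := (abs_nonneg _).trans h2
    calc _ ≤ |deriv window (x.2.2 + n)| * |(drift P U x).2.2| * |θ * Φ r| := by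
          rw [← abs_mul, ← abs_mul]; exact le_abs_self _
      _ ≤ 2 * B * ((μ + P.kB * P.T * (k * N)) / P.a * (1 + ‖p‖ ^ 2)) * LM := by gcongr
      _ = _ := by ring
  -- the derivative of the cutoff
  have e2 : χ * (fderiv ℝ (gradCut U R) x.1 (drift P U x).1 * Φ r) ≤
      4 * B * H / R * μ * LM * (1 + ‖p‖ ^ 2) := by
    obtain ⟨hz, hle⟩ := hU.norm_fderiv_gradCut_le hR hB hx
    have h1 : ‖fderiv ℝ (gradCut U R) x.1‖ ≤ 4 * B * H / R := by
      rcases le_total (2 * R) ‖gradient (pot U) x.1‖ with h | h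
      · rw [hz h, norm_zero]; positivity
      · refine hle.trans ?_
        have := hH _ hx h
        gcongr
    have h2 : |fderiv ℝ (gradCut U R) x.1 (drift P U x).1| ≤ 4 * B * H / R * (μ * ‖p‖) := by
      rw [← Real.norm_eq_abs, drift_eq]
      exact (ContinuousLinearMap.le_opNorm _ _).trans
        (mul_le_mul h1 (A.le_opNorm p) (norm_nonneg _) (by positivity))
    calc _ ≤ |χ * (fderiv ℝ (gradCut U R) x.1 (drift P U x).1 * Φ r)| := le_abs_self _
      _ ≤ 1 * (4 * B * H / R * (μ * ‖p‖) * LM) := by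
          rw [abs_mul, abs_mul, abs_of_nonneg hχ0]; gcongr
      _ ≤ 1 * (4 * B * H / R * (μ * (1 + ‖p‖ ^ 2)) * LM) := by gcongr
      _ = _ := by ring
  -- the expanding direction
  set E3 : ℝ := 2 * (Cφ * √s) * (1 + (1 + P.γ * μ) * Gc + Λ * (1 + Gc)) +
    2 * Cφ * (1 + P.γ * μ + Lc * μ + Λ) with hE3
  have hE30 : 0 ≤ E3 := by positivity
  set E4 : ℝ := Cφ / n + 2 * Cφ * (1 + Gc ^ 2) / P.σ with hE4
  have hE40 : 0 ≤ E4 := by positivity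
  have e3 : θ * (Φ' r * (s * (2 * inner ℝ w ((drift P U x).2.1 -
        fderiv ℝ c x.1 (drift P U x).1)))) +
      θ * (n * (4 * r * Φ'' r + 2 * (k * N) * Φ' r)) +
      (P.σ * ‖windowGrad U R s c Φ' x‖ ^ 2 + Λ * (1 + ‖p‖) * ‖windowGrad U R s c Φ' x‖) ≤
      θ * (-(k * N / 2 * n) + (E3 + E4) * (1 + ‖p‖ ^ 2)) := by
    rcases eq_or_ne θ 0 with h0 | h0
    · rw [hG, h0]; simp
    have hle : ‖gradient (pot U) x.1‖ ≤ 2 * R := by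
      by_contra h
      exact h0 (gradCut_eq_zero hR (not_le.1 h).le)
    have h1 := inner_drift_le (P := P) (U := U) hc (hres x.1) (hg _ hx hle) hξ
    set I := inner ℝ w ((drift P U x).2.1 - fderiv ℝ c x.1 (drift P U x).1) with hI
    have h2 : Φ' r * (s * (2 * I)) ≤ 2 * n * r * Φ' r +
        2 * (y * (1 + (1 + P.γ * μ) * Gc) + y * ‖w‖ * (1 + P.γ * μ + Lc * μ)) := by
      have h3 : Φ' r * (s * (2 * I)) - 2 * n * r * Φ' r =
          2 * s * (Φ' r * (I - n * ‖w‖ ^ 2)) := by rw [hr]; ring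
      have h4 : Φ' r * (I - n * ‖w‖ ^ 2) ≤ |Φ' r| * (‖w‖ * (1 + (1 + P.γ * μ) * Gc +
          (1 + P.γ * μ + Lc * μ) * ‖w‖)) := by
        refine (le_abs_self _).trans ?_
        rw [abs_mul]
        exact mul_le_mul_of_nonneg_left h1 (abs_nonneg _)
      have h5 := mul_le_mul_of_nonneg_left h4 (by positivity : 0 ≤ 2 * s)
      have h6 : 2 * s * (|Φ' r| * (‖w‖ * (1 + (1 + P.γ * μ) * Gc +
          (1 + P.γ * μ + Lc * μ) * ‖w‖))) =
          2 * (y * (1 + (1 + P.γ * μ) * Gc) + y * ‖w‖ * (1 + P.γ * μ + Lc * μ)) := by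
        rw [hy]; ring
      linarith
    have h7 := mul_le_mul_of_nonneg_left (hΦ.ineq r hr0) hn0.le
    -- The truncation scale `n²` is exactly what makes `n r/n²` equal to `|w|²/σ`, with no power of
    -- `n` left; its logarithm is still `O(log n)`.
    have h8 : n * (Cφ * (1 + r) / n ^ 2) ≤ E4 * (1 + ‖p‖ ^ 2) := by
      have h9 : n * (Cφ * (1 + r) / n ^ 2) = Cφ / n + Cφ * ‖w‖ ^ 2 / P.σ := by
        rw [hr, hs]; field_simp
      have h10 : ‖w‖ ^ 2 ≤ 2 * (1 + Gc ^ 2) * (1 + ‖p‖ ^ 2) := by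
        have h11 := (pow_le_pow_left₀ (norm_nonneg _) hwp 2).trans add_sq_le
        have h12 := mul_nonneg (sq_nonneg Gc) (sq_nonneg ‖p‖)
        linarith
      have h11 : Cφ / n ≤ Cφ / n * (1 + ‖p‖ ^ 2) :=
        le_mul_of_one_le_right (by positivity) hp2
      have h12 : Cφ * ‖w‖ ^ 2 / P.σ ≤ Cφ * (2 * (1 + Gc ^ 2) * (1 + ‖p‖ ^ 2)) / P.σ := by gcongr
      have h13 : Cφ * (2 * (1 + Gc ^ 2) * (1 + ‖p‖ ^ 2)) / P.σ =
        2 * Cφ * (1 + Gc ^ 2) / P.σ * (1 + ‖p‖ ^ 2) := by ring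
      rw [h9, hE4, add_mul]
      linarith
    have h14 : 2 * (y * (1 + (1 + P.γ * μ) * Gc) + y * ‖w‖ * (1 + P.γ * μ + Lc * μ)) +
        (2 * (Λ * (1 + Gc)) * y + 2 * Λ * (y * ‖w‖)) ≤ E3 * (1 + ‖p‖ ^ 2) := by
      have h15 : y * (1 + (1 + P.γ * μ) * Gc + Λ * (1 + Gc)) ≤
          Cφ * √s * (1 + (1 + P.γ * μ) * Gc + Λ * (1 + Gc)) :=
        mul_le_mul_of_nonneg_right hys (by positivity)
      have h16 : y * ‖w‖ * (1 + P.γ * μ + Lc * μ + Λ) ≤ Cφ * (1 + P.γ * μ + Lc * μ + Λ) :=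
        mul_le_mul_of_nonneg_right hyw (by positivity)
      have h17 : E3 ≤ E3 * (1 + ‖p‖ ^ 2) := le_mul_of_one_le_right hE30 hp2
      rw [hE3] at h17 ⊢
      linarith
    have h18 : θ * (Φ' r * (s * (2 * I)) + n * (4 * r * Φ'' r + 2 * (k * N) * Φ' r) +
        n * (4 * r * Φ' r ^ 2) + (2 * (Λ * (1 + Gc)) * y + 2 * Λ * (y * ‖w‖))) ≤
        θ * (-(k * N / 2 * n) + (E3 + E4) * (1 + ‖p‖ ^ 2)) := by
      refine mul_le_mul_of_nonneg_left ?_ hθ0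
      linarith
    linarith
  have e4 := mul_le_mul_of_nonneg_left e3 hχ0
  have e5 : χ * (θ * ((E3 + E4) * (1 + ‖p‖ ^ 2))) ≤ (E3 + E4) * (1 + ‖p‖ ^ 2) := by
    have : 0 ≤ (E3 + E4) * (1 + ‖p‖ ^ 2) := by positivity
    exact (mul_le_of_le_one_left (by positivity) hχ1).trans (mul_le_of_le_one_left this hθ1)
  rw [generator_eq (contDiffAt_windowFun hU hc.contDiff hΦ.contDiff hx),
    fderiv_windowFun_apply hU hc.contDiff hΦ hx, momentumLaplacian_windowFun hU hc.contDiff hΦ hx]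
  have e6 : P.σ * (χ * (θ * (s * (4 * r * Φ'' r + 2 * (k * N) * Φ' r)))) =
      χ * (θ * (n * (4 * r * Φ'' r + 2 * (k * N) * Φ' r))) := by rw [← hσs]; ring
  have e7 : windowError k P μ Λ B Cφ Gc Lc R H n * (1 + ‖p‖ ^ 2) =
      2 * B * ((μ + P.kB * P.T * (k * N)) / P.a) * LM * (1 + ‖p‖ ^ 2) +
      4 * B * H / R * μ * LM * (1 + ‖p‖ ^ 2) + (E3 + E4) * (1 + ‖p‖ ^ 2) := by
    rw [hE3, hE4, hLM, hs]; unfold windowError; ring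
  rw [e6, e7]
  linarith

/-! ### Localized perturbations with errors negligible against `n`. -/

variable {N k : ℕ} {P : Params N} {U : Conf N k → ℝ≥0∞}

/-- The properties of the localized perturbations in the unstable region `ξ ≈ -n`. -/
structure IsWindowTerm (P : Params N) (U : Conf N k → ℝ≥0∞) (C Λ η : ℝ) (n : ℕ)
    (F : Phase N k → ℝ) (G : Phase N k → Conf N k) : Prop where
  contDiffAt : ∀ x ∈ stateSpace U, ContDiffAt ℝ 2 F x
  eq_zero : ∀ x : Phase N k, 1 ≤ |x.2.2 + n| → F x = 0
  abs_le : ∀ x, |F x| ≤ η * n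
  fderiv_eq : ∀ x ∈ stateSpace U, ∀ j, fderiv ℝ F x (momentumDir j) = window (x.2.2 + n) * G x j
  -- The squared gradient carries a single power of the window, although that of `F` carries two:
  -- this stronger form survives summation over overlapping windows.
  estimate : ∀ x ∈ stateSpace U, |x.2.2 + n| ≤ 1 →
    generator P U F x + window (x.2.2 + n) *
      (P.σ * ‖G x‖ ^ 2 + Λ * (1 + ‖x.2.1‖) * ‖G x‖) ≤
    -(window (x.2.2 + n) * gradCut U (2 * C * n) x.1 * (k * N / 2 * n)) +
      η * n * (1 + ‖x.2.1‖ ^ 2)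

/-- Sorts the remainder by growth, `log n`, `H (log n)/n` and `√n`, with coefficients free of `n`
and `H`. Each is `o(n)` for the Hessian bound in use. -/
theorem windowError_le {μ Λ B Cφ Gc C H n : ℝ} (hμ : 0 ≤ μ) (hΛ : 0 ≤ Λ) (hB : 0 ≤ B)
    (hCφ : 0 < Cφ) (hC : 0 < C) (hH : 0 ≤ H) (hn : 1 ≤ n) :
    windowError k P μ Λ B Cφ Gc (2 * ((1 + 8 * B) * H / n)) (2 * C * n) H n ≤
      (4 * B * ((μ + P.kB * P.T * (k * N)) / P.a) * Cφ + Cφ + 2 * Cφ * (1 + Gc ^ 2) / P.σ +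
        2 * Cφ * (1 + P.γ * μ + Λ)) * (1 + Real.log n) +
      (4 * B * μ * Cφ / C + 4 * Cφ * (1 + 8 * B) * μ) * (H * (1 + Real.log n) / n) +
      (2 * Cφ * (1 + (1 + P.γ * μ) * Gc + Λ * (1 + Gc)) / √P.σ) * √n := by
  have hσ := P.σ_pos
  have hγ := P.γ_pos
  have ha := P.a_pos
  have hk : 0 < P.kB * P.T := mul_pos P.kB_pos P.T_pos
  have hn0 : 0 < n := by linarith
  have hlog : 0 ≤ Real.log n := Real.log_nonneg hn
  have h1 : 1 + 2 * Real.log n ≤ 2 * (1 + Real.log n) := by linarith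
  have hl1 : 1 ≤ 1 + Real.log n := by linarith
  unfold windowError
  have t1 : 2 * B * ((μ + P.kB * P.T * (k * N)) / P.a) * (Cφ * (1 + 2 * Real.log n)) ≤
      4 * B * ((μ + P.kB * P.T * (k * N)) / P.a) * Cφ * (1 + Real.log n) := by
    calc _ ≤ 2 * B * ((μ + P.kB * P.T * (k * N)) / P.a) * (Cφ * (2 * (1 + Real.log n))) := by
          gcongr
      _ = _ := by ring
  have t2 : 4 * B * H / (2 * C * n) * μ * (Cφ * (1 + 2 * Real.log n)) ≤
      4 * B * μ * Cφ / C * (H * (1 + Real.log n) / n) := by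
    calc _ ≤ 4 * B * H / (2 * C * n) * μ * (Cφ * (2 * (1 + Real.log n))) := by gcongr
      _ = _ := by field_simp
  have t3 : Cφ / n ≤ Cφ * (1 + Real.log n) :=
    (div_le_self hCφ.le hn).trans (le_mul_of_one_le_right hCφ.le hl1)
  have t4 : 2 * Cφ * (1 + Gc ^ 2) / P.σ ≤ 2 * Cφ * (1 + Gc ^ 2) / P.σ * (1 + Real.log n) :=
    le_mul_of_one_le_right (by positivity) hl1
  have t5 : 2 * Cφ * (1 + P.γ * μ + Λ) ≤ 2 * Cφ * (1 + P.γ * μ + Λ) * (1 + Real.log n) :=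
    le_mul_of_one_le_right (by positivity) hl1
  have t6 : 2 * Cφ * (2 * ((1 + 8 * B) * H / n) * μ) ≤
      4 * Cφ * (1 + 8 * B) * μ * (H * (1 + Real.log n) / n) := by
    calc 2 * Cφ * (2 * ((1 + 8 * B) * H / n) * μ) =
          4 * Cφ * (1 + 8 * B) * μ * (H * 1 / n) := by ring
      _ ≤ _ := by gcongr
  have t7 : 2 * (Cφ * √(n / P.σ)) * (1 + (1 + P.γ * μ) * Gc + Λ * (1 + Gc)) =
      2 * Cφ * (1 + (1 + P.γ * μ) * Gc + Λ * (1 + Gc)) / √P.σ * √n := by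
    rw [Real.sqrt_div hn0.le]; ring
  linarith

theorem tendsto_one_add_log_div : Tendsto (fun n : ℕ => (1 + Real.log n) / n) atTop (𝓝 0) := by
  have h1 : Tendsto (fun x : ℝ => (1 + Real.log x) / x) atTop (𝓝 0) := by
    have := tendsto_inv_atTop_zero.add Real.isLittleO_log_id_atTop.tendsto_div_nhds_zero
    simpa [add_div] using this
  exact h1.comp tendsto_natCast_atTop_atTop

theorem tendsto_sqrt_div : Tendsto (fun n : ℕ => √(n : ℝ) / n) atTop (𝓝 0) := by
  have h1 : Tendsto (fun x : ℝ => (√x)⁻¹) atTop (𝓝 0) :=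
    tendsto_inv_atTop_zero.comp Real.tendsto_sqrt_atTop
  refine (h1.comp tendsto_natCast_atTop_atTop).congr fun n => ?_
  simp [Real.sqrt_div_self]

theorem exists_windowTerm (hU : IsNormal P U) (hN : 1 ≤ N) (hk : 1 ≤ k) {C Λ η : ℝ} (hC : 0 < C)
    (hΛ : 0 ≤ Λ) (hη : 0 < η) :
    ∃ n₀ : ℕ, 1 ≤ n₀ ∧ ∀ n : ℕ, n₀ ≤ n → ∃ (F : Phase N k → ℝ) (G : Phase N k → Conf N k),
      IsWindowTerm P U C Λ η n F G := by
  obtain ⟨B, hB0, hB⟩ := exists_abs_deriv_smoothTransition_le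
  have hd : (1 : ℝ) ≤ k * N := by
    have h1 : (1 : ℝ) ≤ k := by exact_mod_cast hk
    have h2 : (1 : ℝ) ≤ N := by exact_mod_cast hN
    nlinarith
  obtain ⟨Cφ, hCφ, hprof⟩ := exists_profile hd
  obtain ⟨H, hH0, hH, hHt⟩ := hU.exists_hessian_bound (R := 8 * C) (by positivity)
  set μ := ‖massInv (k := k) P‖ with hμ
  have hμ0 : 0 ≤ μ := norm_nonneg _
  -- smallness of the error terms
  set K₀ := 4 * B * ((μ + P.kB * P.T * (k * N)) / P.a) * Cφ + Cφ +
    2 * Cφ * (1 + (8 * C) ^ 2) / P.σ + 2 * Cφ * (1 + P.γ * μ + Λ) with hK₀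
  set K₁ := 4 * B * μ * Cφ / C + 4 * Cφ * (1 + 8 * B) * μ with hK₁
  set K₂ := 2 * Cφ * (1 + (1 + P.γ * μ) * (8 * C) + Λ * (1 + 8 * C)) / √P.σ with hK₂
  have ht1 : Tendsto (fun n : ℕ => K₀ * ((1 + Real.log n) / n) +
      K₁ * (H n * (1 + Real.log n) / (n : ℝ) ^ 2) + K₂ * (√(n : ℝ) / n)) atTop (𝓝 0) := by
    simpa using ((tendsto_one_add_log_div.const_mul K₀).add (hHt.const_mul K₁)).add
      (tendsto_sqrt_div.const_mul K₂)
  have ht2 : Tendsto (fun n : ℕ => 2 * Cφ * ((1 + Real.log n) / n)) atTop (𝓝 0) := by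
    simpa using tendsto_one_add_log_div.const_mul (2 * Cφ)
  have ht3 : Tendsto (fun n : ℕ => 16 * μ * (1 + 8 * B) *
      (H n * (1 + Real.log n) / (n : ℝ) ^ 2)) atTop (𝓝 0) := by
    simpa using hHt.const_mul (16 * μ * (1 + 8 * B))
  obtain ⟨n₀, hn₀⟩ := eventually_atTop.1 ((ht1.eventually_lt_const hη).and
    ((ht2.eventually_lt_const hη).and (ht3.eventually_lt_const one_pos)))
  refine ⟨max n₀ 1, le_max_right _ _, fun n hn => ?_⟩
  obtain ⟨hs1, hs2, hs3⟩ := hn₀ n ((le_max_left _ _).trans hn)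
  have hn1 : (1 : ℝ) ≤ n := by exact_mod_cast (le_max_right _ _).trans hn
  have hn0 : (0 : ℝ) < n := by linarith
  have hlog : 0 ≤ Real.log n := Real.log_nonneg hn1
  have hR : 0 < 2 * C * n := by positivity
  -- Nested radii: the cutoff is `1` up to `2Cn` and is supported in `|∇U| ≤ 4Cn`, where the clipped
  -- gradient still equals `∇U`. The latter is supported in `|∇U| ≤ 8Cn`, which explains `R = 8C` in
  -- the Hessian bound and the size `8C` of the rescaled field.
  have hρ : 0 < 4 * C * n := by positivity
  have hHn : ∀ q ∈ finiteSet U, ‖gradient (pot U) q‖ ≤ 2 * (4 * C * n) →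
      ‖fderiv ℝ (gradient (pot U)) q‖ ≤ H n := fun q hq h =>
    hH n q hq (h.trans (le_of_eq (by ring)))
  obtain ⟨M, hM, hg⟩ := exists_isTame_clippedGradient hU hρ hn0 hB (hH0 n) hHn
  have hGc : 2 * (4 * C * n) / n = 8 * C := by field_simp; ring
  rw [hGc] at hg
  -- The spectral gap condition of the slow manifold, amounting to `H n = o(n²)`.
  have hslow : 16 * μ * ((1 + 8 * B) * H n / n) ≤ n := by
    have h1 : 16 * μ * (1 + 8 * B) * (H n * 1 / (n : ℝ) ^ 2) ≤
        16 * μ * (1 + 8 * B) * (H n * (1 + Real.log n) / (n : ℝ) ^ 2) := by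
      have := hH0 n
      gcongr
      linarith
    have h2 := mul_le_mul_of_nonneg_right (h1.trans hs3.le) hn0.le
    calc _ = 16 * μ * (1 + 8 * B) * (H n * 1 / (n : ℝ) ^ 2) * n := by field_simp
      _ ≤ 1 * n := h2
      _ = n := one_mul _
  obtain ⟨c, hc, hres⟩ := exists_slow_manifold (A := massInv P) (by have := hH0 n; positivity) hM
    (le_refl μ) hslow hn0 one_pos hg
  obtain ⟨Φ, Φ', Φ'', hΦ⟩ := hprof ((n : ℝ) ^ 2) (by nlinarith)
  refine ⟨windowFun U (2 * C * n) n (n / P.σ) c Φ, windowGrad U (2 * C * n) (n / P.σ) c Φ',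
    fun x hx => contDiffAt_windowFun hU hc.contDiff hΦ.contDiff hx, fun x hx => ?_, fun x => ?_,
    fun x hx j => fderiv_windowFun_momentumDir hU hc.contDiff hΦ hx j, fun x hx hξ => ?_⟩
  · unfold windowFun; rw [window_eq_zero hx, zero_mul]
  · have h1 := hΦ.abs_le (n / P.σ * ‖x.2.1 - c x.1‖ ^ 2) (by have := P.σ_pos; positivity)
    rw [Real.log_pow, Nat.cast_ofNat] at h1
    have h2 : 2 * Cφ * (1 + Real.log n) ≤ η * n := by
      have := mul_le_mul_of_nonneg_right hs2.le hn0.le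
      calc _ = 2 * Cφ * ((1 + Real.log n) / n) * n := by field_simp
        _ ≤ _ := this
    unfold windowFun
    rw [abs_mul, abs_mul, abs_of_nonneg (window_nonneg _), abs_of_nonneg (gradCut_nonneg _ _ _)]
    calc _ ≤ 1 * (1 * (Cφ * (1 + 2 * Real.log n))) := by
          gcongr
          · exact mul_nonneg (gradCut_nonneg _ _ _) (abs_nonneg _)
          · exact window_le_one _
          · exact gradCut_le_one _ _ _
      _ ≤ η * n := by
          rw [one_mul, one_mul]
          refine le_trans ?_ h2
          have : Cφ * (1 + 2 * Real.log n) ≤ Cφ * (2 * (1 + Real.log n)) := by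
            gcongr; linarith
          linarith
  · have hgq : ∀ q ∈ finiteSet U, ‖gradient (pot U) q‖ ≤ 2 * (2 * C * n) →
        (n : ℝ) • ((n : ℝ)⁻¹ • clippedGradient U (4 * C * n) q) = gradient (pot U) q := by
      intro q hq h
      rw [smul_smul, mul_inv_cancel₀ hn0.ne', one_smul]
      exact clippedGradient_eq hρ hq (h.trans (le_of_eq (by ring)))
    have h1 := windowFun_estimate hU hR hn1 hΛ hB hCφ hΦ hc hres hgq (hH0 n)
      (fun q hq h => hHn q hq (h.trans (by linarith))) hx hξ
    refine h1.trans (add_le_add_right (mul_le_mul_of_nonneg_right ?_ (by positivity)) _)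
    refine (windowError_le hμ0 hΛ hB0.le hCφ hC (hH0 n) hn1).trans ?_
    have h2 := mul_le_mul_of_nonneg_right hs1.le hn0.le
    have h3 : ∀ a b c : ℝ, a * (1 + Real.log n) + b * (H n * (1 + Real.log n) / n) + c * √n =
        (a * ((1 + Real.log n) / n) + b * (H n * (1 + Real.log n) / (n : ℝ) ^ 2) +
          c * (√n / n)) * n := by
      intro a b c
      field_simp
    exact (h3 _ _ _).trans_le h2

/-! ### Summation over the windows. -/

variable {N k : ℕ} {P : Params N} {U : Conf N k → ℝ≥0∞}

theorem gradMomentumSq_eq {f : Phase N k → ℝ} {x : Phase N k} {D : Conf N k}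
    (h : ∀ j, fderiv ℝ f x (momentumDir j) = D j) : gradMomentumSq f x = ‖D‖ ^ 2 := by
  unfold gradMomentumSq
  rw [EuclideanSpace.real_norm_sq_eq]
  exact Finset.sum_congr rfl fun j _ => by rw [h j]

theorem IsWindowTerm.generator_eq_zero {C Λ η : ℝ} {n : ℕ} {F : Phase N k → ℝ}
    {G : Phase N k → Conf N k} (h : IsWindowTerm P U C Λ η n F G) {x : Phase N k}
    (hx : 1 < |x.2.2 + n|) : generator P U F x = 0 := by
  have h1 : F =ᶠ[𝓝 x] fun _ => 0 := by
    have hc : Continuous fun y : Phase N k => |y.2.2 + n| := by fun_prop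
    filter_upwards [hc.continuousAt.eventually (lt_mem_nhds hx)] with y hy
    exact h.eq_zero y hy.le
  rw [generator_congr h1, generator_const]

theorem card_window_le (ξ : ℝ) (s : Finset ℕ) (hs : ∀ n ∈ s, |ξ + n| ≤ 1) : s.card ≤ 3 := by
  have h : s ⊆ Finset.Icc (⌊-ξ⌋₊ - 1) (⌊-ξ⌋₊ + 1) := by
    intro n hn
    obtain ⟨h1, h2⟩ := abs_le.1 (hs n hn)
    have h3 := Nat.lt_floor_add_one (-ξ)
    rw [Finset.mem_Icc]
    constructor
    · rcases le_or_gt 0 (-ξ) with h0 | h0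
      · have h4 := Nat.floor_le h0
        have : ((⌊-ξ⌋₊ : ℕ) : ℝ) ≤ n + 1 := by linarith
        have : ⌊-ξ⌋₊ ≤ n + 1 := by exact_mod_cast this
        omega
      · rw [Nat.floor_of_nonpos h0.le]; omega
    · have : (n : ℝ) < (⌊-ξ⌋₊ : ℕ) + 2 := by linarith
      have : n < ⌊-ξ⌋₊ + 2 := by exact_mod_cast this
      omega
  refine (Finset.card_le_card h).trans ?_
  rw [Nat.card_Icc]; omega

/-- The sum of the localized perturbations. -/
def windowSum (F : ℕ → Phase N k → ℝ) (n₀ : ℕ) (x : Phase N k) : ℝ :=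
  ∑ n ∈ Finset.Ico n₀ (n₀ + ⌈|x.2.2| + 1⌉₊), F n x

theorem windowSum_eq {F : ℕ → Phase N k → ℝ} {n₀ : ℕ}
    (h : ∀ n, n₀ ≤ n → ∀ x : Phase N k, 1 ≤ |x.2.2 + n| → F n x = 0) {m : ℕ} {x : Phase N k}
    (hm : |x.2.2| + 1 ≤ m) : windowSum F n₀ x = ∑ n ∈ Finset.Ico n₀ m, F n x := by
  have key : ∀ m m' : ℕ, |x.2.2| + 1 ≤ m → m ≤ m' →
      ∑ n ∈ Finset.Ico n₀ m, F n x = ∑ n ∈ Finset.Ico n₀ m', F n x := by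
    intro m m' h1 h2
    refine Finset.sum_subset (Finset.Ico_subset_Ico_right h2) fun n hn hn' => h n ?_ x ?_
    · exact (Finset.mem_Ico.1 hn).1
    · have h3 : m ≤ n := by
        rw [Finset.mem_Ico] at hn hn'; omega
      have h4 : (m : ℝ) ≤ n := by exact_mod_cast h3
      have := neg_abs_le x.2.2
      exact (by linarith : 1 ≤ x.2.2 + n).trans (le_abs_self _)
  have hm' : |x.2.2| + 1 ≤ ((n₀ + ⌈|x.2.2| + 1⌉₊ : ℕ) : ℝ) := by
    have := Nat.le_ceil (|x.2.2| + 1)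
    push_cast
    have : (0 : ℝ) ≤ n₀ := Nat.cast_nonneg _
    linarith
  unfold windowSum
  rw [key _ _ hm' (le_max_left _ m), key m _ hm (le_max_right _ _)]

/-- The extra unit in `|ξ| + 2` leaves room for `ξ` to vary, so the range of summation is fixed on a
neighbourhood and derivatives may be taken termwise. -/
theorem windowSum_eventuallyEq {F : ℕ → Phase N k → ℝ} {n₀ : ℕ}
    (h : ∀ n, n₀ ≤ n → ∀ x : Phase N k, 1 ≤ |x.2.2 + n| → F n x = 0) {m : ℕ} {x : Phase N k}
    (hm : |x.2.2| + 2 ≤ m) : windowSum F n₀ =ᶠ[𝓝 x] fun y => ∑ n ∈ Finset.Ico n₀ m, F n y := by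
  have hc : Continuous fun y : Phase N k => |y.2.2| := by fun_prop
  filter_upwards [hc.continuousAt.eventually (gt_mem_nhds (lt_add_one |x.2.2|))] with y hy
  exact windowSum_eq h (by linarith)

/-- The perturbation that makes use of the expansion of the momenta when `ξ → -∞`. -/
theorem exists_expanding_perturbation (hU : IsNormal P U) (hN : 1 ≤ N) (hk : 1 ≤ k) {C Λ η : ℝ}
    (hC : 0 < C) (hΛ : 0 ≤ Λ) (hη : 0 < η) :
    ∃ (n₀ : ℕ) (ψ : Phase N k → ℝ) (D : Phase N k → Conf N k), 1 ≤ n₀ ∧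
      (∀ x ∈ stateSpace U, ContDiffAt ℝ 2 ψ x) ∧
      (∀ x, |ψ x| ≤ η * x.2.2 ^ 2) ∧
      (∀ x ∈ stateSpace U, ∀ j, fderiv ℝ ψ x (momentumDir j) = D x j) ∧
      (∀ x ∈ stateSpace U, 0 ≤ x.2.2 → generator P U ψ x +
        (P.σ * ‖D x‖ ^ 2 + Λ * (1 + ‖x.2.1‖) * ‖D x‖) ≤ 0) ∧
      (∀ x ∈ stateSpace U, generator P U ψ x +
        (P.σ * ‖D x‖ ^ 2 + Λ * (1 + ‖x.2.1‖) * ‖D x‖) ≤ η * |x.2.2| * (1 + ‖x.2.1‖ ^ 2)) ∧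
      (∀ x ∈ stateSpace U, x.2.2 ≤ -(n₀ : ℝ) → ‖gradient (pot U) x.1‖ ≤ C * |x.2.2| →
        generator P U ψ x + (P.σ * ‖D x‖ ^ 2 + Λ * (1 + ‖x.2.1‖) * ‖D x‖) ≤
          -(k * N / 2 * (|x.2.2| - 1)) + η * |x.2.2| * (1 + ‖x.2.1‖ ^ 2)) := by
  obtain ⟨n₁, -, hn₁⟩ := exists_windowTerm hU hN hk hC hΛ (by positivity : 0 < η / 6)
  -- With `n ≥ 2`, every window vanishes for `ξ ≥ 0`, and `n ≤ 2|ξ|` on the support of the `n`-th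
  -- one. At most three windows meet a given `ξ`, so a tolerance `η/6` per window gives `η` in
  -- total.
  set n₀ := max n₁ 2 with hn₀
  choose! F G hFG using fun n (h : n₁ ≤ n) => hn₁ n h
  have hF : ∀ n, n₀ ≤ n → IsWindowTerm P U C Λ (η / 6) n (F n) (G n) := fun n hn =>
    hFG n ((le_max_left _ _).trans hn)
  have hF0 : ∀ n, n₀ ≤ n → ∀ x : Phase N k, 1 ≤ |x.2.2 + n| → F n x = 0 := fun n hn =>
    (hF n hn).eq_zero
  have h2 : ∀ n : ℕ, n₀ ≤ n → (2 : ℝ) ≤ n := fun n hn => by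
    exact_mod_cast (le_max_right n₁ 2).trans hn
  set m : Phase N k → ℕ := fun x => n₀ + ⌈|x.2.2| + 2⌉₊ with hm
  have hmx : ∀ x, |x.2.2| + 2 ≤ m x := fun x => by
    have := Nat.le_ceil (|x.2.2| + 2)
    have h0 : (0 : ℝ) ≤ n₀ := Nat.cast_nonneg _
    simp only [hm]; push_cast; linarith
  have hcd : ∀ x ∈ stateSpace U, ∀ n ∈ Finset.Ico n₀ (m x), ContDiffAt ℝ 2 (F n) x :=
    fun x hx n hn => (hF n (Finset.mem_Ico.1 hn).1).contDiffAt x hx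
  set χ : Phase N k → ℕ → ℝ := fun x n => window (x.2.2 + n) with hχ
  set D : Phase N k → Conf N k := fun x => ∑ n ∈ Finset.Ico n₀ (m x), χ x n • G n x with hD
  -- reduction to the individual terms
  have hχ1 : ∀ x, ∑ n ∈ Finset.Ico n₀ (m x), χ x n ≤ 1 := fun x => by
    rw [sum_window x.2.2 n₀ (m x) (Nat.le_add_right _ _)]
    linarith [Real.smoothTransition.le_one (x.2.2 + m x),
      Real.smoothTransition.nonneg (x.2.2 + n₀)]
  have hDn : ∀ x, ‖D x‖ ≤ ∑ n ∈ Finset.Ico n₀ (m x), χ x n * ‖G n x‖ := fun x => by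
    refine (norm_sum_le _ _).trans (Finset.sum_le_sum fun n _ => ?_)
    rw [norm_smul, Real.norm_of_nonneg (window_nonneg _)]
  -- Cauchy–Schwarz with the weights `χ`, whose sum is at most `1`: overlapping windows do not
  -- increase the quadratic term.
  have hDsq : ∀ x, ‖D x‖ ^ 2 ≤ ∑ n ∈ Finset.Ico n₀ (m x), χ x n * ‖G n x‖ ^ 2 := fun x => by
    have h3 := Finset.sum_sq_le_sum_mul_sum_of_sq_le_mul (Finset.Ico n₀ (m x))
      (r := fun n => χ x n * ‖G n x‖) (f := fun n => χ x n) (g := fun n => χ x n * ‖G n x‖ ^ 2)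
      (fun n _ => window_nonneg _)
      (fun n _ => mul_nonneg (window_nonneg _) (sq_nonneg _)) (fun n _ => le_of_eq (by ring))
    have h4 : 0 ≤ ∑ n ∈ Finset.Ico n₀ (m x), χ x n * ‖G n x‖ ^ 2 :=
      Finset.sum_nonneg fun n _ => mul_nonneg (window_nonneg _) (sq_nonneg _)
    refine (pow_le_pow_left₀ (norm_nonneg _) (hDn x) 2).trans (h3.trans ?_)
    exact mul_le_of_le_one_left h4 (hχ1 x)
  set τ : Phase N k → ℕ → ℝ := fun x n => generator P U (F n) x +
    χ x n * (P.σ * ‖G n x‖ ^ 2 + Λ * (1 + ‖x.2.1‖) * ‖G n x‖) with hτ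
  have htot : ∀ x ∈ stateSpace U, generator P U (windowSum F n₀) x +
      (P.σ * ‖D x‖ ^ 2 + Λ * (1 + ‖x.2.1‖) * ‖D x‖) ≤ ∑ n ∈ Finset.Ico n₀ (m x), τ x n := by
    intro x hx
    rw [generator_congr (windowSum_eventuallyEq hF0 (hmx x)), generator_sum _ (hcd x hx)]
    have e : ∑ n ∈ Finset.Ico n₀ (m x), τ x n =
        ∑ n ∈ Finset.Ico n₀ (m x), generator P U (F n) x +
        (P.σ * ∑ n ∈ Finset.Ico n₀ (m x), χ x n * ‖G n x‖ ^ 2 +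
          Λ * (1 + ‖x.2.1‖) * ∑ n ∈ Finset.Ico n₀ (m x), χ x n * ‖G n x‖) := by
      rw [Finset.mul_sum, Finset.mul_sum, ← Finset.sum_add_distrib, ← Finset.sum_add_distrib]
      exact Finset.sum_congr rfl fun n _ => by rw [hτ]; ring
    rw [e]
    have h3 := mul_le_mul_of_nonneg_left (hDsq x) P.σ_pos.le
    have h4 := mul_le_mul_of_nonneg_left (hDn x)
      (by positivity : 0 ≤ Λ * (1 + ‖x.2.1‖))
    linarith
  have hτ0 : ∀ (x : Phase N k) (n : ℕ), n₀ ≤ n → 1 < |x.2.2 + n| → τ x n = 0 := by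
    intro x n hn h
    simp only [hτ, hχ]
    rw [(hF n hn).generator_eq_zero h, window_eq_zero h.le, zero_mul, add_zero]
  have hbound : ∀ x ∈ stateSpace U, ∑ n ∈ Finset.Ico n₀ (m x), τ x n ≤
      -(∑ n ∈ Finset.Ico n₀ (m x), χ x n * gradCut U (2 * C * n) x.1 * (k * N / 2 * n)) +
        η * |x.2.2| * (1 + ‖x.2.1‖ ^ 2) := by
    intro x hx
    have h3 : ∀ n ∈ Finset.Ico n₀ (m x), τ x n ≤
        -(χ x n * gradCut U (2 * C * n) x.1 * (k * N / 2 * n)) +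
        if |x.2.2 + n| ≤ 1 then η / 3 * |x.2.2| * (1 + ‖x.2.1‖ ^ 2) else 0 := by
      intro n hn
      have hn' := (Finset.mem_Ico.1 hn).1
      split_ifs with h
      · refine ((hF n hn').estimate x hx h).trans (add_le_add_right ?_ _)
        refine mul_le_mul_of_nonneg_right ?_ (by positivity)
        have h4 := h2 n hn'
        have h5 := (abs_le.1 h).2
        have h6 := neg_abs_le x.2.2
        have h7 : (n : ℝ) ≤ 2 * |x.2.2| := by linarith
        calc η / 6 * n ≤ η / 6 * (2 * |x.2.2|) := by gcongr
          _ = _ := by ring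
      · rw [hτ0 x n hn' (not_le.1 h)]
        simp only [hχ]
        rw [window_eq_zero (not_le.1 h).le]
        simp
    refine (Finset.sum_le_sum h3).trans ?_
    rw [Finset.sum_add_distrib, Finset.sum_neg_distrib, ← Finset.sum_filter, Finset.sum_const,
      nsmul_eq_mul]
    refine add_le_add_right ?_ _
    have h8 := card_window_le x.2.2 {n ∈ Finset.Ico n₀ (m x) | |x.2.2 + (n : ℝ)| ≤ 1}
      fun n hn => (Finset.mem_filter.1 hn).2
    have h9 : (({n ∈ Finset.Ico n₀ (m x) | |x.2.2 + (n : ℝ)| ≤ 1} : Finset ℕ).card : ℝ) ≤ 3 := by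
      exact_mod_cast h8
    calc _ ≤ 3 * (η / 3 * |x.2.2| * (1 + ‖x.2.1‖ ^ 2)) := by gcongr
      _ = _ := by ring
  refine ⟨n₀, windowSum F n₀, D, le_trans (by norm_num) (le_max_right _ _), fun x hx => ?_,
    fun x => ?_, fun x hx j => ?_, fun x hx hξ => ?_, fun x hx => ?_, fun x hx hξ hgr => ?_⟩
  · exact (ContDiffAt.sum fun n hn => hcd x hx n hn).congr_of_eventuallyEq
      (windowSum_eventuallyEq hF0 (hmx x))
  · rw [windowSum_eq hF0 (m := m x) (by linarith [hmx x])]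
    have h3 : ∀ n ∈ Finset.Ico n₀ (m x), |F n x| ≤
        if |x.2.2 + n| ≤ 1 then η / 3 * x.2.2 ^ 2 else 0 := by
      intro n hn
      have hn' := (Finset.mem_Ico.1 hn).1
      split_ifs with h
      · refine ((hF n hn').abs_le x).trans ?_
        have h4 := h2 n hn'
        have h5 := (abs_le.1 h).2
        have h7 : (n : ℝ) ≤ 2 * x.2.2 ^ 2 := by nlinarith
        calc η / 6 * n ≤ η / 6 * (2 * x.2.2 ^ 2) := by gcongr
          _ = _ := by ring
      · rw [hF0 n hn' x (not_le.1 h).le, abs_zero]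
    refine (Finset.abs_sum_le_sum_abs _ _).trans ((Finset.sum_le_sum h3).trans ?_)
    rw [← Finset.sum_filter, Finset.sum_const, nsmul_eq_mul]
    have h8 := card_window_le x.2.2 {n ∈ Finset.Ico n₀ (m x) | |x.2.2 + (n : ℝ)| ≤ 1}
      fun n hn => (Finset.mem_filter.1 hn).2
    have h9 : (({n ∈ Finset.Ico n₀ (m x) | |x.2.2 + (n : ℝ)| ≤ 1} : Finset ℕ).card : ℝ) ≤ 3 := by
      exact_mod_cast h8
    calc _ ≤ 3 * (η / 3 * x.2.2 ^ 2) := by gcongr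
      _ = _ := by ring
  · rw [(windowSum_eventuallyEq hF0 (hmx x)).fderiv_eq, fderiv_fun_sum fun n hn =>
      (hcd x hx n hn).differentiableAt (by norm_num), sum_apply]
    simp only [hD, WithLp.ofLp_sum, Finset.sum_apply, PiLp.smul_apply, smul_eq_mul]
    exact Finset.sum_congr rfl fun n hn =>
      (hF n (Finset.mem_Ico.1 hn).1).fderiv_eq x hx j
  · refine (htot x hx).trans (le_of_eq (Finset.sum_eq_zero fun n hn => ?_))
    have hn' := (Finset.mem_Ico.1 hn).1
    refine hτ0 x n hn' ?_
    have := h2 n hn'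
    exact (by linarith : 1 < x.2.2 + n).trans_le (le_abs_self _)
  · refine (htot x hx).trans ((hbound x hx).trans ?_)
    have : 0 ≤ ∑ n ∈ Finset.Ico n₀ (m x),
        χ x n * gradCut U (2 * C * n) x.1 * (k * N / 2 * n) :=
      Finset.sum_nonneg fun n _ => mul_nonneg
        (mul_nonneg (window_nonneg _) (gradCut_nonneg _ _ _)) (by positivity)
    linarith
  · refine (htot x hx).trans ((hbound x hx).trans (add_le_add_left (neg_le_neg ?_) _))
    have hsum : ∑ n ∈ Finset.Ico n₀ (m x), χ x n = 1 := by
      rw [sum_window x.2.2 n₀ (m x) (Nat.le_add_right _ _),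
        Real.smoothTransition.one_of_one_le, Real.smoothTransition.zero_of_nonpos, sub_zero]
      · linarith
      · linarith [hmx x, neg_abs_le x.2.2]
    have h3 : ∀ n ∈ Finset.Ico n₀ (m x), χ x n * (k * N / 2 * (|x.2.2| - 1)) ≤
        χ x n * gradCut U (2 * C * n) x.1 * (k * N / 2 * n) := by
      intro n hn
      have hn' := (Finset.mem_Ico.1 hn).1
      have h4 := h2 n hn'
      rcases le_or_gt |x.2.2 + n| 1 with h | h
      · have hneg : |x.2.2| = -x.2.2 := abs_of_neg (by
          have : (0 : ℝ) ≤ n₀ := Nat.cast_nonneg _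
          have := (abs_le.1 h).2; linarith)
        have h5 := (abs_le.1 h).1
        rw [gradCut_eq_one (by positivity), mul_one]
        · refine mul_le_mul_of_nonneg_left ?_ (window_nonneg _)
          refine mul_le_mul_of_nonneg_left ?_ (by positivity)
          have := (abs_le.1 h).2
          linarith
        -- On this window `|ξ| ≤ n + 1 ≤ 2n`, so `|∇U| ≤ C|ξ|` implies `|∇U| ≤ 2Cn` and the cutoff
        -- equals `1`.
        · refine hgr.trans ?_
          rw [hneg]
          nlinarith
      · simp only [hχ]
        rw [window_eq_zero h.le]; simp
    have h5 := Finset.sum_le_sum h3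
    rwa [← Finset.sum_mul, hsum, one_mul] at h5

/-! ### The scale function of `ξ`. -/

section Scale

/-- A smooth positive function of size `2|ξ|` at `-∞` and `1 / (2ξ)` at `+∞`. -/
def nhScale (ξ : ℝ) : ℝ := √(1 + ξ ^ 2) - ξ

theorem abs_le_sqrt_one_add_sq (ξ : ℝ) : |ξ| ≤ √(1 + ξ ^ 2) :=
  Real.abs_le_sqrt (by linarith)

theorem one_le_sqrt_one_add_sq (ξ : ℝ) : 1 ≤ √(1 + ξ ^ 2) :=
  Real.one_le_sqrt.2 (by nlinarith [sq_nonneg ξ])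

theorem sqrt_one_add_sq_le (ξ : ℝ) : √(1 + ξ ^ 2) ≤ 1 + |ξ| := by
  rw [Real.sqrt_le_left (by positivity)]
  nlinarith [abs_nonneg ξ, sq_abs ξ]

theorem nhScale_pos (ξ : ℝ) : 0 < nhScale ξ := by
  have h : √(ξ ^ 2) < √(1 + ξ ^ 2) := Real.sqrt_lt_sqrt (sq_nonneg _) (by linarith)
  rw [Real.sqrt_sq_eq_abs] at h
  unfold nhScale
  linarith [le_abs_self ξ]

theorem nhScale_le (ξ : ℝ) : nhScale ξ ≤ 2 * √(1 + ξ ^ 2) := by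
  unfold nhScale
  linarith [abs_le_sqrt_one_add_sq ξ, neg_abs_le ξ]

theorem nhScale_le_one {ξ : ℝ} (h : 0 ≤ ξ) : nhScale ξ ≤ 1 := by
  have := sqrt_one_add_sq_le ξ
  rw [abs_of_nonneg h] at this
  unfold nhScale; linarith

/-- The logarithmic derivative is `-1/√(1 + ξ²)`, so motion in `ξ` changes the amplitude of the
virial perturbation by a bounded relative rate per unit of `ξ`. -/
theorem hasDerivAt_nhScale (ξ : ℝ) :
    HasDerivAt nhScale (-(nhScale ξ / √(1 + ξ ^ 2))) ξ := by
  have h1 : HasDerivAt (fun ξ : ℝ => 1 + ξ ^ 2) (2 * ξ) ξ := by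
    simpa using (hasDerivAt_pow 2 ξ).const_add 1
  have h0 : 0 < √(1 + ξ ^ 2) := by linarith [one_le_sqrt_one_add_sq ξ]
  have h2 := (h1.sqrt (by positivity)).sub (hasDerivAt_id ξ)
  refine h2.congr_deriv ?_
  unfold nhScale
  field_simp
  ring

theorem contDiff_nhScale : ContDiff ℝ ∞ nhScale :=
  ContDiff.sub (ContDiff.sqrt (by fun_prop) fun ξ => by positivity) contDiff_id

theorem hasDerivAt_inv_sqrt {τ : ℝ} (hτ : 0 ≤ τ) :
    HasDerivAt (fun τ : ℝ => (√(1 + τ))⁻¹) (-(1 / 2) * (√(1 + τ))⁻¹ ^ 3) τ := by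
  have h0 : 0 < √(1 + τ) := Real.sqrt_pos.2 (by linarith)
  have h1 : HasDerivAt (fun τ : ℝ => 1 + τ) 1 τ := (hasDerivAt_id τ).const_add 1
  refine ((h1.sqrt (by linarith)).inv h0.ne').congr_deriv ?_
  field_simp

end Scale

/-! ### The virial perturbation and its derivatives. -/

section Virial

variable {N k : ℕ} {P : Params N} {U : Conf N k → ℝ≥0∞} {K C : ℝ} {x : Phase N k}

/-- The regularized square of the gradient. -/
def virialDenom (U : Conf N k → ℝ≥0∞) (C : ℝ) (q : Conf N k) (ξ : ℝ) : ℝ :=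
  ‖gradient (pot U) q‖ ^ 2 + C ^ 2 * (1 + ξ ^ 2)

theorem virialDenom_pos (hC : 0 < C) (q : Conf N k) (ξ : ℝ) : 0 < virialDenom U C q ξ := by
  unfold virialDenom; positivity

/-- The amplitude of the virial perturbation. -/
def virialCoeff (U : Conf N k → ℝ≥0∞) (K C : ℝ) (q : Conf N k) (ξ : ℝ) : ℝ :=
  K * nhScale ξ * Real.smoothTransition (pot U q - 1) / virialDenom U C q ξ

/-- The virial perturbation, a bounded regularization of `p · ∇U / |∇U|²`. -/
def virialFun (U : Conf N k → ℝ≥0∞) (K C : ℝ) (x : Phase N k) : ℝ :=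
  virialCoeff U K C x.1 x.2.2 *
    (inner ℝ x.2.1 (gradient (pot U) x.1) * (√(1 + ‖x.2.1‖ ^ 2))⁻¹)

theorem contDiffAt_virialFun (hU : IsNormal P U) (hC : 0 < C) (hx : x ∈ stateSpace U) :
    ContDiffAt ℝ 2 (virialFun U K C) x := by
  have h1 : ContDiffAt ℝ 2 (fun x : Phase N k => x.1) x := contDiffAt_fst
  have h2 : ContDiffAt ℝ 2 (fun x : Phase N k => x.2.1) x := contDiffAt_fst.comp x contDiffAt_snd
  have h3 : ContDiffAt ℝ 2 (fun x : Phase N k => x.2.2) x := contDiffAt_snd.comp x contDiffAt_snd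
  have hG : ContDiffAt ℝ 2 (fun x : Phase N k => gradient (pot U) x.1) x :=
    ((hU.contDiffAt_gradient hx).of_le (by norm_cast)).comp x h1
  have hp : ContDiffAt ℝ 2 (fun x : Phase N k => pot U x.1) x :=
    ((hU.contDiffAt_pot hx).of_le (by norm_cast)).comp x h1
  have hs : ContDiffAt ℝ 2 (fun x : Phase N k => nhScale x.2.2) x :=
    (contDiff_nhScale.of_le (by norm_cast)).contDiffAt.comp x h3
  have hT : ContDiffAt ℝ 2 (fun x : Phase N k => Real.smoothTransition (pot U x.1 - 1)) x :=
    (Real.smoothTransition.contDiffAt (n := 2)).comp x (hp.sub contDiffAt_const)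
  have hQ : ContDiffAt ℝ 2 (fun x : Phase N k => virialDenom U C x.1 x.2.2) x :=
    (hG.norm_sq ℝ).add (contDiffAt_const.mul (contDiffAt_const.add (h3.pow 2)))
  have hr : ContDiffAt ℝ 2 (fun x : Phase N k => √(1 + ‖x.2.1‖ ^ 2)) x :=
    (contDiffAt_const.add (h2.norm_sq ℝ)).sqrt (by positivity)
  exact (((contDiffAt_const.mul hs).mul hT).div hQ (virialDenom_pos hC _ _).ne').mul
    ((h2.inner ℝ hG).mul (hr.inv (Real.sqrt_pos.2 (by positivity)).ne'))

/-- The derivative of the amplitude in the direction `(v, ζ)`. -/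
def virialCoeffDeriv (U : Conf N k → ℝ≥0∞) (K C : ℝ) (q : Conf N k) (ξ : ℝ) (v : Conf N k)
    (ζ : ℝ) : ℝ :=
  ((K * (-(nhScale ξ / √(1 + ξ ^ 2)) * ζ) * Real.smoothTransition (pot U q - 1) +
      K * nhScale ξ * (deriv Real.smoothTransition (pot U q - 1) *
        inner ℝ (gradient (pot U) q) v)) * virialDenom U C q ξ -
    K * nhScale ξ * Real.smoothTransition (pot U q - 1) *
      (2 * inner ℝ (gradient (pot U) q) (fderiv ℝ (gradient (pot U)) q v) +
        C ^ 2 * (2 * ξ * ζ))) / virialDenom U C q ξ ^ 2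

theorem hasDerivAt_virialCoeff (hU : IsNormal P U) (hC : 0 < C) {q : Conf N k}
    (hq : q ∈ finiteSet U) (ξ : ℝ) (v : Conf N k) (ζ : ℝ) :
    HasDerivAt (fun t : ℝ => virialCoeff U K C (q + t • v) (ξ + t • ζ))
      (virialCoeffDeriv U K C q ξ v ζ) 0 := by
  have lξ := hasDerivAt_line ξ ζ 0
  have l1 : HasDerivAt (fun t : ℝ => nhScale (ξ + t • ζ)) (-(nhScale ξ / √(1 + ξ ^ 2)) * ζ) 0 := by
    have h : HasDerivAt nhScale (-(nhScale ξ / √(1 + ξ ^ 2))) (ξ + (0 : ℝ) • ζ) := by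
      simpa using hasDerivAt_nhScale ξ
    exact h.comp 0 lξ
  have l2 : HasDerivAt (fun t : ℝ => pot U (q + t • v)) (inner ℝ (gradient (pot U) q) v) 0 := by
    have h : HasFDerivAt (pot U) (fderiv ℝ (pot U) q) (q + (0 : ℝ) • v) := by
      simpa using ((hU.contDiffAt_pot hq).differentiableAt (by simp)).hasFDerivAt
    rw [← fderiv_pot_apply]
    exact h.comp_hasDerivAt 0 (hasDerivAt_line q v 0)
  have l3 : HasDerivAt (fun t : ℝ => Real.smoothTransition (pot U (q + t • v) - 1))
      (deriv Real.smoothTransition (pot U q - 1) * inner ℝ (gradient (pot U) q) v) 0 := by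
    have h : HasDerivAt Real.smoothTransition (deriv Real.smoothTransition (pot U q - 1))
        (pot U (q + (0 : ℝ) • v) - 1) := by
      simpa using (differentiable_smoothTransition (pot U q - 1)).hasDerivAt
    exact h.comp 0 (l2.sub_const 1)
  have l4 : HasDerivAt (fun t : ℝ => gradient (pot U) (q + t • v))
      (fderiv ℝ (gradient (pot U)) q v) 0 := by
    have h : HasFDerivAt (gradient (pot U)) (fderiv ℝ (gradient (pot U)) q)
        (q + (0 : ℝ) • v) := by
      simpa using hU.hasFDerivAt_gradient hq
    exact h.comp_hasDerivAt 0 (hasDerivAt_line q v 0)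
  have l5 : HasDerivAt (fun t : ℝ => virialDenom U C (q + t • v) (ξ + t • ζ))
      (2 * inner ℝ (gradient (pot U) q) (fderiv ℝ (gradient (pot U)) q v) +
        C ^ 2 * (2 * ξ * ζ)) 0 := by
    have := l4.norm_sq.add (((lξ.pow 2).const_add 1).const_mul (C ^ 2))
    simp only [zero_smul, add_zero] at this
    refine this.congr_deriv ?_
    norm_num
  have h := (((l1.const_mul K).mul l3).div l5 (virialDenom_pos hC _ _).ne')
  simp only [zero_smul, add_zero, Pi.mul_apply] at h
  exact h

theorem fderiv_virialFun_apply (hU : IsNormal P U) (hC : 0 < C) (hx : x ∈ stateSpace U)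
    (v : Phase N k) :
    fderiv ℝ (virialFun U K C) x v =
      virialCoeffDeriv U K C x.1 x.2.2 v.1 v.2.2 *
        (inner ℝ x.2.1 (gradient (pot U) x.1) * (√(1 + ‖x.2.1‖ ^ 2))⁻¹) +
      virialCoeff U K C x.1 x.2.2 *
        ((inner ℝ x.2.1 (fderiv ℝ (gradient (pot U)) x.1 v.1) +
          inner ℝ v.2.1 (gradient (pot U) x.1)) * (√(1 + ‖x.2.1‖ ^ 2))⁻¹ -
        inner ℝ x.2.1 (gradient (pot U) x.1) *
          ((√(1 + ‖x.2.1‖ ^ 2))⁻¹ ^ 3 * inner ℝ x.2.1 v.2.1)) := by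
  refine fderiv_apply_eq_of_line ((contDiffAt_virialFun hU hC hx).differentiableAt
    (by norm_num)) ?_
  have l4 : HasDerivAt (fun t : ℝ => gradient (pot U) (x.1 + t • v.1))
      (fderiv ℝ (gradient (pot U)) x.1 v.1) 0 := by
    have h : HasFDerivAt (gradient (pot U)) (fderiv ℝ (gradient (pot U)) x.1)
        (x.1 + (0 : ℝ) • v.1) := by
      simpa using hU.hasFDerivAt_gradient hx
    exact h.comp_hasDerivAt 0 (hasDerivAt_line x.1 v.1 0)
  have lp := hasDerivAt_line x.2.1 v.2.1 0
  have lr : HasDerivAt (fun t : ℝ => (√(1 + ‖x.2.1 + t • v.2.1‖ ^ 2))⁻¹)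
      (-(1 / 2) * (√(1 + ‖x.2.1‖ ^ 2))⁻¹ ^ 3 * (2 * inner ℝ x.2.1 v.2.1)) 0 := by
    have h1 := lp.norm_sq
    simp only [zero_smul, add_zero] at h1
    have h2 : HasDerivAt (fun τ : ℝ => (√(1 + τ))⁻¹) (-(1 / 2) * (√(1 + ‖x.2.1‖ ^ 2))⁻¹ ^ 3)
        (‖x.2.1 + (0 : ℝ) • v.2.1‖ ^ 2) := by
      simpa using hasDerivAt_inv_sqrt (sq_nonneg ‖x.2.1‖)
    exact HasDerivAt.comp (h₂ := fun τ : ℝ => (√(1 + τ))⁻¹) 0 h2 h1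
  have h := (hasDerivAt_virialCoeff (K := K) hU hC hx x.2.2 v.1 v.2.2).mul ((lp.inner ℝ l4).mul lr)
  simp only [zero_smul, add_zero, Pi.mul_apply] at h
  refine h.congr_deriv ?_
  ring

/-- The momentum gradient of `virialFun`. -/
def virialGrad (U : Conf N k → ℝ≥0∞) (K C : ℝ) (x : Phase N k) : Conf N k :=
  virialCoeff U K C x.1 x.2.2 • ((√(1 + ‖x.2.1‖ ^ 2))⁻¹ • gradient (pot U) x.1 -
    (inner ℝ x.2.1 (gradient (pot U) x.1) * (√(1 + ‖x.2.1‖ ^ 2))⁻¹ ^ 3) • x.2.1)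

theorem virialCoeffDeriv_zero (U : Conf N k → ℝ≥0∞) (K C : ℝ) (q : Conf N k) (ξ : ℝ) :
    virialCoeffDeriv U K C q ξ 0 0 = 0 := by
  simp [virialCoeffDeriv]

theorem fderiv_virialFun_momentumDir (hU : IsNormal P U) (hC : 0 < C) (hx : x ∈ stateSpace U)
    (j : Fin N × Fin k) :
    fderiv ℝ (virialFun U K C) x (momentumDir j) = virialGrad U K C x j := by
  rw [fderiv_virialFun_apply hU hC hx]
  simp only [momentumDir, map_zero, inner_zero_right, virialCoeffDeriv_zero,
    EuclideanSpace.inner_single_right, EuclideanSpace.inner_single_left, conj_trivial, virialGrad,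
    PiLp.smul_apply, PiLp.sub_apply, smul_eq_mul, map_one]
  ring

theorem momentumLaplacian_virialFun (hU : IsNormal P U) (hC : 0 < C) (hx : x ∈ stateSpace U) :
    momentumLaplacian (virialFun U K C) x =
      virialCoeff U K C x.1 x.2.2 * (inner ℝ x.2.1 (gradient (pot U) x.1) *
        (3 * (√(1 + ‖x.2.1‖ ^ 2))⁻¹ ^ 5 * ‖x.2.1‖ ^ 2 -
          (k * N + 2) * (√(1 + ‖x.2.1‖ ^ 2))⁻¹ ^ 3)) := by
  set p := x.2.1 with hp
  set G := gradient (pot U) x.1 with hG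
  set a := virialCoeff U K C x.1 x.2.2 with ha
  set h := (√(1 + ‖p‖ ^ 2))⁻¹ with hh
  have key : ∀ j : Fin N × Fin k,
      fderiv ℝ (fun y => fderiv ℝ (virialFun U K C) y (momentumDir j)) x (momentumDir j) =
      a * (-(2 * h ^ 3) * (p j * G j) +
        inner ℝ p G * (3 * h ^ 5 * (p j) ^ 2 - h ^ 3)) := by
    intro j
    set e : Conf N k := EuclideanSpace.single j 1 with he
    have l1 : ∀ t : ℝ, HasDerivAt (fun t : ℝ => (√(1 + ‖p + t • e‖ ^ 2))⁻¹)
        (-(1 / 2) * (√(1 + ‖p + t • e‖ ^ 2))⁻¹ ^ 3 * (2 * inner ℝ (p + t • e) e)) t := fun t =>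
      HasDerivAt.comp (h₂ := fun τ : ℝ => (√(1 + τ))⁻¹) t
        (hasDerivAt_inv_sqrt (sq_nonneg ‖p + t • e‖)) (hasDerivAt_line p e t).norm_sq
    have l2 : ∀ (t : ℝ) (y : Conf N k), HasDerivAt (fun t : ℝ => inner ℝ (p + t • e) y)
        (inner ℝ e y) t := fun t y => by
      simpa using (hasDerivAt_line p e t).inner ℝ (hasDerivAt_const t y)
    refine fderiv_fderiv_eq_of_line (g := fun t => a * (inner ℝ e G * (√(1 + ‖p + t • e‖ ^ 2))⁻¹ +
      inner ℝ (p + t • e) G * (-(1 / 2) * (√(1 + ‖p + t • e‖ ^ 2))⁻¹ ^ 3 *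
        (2 * inner ℝ (p + t • e) e)))) (contDiffAt_virialFun hU hC hx) (fun t => ?_) ?_
    · have h1 := ((l2 t G).mul (l1 t)).const_mul a
      refine h1.congr_of_eventuallyEq (Eventually.of_forall fun t => ?_)
      simp only [virialFun, momentumDir, Prod.fst_add, Prod.snd_add,
        Prod.smul_fst, Prod.smul_snd, smul_zero, add_zero]
      rfl
    · have h5 : inner ℝ p e = p j := by simp [he, EuclideanSpace.inner_single_right]
      have h6 : inner ℝ e e = (1 : ℝ) := by simp [he]
      have h7 : inner ℝ e G = G j := by simp [he, EuclideanSpace.inner_single_left]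
      have h3 := ((l1 0).const_mul (inner ℝ e G)).add ((l2 0 G).mul
        ((((l1 0).pow 3).const_mul (-(1 / 2) : ℝ)).mul ((l2 0 e).const_mul 2)))
      refine (h3.const_mul a).congr_deriv ?_
      simp only [zero_smul, add_zero, h5, h6, h7, ← hh, Pi.mul_apply, Pi.pow_apply]
      push_cast
      ring
  unfold momentumLaplacian
  rw [Finset.sum_congr rfl fun j _ => key j, ← Finset.mul_sum, Finset.sum_add_distrib,
    ← Finset.mul_sum, ← Finset.mul_sum, Finset.sum_sub_distrib, ← Finset.mul_sum,
    ← EuclideanSpace.real_norm_sq_eq]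
  have h8 : ∑ j, p j * G j = inner ℝ p G := by
    rw [PiLp.inner_apply]
    exact Finset.sum_congr rfl fun j _ => by simp; ring
  rw [h8]
  simp only [Finset.sum_const, Finset.card_univ, Fintype.card_prod, Fintype.card_fin, nsmul_eq_mul]
  push_cast
  ring

end Virial

/-! ### Size of the virial perturbation and of the terms of its generator. -/

section VirialEstimate

variable {N k : ℕ} {P : Params N} {U : Conf N k → ℝ≥0∞} {K C : ℝ} {x : Phase N k}

theorem inv_sqrt_one_add_sq_pos (r : ℝ) : 0 < (√(1 + r ^ 2))⁻¹ :=
  inv_pos.2 (Real.sqrt_pos.2 (by positivity))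

theorem inv_sqrt_one_add_sq_le_one (r : ℝ) : (√(1 + r ^ 2))⁻¹ ≤ 1 :=
  inv_le_one_of_one_le₀ (one_le_sqrt_one_add_sq r)

theorem inv_sqrt_one_add_sq_sq (r : ℝ) : (√(1 + r ^ 2))⁻¹ ^ 2 * (1 + r ^ 2) = 1 := by
  rw [inv_pow, Real.sq_sqrt (by positivity)]
  exact inv_mul_cancel₀ (by positivity)

theorem mul_inv_sqrt_one_add_sq_le_one (r : ℝ) : r * (√(1 + r ^ 2))⁻¹ ≤ 1 := by
  rw [← div_eq_mul_inv, div_le_one (by positivity)]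
  exact (le_abs_self r).trans (abs_le_sqrt_one_add_sq r)

/-- The amplitude of the virial perturbation without its cutoff. -/
def virialRatio (U : Conf N k → ℝ≥0∞) (K C : ℝ) (q : Conf N k) (ξ : ℝ) : ℝ :=
  K * nhScale ξ / virialDenom U C q ξ

theorem virialRatio_nonneg (hK : 0 ≤ K) (hC : 0 < C) (q : Conf N k) (ξ : ℝ) :
    0 ≤ virialRatio U K C q ξ :=
  div_nonneg (mul_nonneg hK (nhScale_pos ξ).le) (virialDenom_pos hC q ξ).le

theorem virialRatio_mul_denom (hC : 0 < C) (q : Conf N k) (ξ : ℝ) :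
    virialRatio U K C q ξ * virialDenom U C q ξ = K * nhScale ξ :=
  div_mul_cancel₀ _ (virialDenom_pos hC q ξ).ne'

theorem virialDenom_eq (U : Conf N k → ℝ≥0∞) (C : ℝ) (q : Conf N k) (ξ : ℝ) :
    virialDenom U C q ξ = ‖gradient (pot U) q‖ ^ 2 + C ^ 2 * √(1 + ξ ^ 2) ^ 2 := by
  rw [virialDenom, Real.sq_sqrt (by positivity)]

/-- AM–GM in the denominator: `|∇U|² + C²(1 + ξ²) ≥ 2C|∇U|√(1 + ξ²)`. This absorbs the thermostat
force `-ξp`, at the price of a factor `1/C`. -/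
theorem virialRatio_mul_norm_mul_sqrt_le (hK : 0 ≤ K) (hC : 0 < C) (q : Conf N k) (ξ : ℝ) :
    virialRatio U K C q ξ * ‖gradient (pot U) q‖ * √(1 + ξ ^ 2) ≤ K * nhScale ξ / (2 * C) := by
  rw [le_div_iff₀ (by positivity), ← virialRatio_mul_denom (U := U) hC q ξ, virialDenom_eq]
  have := virialRatio_nonneg (U := U) hK hC q ξ
  have h := sq_nonneg (‖gradient (pot U) q‖ - C * √(1 + ξ ^ 2))
  nlinarith [mul_nonneg this h]

theorem virialRatio_mul_norm_le (hK : 0 ≤ K) (hC : 0 < C) (q : Conf N k) (ξ : ℝ) :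
    virialRatio U K C q ξ * ‖gradient (pot U) q‖ ≤ K / C := by
  have h1 := virialRatio_mul_norm_mul_sqrt_le (U := U) hK hC q ξ
  have h0 : 0 < √(1 + ξ ^ 2) := by linarith [one_le_sqrt_one_add_sq ξ]
  have h2 : K * nhScale ξ / (2 * C) ≤ K / C * √(1 + ξ ^ 2) := by
    rw [div_le_iff₀ (by positivity)]
    have : K / C * √(1 + ξ ^ 2) * (2 * C) = K * (2 * √(1 + ξ ^ 2)) := by field_simp
    rw [this]
    exact mul_le_mul_of_nonneg_left (nhScale_le ξ) hK
  exact le_of_mul_le_mul_right (h1.trans h2) h0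

theorem virialRatio_le (hK : 0 ≤ K) (hC : 1 ≤ C) (q : Conf N k) (ξ : ℝ) :
    virialRatio U K C q ξ ≤ K * nhScale ξ / C := by
  have := nhScale_pos ξ
  refine div_le_div_of_nonneg_left (by positivity) (by linarith) ?_
  unfold virialDenom
  nlinarith [sq_nonneg ‖gradient (pot U) q‖, sq_nonneg (C * ξ)]

theorem virialCoeff_eq (U : Conf N k → ℝ≥0∞) (K C : ℝ) (q : Conf N k) (ξ : ℝ) :
    virialCoeff U K C q ξ =
      virialRatio U K C q ξ * Real.smoothTransition (pot U q - 1) := by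
  unfold virialCoeff virialRatio; ring

theorem virialCoeff_nonneg (hK : 0 ≤ K) (hC : 0 < C) (q : Conf N k) (ξ : ℝ) :
    0 ≤ virialCoeff U K C q ξ := by
  rw [virialCoeff_eq]
  exact mul_nonneg (virialRatio_nonneg hK hC q ξ) (Real.smoothTransition.nonneg _)

theorem virialCoeff_le (hK : 0 ≤ K) (hC : 0 < C) (q : Conf N k) (ξ : ℝ) :
    virialCoeff U K C q ξ ≤ virialRatio U K C q ξ := by
  rw [virialCoeff_eq]
  exact mul_le_of_le_one_right (virialRatio_nonneg hK hC q ξ) (Real.smoothTransition.le_one _)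

theorem virialCoeff_mul_norm_le (hK : 0 ≤ K) (hC : 0 < C) (q : Conf N k) (ξ : ℝ) :
    virialCoeff U K C q ξ * ‖gradient (pot U) q‖ ≤ K / C :=
  (mul_le_mul_of_nonneg_right (virialCoeff_le hK hC q ξ) (norm_nonneg _)).trans
    (virialRatio_mul_norm_le hK hC q ξ)

/-- The function is bounded by `K/C`; because the cutoff kills it where `U < 1`, the bound may be
multiplied by `U`. -/
theorem abs_virialFun_le (hK : 0 ≤ K) (hC : 0 < C) (x : Phase N k) :
    |virialFun U K C x| ≤ K / C * pot U x.1 := by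
  have hKC : 0 ≤ K / C := by positivity
  rcases lt_or_ge (pot U x.1) 1 with h | h
  · have : virialFun U K C x = 0 := by
      rw [virialFun, virialCoeff_eq, Real.smoothTransition.zero_of_nonpos (by linarith)]
      simp
    rw [this, abs_zero]
    exact mul_nonneg hKC (pot_nonneg U x.1)
  · refine le_trans ?_ (le_mul_of_one_le_right hKC h)
    have h0 := virialCoeff_nonneg (U := U) hK hC x.1 x.2.2
    have h1 := virialCoeff_mul_norm_le (U := U) hK hC x.1 x.2.2
    have h2 := mul_inv_sqrt_one_add_sq_le_one ‖x.2.1‖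
    have h3 := abs_real_inner_le_norm x.2.1 (gradient (pot U) x.1)
    have h4 := inv_sqrt_one_add_sq_pos ‖x.2.1‖
    rw [virialFun, abs_mul, abs_mul, abs_of_nonneg h0, abs_of_pos h4]
    calc _ ≤ virialCoeff U K C x.1 x.2.2 *
          (‖x.2.1‖ * ‖gradient (pot U) x.1‖ * (√(1 + ‖x.2.1‖ ^ 2))⁻¹) := by gcongr
      _ = virialCoeff U K C x.1 x.2.2 * ‖gradient (pot U) x.1‖ *
          (‖x.2.1‖ * (√(1 + ‖x.2.1‖ ^ 2))⁻¹) := by ring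
      _ ≤ K / C * 1 := by gcongr
      _ = K / C := mul_one _

theorem norm_virialGrad_le (hK : 0 ≤ K) (hC : 0 < C) (x : Phase N k) :
    ‖virialGrad U K C x‖ ≤ 2 * (K / C) := by
  have h0 := virialCoeff_nonneg (U := U) hK hC x.1 x.2.2
  have h1 := virialCoeff_mul_norm_le (U := U) hK hC x.1 x.2.2
  have h3 := abs_real_inner_le_norm x.2.1 (gradient (pot U) x.1)
  have h4 := inv_sqrt_one_add_sq_pos ‖x.2.1‖
  have h5 := inv_sqrt_one_add_sq_le_one ‖x.2.1‖
  have h6 := inv_sqrt_one_add_sq_sq ‖x.2.1‖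
  set h := (√(1 + ‖x.2.1‖ ^ 2))⁻¹
  set G := gradient (pot U) x.1
  rw [virialGrad, norm_smul, Real.norm_of_nonneg h0]
  have h7 : ‖h • G - (inner ℝ x.2.1 G * h ^ 3) • x.2.1‖ ≤ 2 * ‖G‖ := by
    refine (norm_sub_le _ _).trans ?_
    rw [norm_smul, norm_smul, norm_mul, Real.norm_of_nonneg h4.le,
      Real.norm_of_nonneg (by positivity : 0 ≤ h ^ 3), Real.norm_eq_abs]
    have h8 : h * ‖G‖ ≤ ‖G‖ := mul_le_of_le_one_left (norm_nonneg _) h5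
    have h9 : h ^ 2 * ‖x.2.1‖ ^ 2 ≤ 1 := by nlinarith [sq_nonneg h]
    have h10 : |inner ℝ x.2.1 G| * h ^ 3 * ‖x.2.1‖ ≤ ‖G‖ := by
      calc _ ≤ ‖x.2.1‖ * ‖G‖ * h ^ 3 * ‖x.2.1‖ := by gcongr
        _ = ‖G‖ * (h ^ 2 * ‖x.2.1‖ ^ 2) * h := by ring
        _ ≤ ‖G‖ * 1 * 1 := by gcongr
        _ = ‖G‖ := by ring
    linarith
  calc _ ≤ virialCoeff U K C x.1 x.2.2 * (2 * ‖G‖) := by gcongr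
    _ = 2 * (virialCoeff U K C x.1 x.2.2 * ‖G‖) := by ring
    _ ≤ 2 * (K / C) := by gcongr

/-- Four sources: the scale in `ξ`, the cutoff in `U`, the Hessian, and the `ξ`-part of the
denominator. The cutoff varies only where `U ≤ 2`, where the gradient is at most `ρ`. The factor
`|∇U|` is the size of `p·∇U/√(1 + |p|²)`. -/
theorem abs_virialCoeffDeriv_mul_le (hK : 0 ≤ K) (hC : 0 < C) {B ρ : ℝ}
    (hB : ∀ y, |deriv Real.smoothTransition y| ≤ B) {q : Conf N k}
    (hρ : pot U q ≤ 2 → ‖gradient (pot U) q‖ ≤ ρ) (ξ : ℝ) (v : Conf N k) (ζ : ℝ) :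
    |virialCoeffDeriv U K C q ξ v ζ| * ‖gradient (pot U) q‖ ≤
      3 * (K / C) * |ζ| + virialRatio U K C q ξ * ‖v‖ *
        (B * ρ ^ 2 + 2 * ‖fderiv ℝ (gradient (pot U)) q‖) := by
  have hR := virialRatio_nonneg (U := U) hK hC q ξ
  have hRG := virialRatio_mul_norm_le (U := U) hK hC q ξ
  have hQ := virialDenom_pos (U := U) hC q ξ
  have hQe := virialDenom_eq U C q ξ
  have ht := one_le_sqrt_one_add_sq ξ
  have hξ := abs_le_sqrt_one_add_sq ξ
  set G := gradient (pot U) q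
  set R := virialRatio U K C q ξ with hRd
  set Q := virialDenom U C q ξ with hQd
  set t := √(1 + ξ ^ 2)
  set b := Real.smoothTransition (pot U q - 1)
  set T := deriv Real.smoothTransition (pot U q - 1)
  set J := fderiv ℝ (gradient (pot U)) q
  have hb0 : 0 ≤ b := Real.smoothTransition.nonneg _
  have hb1 : b ≤ 1 := Real.smoothTransition.le_one _
  have e : virialCoeffDeriv U K C q ξ v ζ =
      -(R * b * ζ / t) + R * (T * inner ℝ G v) - R * b * (2 * inner ℝ G (J v)) / Q
        - R * b * (2 * (C ^ 2 * ξ * ζ)) / Q := by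
    rw [hRd, virialRatio, ← hQd, virialCoeffDeriv, ← hQd]
    have : t ≠ 0 := by positivity
    field_simp
    ring
  have hg := norm_nonneg G
  have hinv : ∀ y z : ℝ, |R * b * y / z| = R * b * |y| / |z| := fun y z => by
    rw [abs_div, abs_mul, abs_of_nonneg (mul_nonneg hR hb0)]
  have hRb : R * b ≤ R := mul_le_of_le_one_right hR hb1
  have hRb0 : 0 ≤ R * b := mul_nonneg hR hb0
  have b1 : |R * b * ζ / t| * ‖G‖ ≤ K / C * |ζ| := by
    have h1 : R * b * |ζ| / t ≤ R * |ζ| :=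
      (div_le_self (by positivity) ht).trans (by gcongr)
    rw [hinv, abs_of_pos (by linarith : 0 < t)]
    calc _ ≤ R * |ζ| * ‖G‖ := by gcongr
      _ = R * ‖G‖ * |ζ| := by ring
      _ ≤ K / C * |ζ| := by gcongr
  have b2 : |R * (T * inner ℝ G v)| * ‖G‖ ≤ R * ‖v‖ * (B * ρ ^ 2) := by
    rw [abs_mul, abs_mul, abs_of_nonneg hR]
    rcases le_or_gt (pot U q) 2 with h | h
    · have h1 := hρ h
      have h2 := abs_real_inner_le_norm G v
      have h3 := hB (pot U q - 1)
      have hB0 : 0 ≤ B := (abs_nonneg _).trans h3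
      calc _ ≤ R * (B * (‖G‖ * ‖v‖)) * ‖G‖ := by gcongr
        _ = R * ‖v‖ * (B * ‖G‖ ^ 2) := by ring
        _ ≤ R * ‖v‖ * (B * ρ ^ 2) := by gcongr
    · have h1 : T = 0 := deriv_smoothTransition_of_one_lt (by linarith)
      have hB0 : 0 ≤ B := (abs_nonneg _).trans (hB 0)
      rw [h1]
      simp only [abs_zero, zero_mul, mul_zero]
      positivity
  have b3 : |R * b * (2 * inner ℝ G (J v)) / Q| * ‖G‖ ≤ R * ‖v‖ * (2 * ‖J‖) := by
    have h2 : |inner ℝ G (J v)| ≤ ‖G‖ * (‖J‖ * ‖v‖) :=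
      (abs_real_inner_le_norm _ _).trans (by gcongr; exact J.le_opNorm v)
    have h3 : ‖G‖ ^ 2 ≤ Q := by rw [hQe]; nlinarith [sq_nonneg (C * t)]
    rw [hinv, abs_of_pos hQ, abs_mul, abs_of_pos (two_pos : (0 : ℝ) < 2), div_mul_eq_mul_div,
      div_le_iff₀ hQ]
    calc _ ≤ R * (2 * (‖G‖ * (‖J‖ * ‖v‖))) * ‖G‖ := by gcongr
      _ = R * ‖v‖ * (2 * ‖J‖) * ‖G‖ ^ 2 := by ring
      _ ≤ R * ‖v‖ * (2 * ‖J‖) * Q := by gcongr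
  have b4 : |R * b * (2 * (C ^ 2 * ξ * ζ)) / Q| * ‖G‖ ≤ 2 * (K / C) * |ζ| := by
    have h3 : C ^ 2 * |ξ| ≤ Q := by
      have h4 : |ξ| ≤ t ^ 2 := hξ.trans (by nlinarith)
      have h5 : C ^ 2 * |ξ| ≤ C ^ 2 * t ^ 2 := by gcongr
      rw [hQe]; nlinarith [sq_nonneg ‖G‖]
    rw [hinv, abs_of_pos hQ, abs_mul, abs_mul, abs_mul, abs_of_pos (two_pos : (0 : ℝ) < 2),
      abs_of_nonneg (sq_nonneg C), div_mul_eq_mul_div, div_le_iff₀ hQ]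
    calc _ ≤ R * (2 * (C ^ 2 * |ξ| * |ζ|)) * ‖G‖ := by gcongr
      _ = R * ‖G‖ * (2 * |ζ|) * (C ^ 2 * |ξ|) := by ring
      _ ≤ K / C * (2 * |ζ|) * Q := by gcongr
      _ = 2 * (K / C) * |ζ| * Q := by ring
  have habs : |virialCoeffDeriv U K C q ξ v ζ| ≤ |R * b * ζ / t| + |R * (T * inner ℝ G v)| +
      |R * b * (2 * inner ℝ G (J v)) / Q| + |R * b * (2 * (C ^ 2 * ξ * ζ)) / Q| := by
    rw [e]
    refine (abs_sub _ _).trans (add_le_add_left ?_ _)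
    refine (abs_sub _ _).trans (add_le_add_left ?_ _)
    exact (abs_add_le _ _).trans_eq (by rw [abs_neg])
  have := mul_le_mul_of_nonneg_right habs hg
  nlinarith

/-- The transport of `virialFun` by a momentum drift `w - ∇U`. -/
theorem virial_transport_le {G w p : Conf N k} {h a : ℝ} (ha : 0 ≤ a) (h0 : 0 < h)
    (hp : h ^ 2 * (1 + ‖p‖ ^ 2) = 1) :
    a * (inner ℝ (w - G) G * h - inner ℝ p G * (h ^ 3 * inner ℝ p (w - G))) ≤
      -(a * ‖G‖ ^ 2 * h ^ 3) + 2 * (a * ‖G‖ * (‖w‖ * h)) := by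
  have i1 : inner ℝ (w - G) G = inner ℝ w G - ‖G‖ ^ 2 := by
    rw [inner_sub_left, real_inner_self_eq_norm_sq]
  have i2 : inner ℝ p (w - G) = inner ℝ p w - inner ℝ p G := inner_sub_right _ _ _
  have j1 : inner ℝ w G ≤ ‖w‖ * ‖G‖ := real_inner_le_norm _ _
  have j2 : |inner ℝ p G| ≤ ‖p‖ * ‖G‖ := abs_real_inner_le_norm _ _
  have j3 : |inner ℝ p w| ≤ ‖p‖ * ‖w‖ := abs_real_inner_le_norm _ _
  have j4 : -(inner ℝ p G * inner ℝ p w) ≤ ‖p‖ ^ 2 * (‖G‖ * ‖w‖) := by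
    refine (neg_le_abs _).trans ?_
    rw [abs_mul]
    calc _ ≤ ‖p‖ * ‖G‖ * (‖p‖ * ‖w‖) := by gcongr
      _ = _ := by ring
  have j5 : inner ℝ p G ^ 2 ≤ ‖p‖ ^ 2 * ‖G‖ ^ 2 := by
    rw [← sq_abs, ← mul_pow]; gcongr
  -- The regularization costs at most `h³(p·G)² ≤ (h - h³)|G|²`, so out of the gain `-h|G|²` the
  -- part `-h³|G|²` remains.
  have j6 : h ^ 3 * ‖p‖ ^ 2 = h - h ^ 3 := by linear_combination h * hp
  have j7 : h ^ 3 * ‖p‖ ^ 2 ≤ h := by rw [j6]; linarith [pow_pos h0 3]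
  rw [i1, i2]
  have k1 : h ^ 3 * inner ℝ p G ^ 2 ≤ (h - h ^ 3) * ‖G‖ ^ 2 := by
    rw [← j6, mul_assoc]; gcongr
  have k2 : h ^ 3 * -(inner ℝ p G * inner ℝ p w) ≤ h * (‖G‖ * ‖w‖) := by
    calc _ ≤ h ^ 3 * (‖p‖ ^ 2 * (‖G‖ * ‖w‖)) := by gcongr
      _ = h ^ 3 * ‖p‖ ^ 2 * (‖G‖ * ‖w‖) := by ring
      _ ≤ _ := by gcongr
  have k3 : h * inner ℝ w G ≤ h * (‖w‖ * ‖G‖) := by gcongr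
  calc _ ≤ a * (-(‖G‖ ^ 2 * h ^ 3) + 2 * (‖G‖ * (‖w‖ * h))) := by
        refine mul_le_mul_of_nonneg_left ?_ ha
        linarith
    _ = _ := by ring

theorem virial_laplacian_le {G p : Conf N k} {h a d : ℝ} (ha : 0 ≤ a) (hd : 0 ≤ d) (h0 : 0 < h)
    (h1 : h ≤ 1) (hp : h ^ 2 * (1 + ‖p‖ ^ 2) = 1) (hp' : ‖p‖ * h ≤ 1) :
    a * (inner ℝ p G * (3 * h ^ 5 * ‖p‖ ^ 2 - (d + 2) * h ^ 3)) ≤ a * ‖G‖ * (d + 5) := by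
  have j2 : |inner ℝ p G| ≤ ‖p‖ * ‖G‖ := abs_real_inner_le_norm _ _
  have j3 : |3 * h ^ 5 * ‖p‖ ^ 2 - (d + 2) * h ^ 3| ≤ (d + 5) * h := by
    have e1 : 0 ≤ h ^ 5 * ‖p‖ ^ 2 := by positivity
    have e3 : 0 < h ^ 3 := pow_pos h0 3
    have e2 : h ^ 3 ≤ h := by nlinarith [mul_le_one₀ h1 h0.le h1]
    have e4 : h ^ 5 * ‖p‖ ^ 2 ≤ h := by
      have : h ^ 5 * ‖p‖ ^ 2 = h ^ 3 - h ^ 5 := by linear_combination h ^ 3 * hp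
      have : 0 < h ^ 5 := pow_pos h0 5
      linarith
    rw [abs_le]
    constructor <;> nlinarith
  calc _ ≤ a * (‖p‖ * ‖G‖ * ((d + 5) * h)) := by
        refine mul_le_mul_of_nonneg_left ((le_abs_self _).trans ?_) ha
        rw [abs_mul]; gcongr
    _ = a * ‖G‖ * (d + 5) * (‖p‖ * h) := by ring
    _ ≤ a * ‖G‖ * (d + 5) * 1 := by gcongr
    _ = _ := mul_one _

end VirialEstimate

/-! ### The generator on the virial perturbation. -/

section VirialBound

variable {N k : ℕ} {P : Params N} {U : Conf N k → ℝ≥0∞} {K C : ℝ} {x : Phase N k}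

theorem weight_bounds {s : ℝ} (hs : 0 ≤ s) (r : ℝ) :
    r * s ≤ (1 + s) * (1 + r ^ 2) ∧ s ≤ (1 + s) * (1 + r ^ 2) ∧ 1 ≤ (1 + s) * (1 + r ^ 2) ∧
      1 + r ^ 2 ≤ (1 + s) * (1 + r ^ 2) := by
  have h1 : 0 ≤ s * r ^ 2 := by positivity
  have h2 : 0 ≤ s * (r - 1) ^ 2 := by positivity
  have h3 := sq_nonneg r
  refine ⟨?_, ?_, ?_, ?_⟩ <;> nlinarith

-- The force `-∇U` gives the negative term. Of the errors, all carry the small factor `K/C` except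
-- the Hessian part proportional to `|∇U|²`: there the denominator only yields the amplitude `K`,
-- and smallness comes from `η`.
set_option maxHeartbeats 800000 in
theorem generator_virialFun_le (hU : IsNormal P U) (hK : 0 ≤ K) (hC : 1 ≤ C) {B ρ η C₁ : ℝ}
    (hB : ∀ y, |deriv Real.smoothTransition y| ≤ B)
    (hρ : ∀ q ∈ finiteSet U, pot U q ≤ 2 → ‖gradient (pot U) q‖ ≤ ρ) (hη : 0 ≤ η) (hC₁ : 0 ≤ C₁)
    (hJ : ∀ q ∈ finiteSet U,
      ‖fderiv ℝ (gradient (pot U)) q‖ ≤ η * ‖gradient (pot U) q‖ ^ 2 + C₁)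
    (hx : x ∈ stateSpace U) :
    generator P U (virialFun U K C) x ≤
      -(virialCoeff U K C x.1 x.2.2 * ‖gradient (pot U) x.1‖ ^ 2 * (√(1 + ‖x.2.1‖ ^ 2))⁻¹ ^ 3) +
      (K / C * (1 + P.γ * ‖massInv (k := k) P‖ + P.σ * (k * N + 5) +
          3 * ((‖massInv (k := k) P‖ + P.kB * P.T * (k * N)) / P.a) +
          ‖massInv (k := k) P‖ * (B * ρ ^ 2 + 3 * C₁)) +
        3 * (K * ‖massInv (k := k) P‖ * η)) * ((1 + nhScale x.2.2) * (1 + ‖x.2.1‖ ^ 2)) := by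
  have hC0 : 0 < C := by linarith
  rw [generator_eq (contDiffAt_virialFun hU hC0 hx), fderiv_virialFun_apply hU hC0 hx,
    momentumLaplacian_virialFun hU hC0 hx]
  have hv1 : (drift P U x).1 = massInv P x.2.1 := by rw [drift_eq]
  have hv2 : (drift P U x).2.1 = (-x.2.2 • x.2.1 - P.γ • massInv P x.2.1) -
      gradient (pot U) x.1 := by rw [drift_eq]
  have hζ := abs_drift_snd_snd_le (U := U) P x
  rw [hv1, hv2]
  set ζ := (drift P U x).2.2
  set κ := (‖massInv (k := k) P‖ + P.kB * P.T * (k * N)) / P.a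
  have hγ := P.γ_pos
  have hσ := P.σ_pos
  have hs := nhScale_pos x.2.2
  have ht := one_le_sqrt_one_add_sq x.2.2
  have hξ := abs_le_sqrt_one_add_sq x.2.2
  have ha0 := virialCoeff_nonneg (U := U) hK hC0 x.1 x.2.2
  have haR := virialCoeff_le (U := U) hK hC0 x.1 x.2.2
  have haG := virialCoeff_mul_norm_le (U := U) hK hC0 x.1 x.2.2
  have hR := virialRatio_nonneg (U := U) hK hC0 x.1 x.2.2
  have hRGt := virialRatio_mul_norm_mul_sqrt_le (U := U) hK hC0 x.1 x.2.2
  have hRs := virialRatio_le (U := U) hK hC x.1 x.2.2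
  have hRQ := virialRatio_mul_denom (U := U) (K := K) hC0 x.1 x.2.2
  have hD := abs_virialCoeffDeriv_mul_le hK hC0 hB (hρ x.1 hx) x.2.2 (massInv P x.2.1) ζ
  have hJx := hJ x.1 hx
  have h0 := inv_sqrt_one_add_sq_pos ‖x.2.1‖
  have h1 := inv_sqrt_one_add_sq_le_one ‖x.2.1‖
  have h2 := inv_sqrt_one_add_sq_sq ‖x.2.1‖
  have h3 := mul_inv_sqrt_one_add_sq_le_one ‖x.2.1‖
  have hAp : ‖massInv P x.2.1‖ ≤ ‖massInv (k := k) P‖ * ‖x.2.1‖ := (massInv P).le_opNorm _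
  set s := nhScale x.2.2
  set t := √(1 + x.2.2 ^ 2)
  set h := (√(1 + ‖x.2.1‖ ^ 2))⁻¹
  set G := gradient (pot U) x.1
  set J := fderiv ℝ (gradient (pot U)) x.1
  set R := virialRatio U K C x.1 x.2.2
  set a := virialCoeff U K C x.1 x.2.2
  set a' := virialCoeffDeriv U K C x.1 x.2.2 (massInv P x.2.1) ζ
  set μ := ‖massInv (k := k) P‖
  set p := x.2.1
  have hμ : 0 ≤ μ := norm_nonneg _
  have hpn := norm_nonneg p
  have hGn := norm_nonneg G
  have hKC : 0 ≤ K / C := by positivity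
  have T1 : a' * (inner ℝ p G * h) ≤
      3 * (K / C) * |ζ| + R * ‖massInv P p‖ * (B * ρ ^ 2 + 2 * ‖J‖) := by
    refine le_trans ?_ hD
    refine (le_abs_self _).trans ?_
    rw [abs_mul, abs_mul, abs_of_pos h0]
    refine mul_le_mul_of_nonneg_left ?_ (abs_nonneg _)
    calc _ ≤ ‖p‖ * ‖G‖ * h := by gcongr; exact abs_real_inner_le_norm _ _
      _ = ‖G‖ * (‖p‖ * h) := by ring
      _ ≤ ‖G‖ := mul_le_of_le_one_right hGn h3
  have T2 : a * (inner ℝ p (J (massInv P p)) * h) ≤ R * ‖massInv P p‖ * ‖J‖ := by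
    calc _ ≤ a * (‖p‖ * (‖J‖ * ‖massInv P p‖) * h) := by
          gcongr
          exact (real_inner_le_norm _ _).trans (by gcongr; exact J.le_opNorm _)
      _ = a * (‖massInv P p‖ * ‖J‖) * (‖p‖ * h) := by ring
      _ ≤ R * (‖massInv P p‖ * ‖J‖) * 1 := by gcongr
      _ = _ := by ring
  have T3 := virial_transport_le (w := -x.2.2 • p - P.γ • massInv P p) (G := G) ha0 h0 h2
  have T3' : 2 * (a * ‖G‖ * (‖-x.2.2 • p - P.γ • massInv P p‖ * h)) ≤
      K / C * s * (1 + P.γ * μ) := by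
    have w1 : ‖-x.2.2 • p - P.γ • massInv P p‖ ≤ (|x.2.2| + P.γ * μ) * ‖p‖ := by
      refine (norm_sub_le _ _).trans ?_
      rw [norm_smul, norm_smul, norm_neg, Real.norm_eq_abs, Real.norm_of_nonneg hγ.le]
      nlinarith
    have w2 : ‖-x.2.2 • p - P.γ • massInv P p‖ * h ≤ t * (1 + P.γ * μ) := by
      calc _ ≤ (|x.2.2| + P.γ * μ) * ‖p‖ * h := by gcongr
        _ = (|x.2.2| + P.γ * μ) * (‖p‖ * h) := by ring
        _ ≤ (|x.2.2| + P.γ * μ) * 1 := by gcongr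
        _ ≤ t * (1 + P.γ * μ) := by nlinarith [mul_nonneg hγ.le hμ]
    calc _ ≤ 2 * (R * ‖G‖ * (t * (1 + P.γ * μ))) := by gcongr
      _ = 2 * (R * ‖G‖ * t) * (1 + P.γ * μ) := by ring
      _ ≤ 2 * (K * s / (2 * C)) * (1 + P.γ * μ) := by gcongr
      _ = _ := by field_simp
  have T4 := virial_laplacian_le (G := G) (d := k * N) ha0 (by positivity) h0 h1 h2 h3
  have T4' : a * ‖G‖ * (k * N + 5) ≤ K / C * (k * N + 5) := by gcongr
  have T4'' := mul_le_mul_of_nonneg_left (T4.trans T4') hσ.le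
  have T5 : 3 * (K / C) * |ζ| ≤ 3 * (K / C) * (κ * (1 + ‖p‖ ^ 2)) := by gcongr
  have T6 : R * ‖massInv P p‖ * (B * ρ ^ 2 + 3 * ‖J‖) ≤
      μ * ‖p‖ * (K / C * s * (B * ρ ^ 2 + 3 * C₁) + 3 * (K * η * s)) := by
    have hB0 : 0 ≤ B := (abs_nonneg _).trans (hB 0)
    have g1 : R * ‖G‖ ^ 2 ≤ K * s := by
      rw [← hRQ]
      refine mul_le_mul_of_nonneg_left ?_ hR
      unfold virialDenom
      have : 0 ≤ C ^ 2 * (1 + x.2.2 ^ 2) := by positivity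
      linarith
    calc _ ≤ R * (μ * ‖p‖) * (B * ρ ^ 2 + 3 * (η * ‖G‖ ^ 2 + C₁)) := by gcongr
      _ = μ * ‖p‖ * (R * (B * ρ ^ 2 + 3 * C₁) + 3 * (η * (R * ‖G‖ ^ 2))) := by ring
      _ ≤ μ * ‖p‖ * (K * s / C * (B * ρ ^ 2 + 3 * C₁) + 3 * (η * (K * s))) := by gcongr
      _ = _ := by ring
  have hB0 : 0 ≤ B := (abs_nonneg _).trans (hB 0)
  set M₁ := B * ρ ^ 2 + 3 * C₁ with hM₁
  have hM₁0 : 0 ≤ M₁ := by positivity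
  have hκ : 0 ≤ κ := by
    have := P.kB_pos; have := P.T_pos; have := P.a_pos
    positivity
  obtain ⟨z1, z2, z3, z4⟩ := weight_bounds hs.le ‖p‖
  set F := (1 + s) * (1 + ‖p‖ ^ 2)
  have y1 := mul_le_mul_of_nonneg_left z1 (by positivity : 0 ≤ K / C * (μ * M₁))
  have y1' := mul_le_mul_of_nonneg_left z1 (by positivity : 0 ≤ 3 * (K * μ * η))
  have y2 := mul_le_mul_of_nonneg_left z2 (by positivity : 0 ≤ K / C * (1 + P.γ * μ))
  have y3 := mul_le_mul_of_nonneg_left z3 (by positivity : 0 ≤ K / C * (P.σ * (k * N + 5)))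
  have y4 := mul_le_mul_of_nonneg_left z4 (by positivity : 0 ≤ K / C * (3 * κ))
  have S := add_le_add (add_le_add T1 T2) ((add_le_add T3 T4'').trans
    (add_le_add_left (add_le_add_right T3' _) _))
  have S' := add_le_add (add_le_add (add_le_add y1 y1') y2) (add_le_add y3 y4)
  clear_value F κ μ M₁ s t h R a a' ζ
  clear T1 T2 T3 T3' T4 T4' T4'' y1 y1' y2 y3 y4 z1 z2 z3 z4 hRQ hRs hRGt haG haR hD hJx
  linarith only [S, S', T5, T6]

/-- Under these conditions each of the three terms of the denominator is at most `|∇U|²`, and the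
cutoff is `1`. -/
theorem virialCoeff_mul_norm_sq_ge (hK : 0 ≤ K) (hC : 0 < C) {q : Conf N k} {ξ : ℝ}
    (hq : 2 ≤ pot U q) (h1 : C ≤ ‖gradient (pot U) q‖) (h2 : C * |ξ| ≤ ‖gradient (pot U) q‖) :
    K * nhScale ξ / 3 ≤ virialCoeff U K C q ξ * ‖gradient (pot U) q‖ ^ 2 := by
  rw [virialCoeff_eq, Real.smoothTransition.one_of_one_le (by linarith), mul_one, virialRatio,
    div_mul_eq_mul_div, div_le_div_iff₀ (by norm_num) (virialDenom_pos hC q ξ)]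
  have hs := nhScale_pos ξ
  have e : virialDenom U C q ξ ≤ ‖gradient (pot U) q‖ ^ 2 * 3 := by
    have e1 : C ^ 2 ≤ ‖gradient (pot U) q‖ ^ 2 := by gcongr
    have e2 : (C * |ξ|) ^ 2 ≤ ‖gradient (pot U) q‖ ^ 2 := by gcongr
    rw [mul_pow, sq_abs] at e2
    unfold virialDenom
    linarith
  calc _ ≤ K * nhScale ξ * (‖gradient (pot U) q‖ ^ 2 * 3) := by gcongr
    _ = _ := by ring

/-- The virial perturbation: it is small, and its generator is very negative where the gradient of
the potential is large compared with `ξ`. -/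
theorem exists_virial_perturbation (hU : IsNormal P U) {η : ℝ} (hK : 0 < K) (hη : 0 < η) :
    ∃ C₀ : ℝ, ∀ C, C₀ ≤ C → 0 < C ∧
      (∀ x ∈ stateSpace U, ContDiffAt ℝ 2 (virialFun U K C) x) ∧
      (∀ x, |virialFun U K C x| ≤ η * pot U x.1) ∧
      (∀ x, ‖virialGrad U K C x‖ ≤ η) ∧
      (∀ x ∈ stateSpace U, ∀ j,
        fderiv ℝ (virialFun U K C) x (momentumDir j) = virialGrad U K C x j) ∧
      (∀ x ∈ stateSpace U, generator P U (virialFun U K C) x ≤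
        η * ((1 + nhScale x.2.2) * (1 + ‖x.2.1‖ ^ 2))) ∧
      (∀ x ∈ stateSpace U, C ≤ ‖gradient (pot U) x.1‖ →
        C * |x.2.2| ≤ ‖gradient (pot U) x.1‖ →
        generator P U (virialFun U K C) x ≤
          -(K * nhScale x.2.2 / 3 * (√(1 + ‖x.2.1‖ ^ 2))⁻¹ ^ 3) +
          η * ((1 + nhScale x.2.2) * (1 + ‖x.2.1‖ ^ 2))) := by
  obtain ⟨B, -, hB⟩ := exists_abs_deriv_smoothTransition_le
  set μ := ‖massInv (k := k) P‖ with hμd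
  have hμ : 0 ≤ μ := norm_nonneg _
  -- Order of choice: `K` is given, then the Hessian tolerance `η₁`, then its additive constant
  -- `C₁`, and last `C`, large against all of them. Thus a large gain `K` is compatible with a small
  -- function.
  set η₁ := η / (6 * (K * (μ + 1))) with hη₁
  have hη₁0 : 0 < η₁ := by positivity
  obtain ⟨C₁, hC₁, hJ⟩ := hU.exists_hessian_le_sq hη₁0
  obtain ⟨ρ, hρ⟩ := ((hU.isCompact_le 2).image_of_continuousOn
    (hU.continuousOn_gradient.mono (le_subset_finiteSet U 2)).norm).bddAbove
  have hρ' : ∀ q ∈ finiteSet U, pot U q ≤ 2 → ‖gradient (pot U) q‖ ≤ ρ := by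
    intro q hq h
    refine hρ ⟨q, ?_, rfl⟩
    have hq' : U q ≠ ⊤ := (show U q < ⊤ from hq).ne
    rw [mem_ofPred_eq, ← ENNReal.toReal_le_toReal hq' (ENNReal.natCast_ne_top 2)]
    simpa [pot] using h
  set M := 1 + P.γ * μ + P.σ * (k * N + 5) + 3 * ((μ + P.kB * P.T * (k * N)) / P.a) +
    μ * (B * ρ ^ 2 + 3 * C₁) with hM
  have hM1 : 1 ≤ M := by
    have := P.kB_pos; have := P.T_pos; have := P.a_pos; have := P.γ_pos; have := P.σ_pos
    have hB0 : 0 ≤ B := (abs_nonneg _).trans (hB 0)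
    have : 0 ≤ P.γ * μ + P.σ * (k * N + 5) + 3 * ((μ + P.kB * P.T * (k * N)) / P.a) +
      μ * (B * ρ ^ 2 + 3 * C₁) := by positivity
    linarith
  refine ⟨1 + |ρ| + 2 * K * M / η, fun C hC => ?_⟩
  have hKM : 0 < 2 * K * M / η := by positivity
  have hC1 : 1 ≤ C := by linarith [abs_nonneg ρ]
  have hC0 : 0 < C := by linarith
  have hCρ : ρ < C := by linarith [le_abs_self ρ]
  have hCM : K / C * M ≤ η / 2 := by
    have : 2 * K * M / η ≤ C := by linarith [abs_nonneg ρ]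
    rw [div_le_iff₀ hη] at this
    rw [div_mul_eq_mul_div, div_le_div_iff₀ hC0 two_pos]
    linarith
  have hKC : 2 * (K / C) ≤ η := by
    have : K / C * 1 ≤ K / C * M := by gcongr
    linarith
  have hη₁M : 3 * (K * μ * η₁) ≤ η / 2 := by
    rw [hη₁, ← sub_nonneg]
    have : η / 2 - 3 * (K * μ * (η / (6 * (K * (μ + 1))))) = η / (2 * (μ + 1)) := by
      field_simp; ring
    rw [this]; positivity
  have hgen : ∀ x ∈ stateSpace U, generator P U (virialFun U K C) x ≤
      -(virialCoeff U K C x.1 x.2.2 * ‖gradient (pot U) x.1‖ ^ 2 * (√(1 + ‖x.2.1‖ ^ 2))⁻¹ ^ 3) +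
      η * ((1 + nhScale x.2.2) * (1 + ‖x.2.1‖ ^ 2)) := fun x hx => by
    refine (generator_virialFun_le hU hK.le hC1 hB hρ' hη₁0.le hC₁ hJ hx).trans ?_
    have hs := nhScale_pos x.2.2
    gcongr
    rw [← hμd, ← hM]
    linarith
  have hh := fun x : Phase N k => inv_sqrt_one_add_sq_pos ‖x.2.1‖
  refine ⟨hC0, fun x hx => contDiffAt_virialFun hU hC0 hx, fun x => ?_,
    fun x => (norm_virialGrad_le hK.le hC0 x).trans hKC,
    fun x hx j => fderiv_virialFun_momentumDir hU hC0 hx j, fun x hx => ?_, fun x hx h1 h2 => ?_⟩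
  · refine (abs_virialFun_le hK.le hC0 x).trans (mul_le_mul_of_nonneg_right ?_ (pot_nonneg U _))
    have : 0 < K / C := by positivity
    linarith
  · refine (hgen x hx).trans (add_le_of_nonpos_left (neg_nonpos.2 ?_))
    have := virialCoeff_nonneg (U := U) hK.le hC0 x.1 x.2.2
    have := hh x
    positivity
  -- `C` exceeds the maximum of `|∇U|` on `{U ≤ 2}`, so `|∇U| ≥ C` forces the cutoff to be `1`.
  · have h3 : 2 ≤ pot U x.1 := by
      by_contra! h
      linarith [hρ' x.1 hx h.le]
    have := virialCoeff_mul_norm_sq_ge hK.le hC0 h3 h1 h2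
    have h4 := mul_le_mul_of_nonneg_right this (pow_pos (hh x) 3).le
    linarith [hgen x hx]

end VirialBound

/-! ### The generator on the Hamiltonian. -/

section Energy

variable {N k : ℕ} {P : Params N} {U : Conf N k → ℝ≥0∞} {x : Phase N k}

theorem exists_massNormSq_ge (P : Params N) :
    ∃ κ > 0, ∀ p : Conf N k, κ * ‖p‖ ^ 2 ≤ massNormSq P p := by
  have hS : 0 ≤ ∑ i, P.m i := Finset.sum_nonneg fun i _ => (P.m_pos i).le
  refine ⟨(1 + ∑ i, P.m i)⁻¹, by positivity, fun p => ?_⟩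
  rw [EuclideanSpace.real_norm_sq_eq, Fintype.sum_prod_type, Finset.mul_sum, massNormSq]
  refine Finset.sum_le_sum fun i _ => ?_
  rw [div_eq_inv_mul]
  have h : P.m i ≤ 1 + ∑ i, P.m i := by
    linarith [Finset.single_le_sum (fun i _ => (P.m_pos i).le) (Finset.mem_univ i)]
  have h' := inv_anti₀ (P.m_pos i) h
  gcongr

theorem inner_massInv_comm (P : Params N) (p v : Conf N k) :
    inner ℝ p (massInv P v) = (inner ℝ v (massInv P p) : ℝ) := by
  simp only [PiLp.inner_apply, massInv_apply]
  refine Finset.sum_congr rfl fun j _ => ?_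
  simp
  ring

theorem le_norm_massInv {κ : ℝ} {p : Conf N k} (h : κ * ‖p‖ ^ 2 ≤ massNormSq P p) :
    κ * ‖p‖ ≤ ‖massInv P p‖ := by
  rcases eq_or_ne p 0 with rfl | hp
  · simp
  · have h1 := h.trans_eq (massNormSq_eq_inner P p)
    have h2 := real_inner_le_norm p (massInv P p)
    have h3 : 0 < ‖p‖ := norm_pos_iff.2 hp
    nlinarith

theorem hasDerivAt_massNormSq (P : Params N) (p v : Conf N k) (t : ℝ) :
    HasDerivAt (fun t : ℝ => massNormSq P (p + t • v)) (2 * inner ℝ v (massInv P (p + t • v))) t := by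
  have l := hasDerivAt_line p v t
  have h := l.inner ℝ ((massInv (k := k) P).hasFDerivAt.comp_hasDerivAt t l)
  simp only [massNormSq_eq_inner]
  refine h.congr_deriv ?_
  rw [inner_massInv_comm P (p + t • v) v]
  simp only [Function.comp_apply]
  ring

theorem contDiff_massNormSq (P : Params N) : ContDiff ℝ 2 (massNormSq (k := k) P) := by
  have : massNormSq (k := k) P = fun p => inner ℝ p (massInv P p) :=
    funext fun p => massNormSq_eq_inner P p
  rw [this]
  exact contDiff_id.inner ℝ (massInv P).contDiff

theorem contDiffAt_hamiltonian (hU : IsNormal P U) (hx : x ∈ stateSpace U) :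
    ContDiffAt ℝ 2 (hamiltonian P U) x := by
  have h2 : ContDiffAt ℝ 2 (fun x : Phase N k => x.2.1) x := contDiffAt_fst.comp x contDiffAt_snd
  have h3 : ContDiffAt ℝ 2 (fun x : Phase N k => x.2.2) x := contDiffAt_snd.comp x contDiffAt_snd
  have hp : ContDiffAt ℝ 2 (fun x : Phase N k => pot U x.1) x :=
    ((hU.contDiffAt_pot hx).of_le (by norm_cast)).comp x contDiffAt_fst
  have hm : ContDiffAt ℝ 2 (fun x : Phase N k => massNormSq P x.2.1) x :=
    (contDiff_massNormSq P).contDiffAt.comp x h2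
  exact ((hm.div_const 2).add hp).add ((contDiffAt_const.mul (h3.pow 2)).div_const 2)

theorem fderiv_hamiltonian_apply (hU : IsNormal P U) (hx : x ∈ stateSpace U) (v : Phase N k) :
    fderiv ℝ (hamiltonian P U) x v =
      inner ℝ v.2.1 (massInv P x.2.1) + inner ℝ (gradient (pot U) x.1) v.1 +
        P.a * x.2.2 * v.2.2 := by
  refine fderiv_apply_eq_of_line ((contDiffAt_hamiltonian hU hx).differentiableAt
    (by norm_num)) ?_
  have l2 : HasDerivAt (fun t : ℝ => pot U (x.1 + t • v.1))
      (inner ℝ (gradient (pot U) x.1) v.1) 0 := by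
    have h : HasFDerivAt (pot U) (fderiv ℝ (pot U) x.1) (x.1 + (0 : ℝ) • v.1) := by
      simpa using ((hU.contDiffAt_pot hx).differentiableAt (by simp)).hasFDerivAt
    rw [← fderiv_pot_apply]
    exact h.comp_hasDerivAt 0 (hasDerivAt_line x.1 v.1 0)
  have l3 := (((hasDerivAt_line x.2.2 v.2.2 0).pow 2).const_mul P.a).div_const 2
  have h := (((hasDerivAt_massNormSq P x.2.1 v.2.1 0).div_const 2).add l2).add l3
  refine h.congr_deriv ?_
  simp only [zero_smul, add_zero]
  push_cast
  ring

theorem fderiv_hamiltonian_momentumDir (hU : IsNormal P U) (hx : x ∈ stateSpace U)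
    (j : Fin N × Fin k) :
    fderiv ℝ (hamiltonian P U) x (momentumDir j) = massInv P x.2.1 j := by
  rw [fderiv_hamiltonian_apply hU hx]
  simp [momentumDir, EuclideanSpace.inner_single_left]

theorem momentumLaplacian_hamiltonian (hU : IsNormal P U) (hx : x ∈ stateSpace U) :
    momentumLaplacian (hamiltonian P U) x = ∑ j : Fin N × Fin k, 1 / P.m j.1 := by
  refine Finset.sum_congr rfl fun j _ => ?_
  set e : Conf N k := EuclideanSpace.single j 1 with he
  have h0 : inner ℝ e (massInv P e) = 1 / P.m j.1 := by
    simp [he, EuclideanSpace.inner_single_left, massInv_apply]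
  refine fderiv_fderiv_eq_of_line (g := fun t => inner ℝ e (massInv P (x.2.1 + t • e)))
    (contDiffAt_hamiltonian hU hx) (fun t => ?_) ?_
  · have h1 := ((((hasDerivAt_massNormSq P x.2.1 e t).div_const 2).add_const (pot U x.1)).add_const
      (P.a * x.2.2 ^ 2 / 2))
    refine (h1.congr_deriv (by ring)).congr_of_eventuallyEq (Eventually.of_forall fun t => ?_)
    simp only [hamiltonian, momentumDir, Prod.fst_add, Prod.snd_add,
      Prod.smul_fst, Prod.smul_snd, smul_zero, add_zero]
    rfl
  · have h2 := (hasDerivAt_const (0 : ℝ) e).inner ℝ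
      ((massInv (k := k) P).hasFDerivAt.comp_hasDerivAt 0 (hasDerivAt_line x.2.1 e 0))
    refine h2.congr_deriv ?_
    simp [h0]

/-- The transport terms `±∇U·M⁻¹p` and the exchange `±ξ‖p‖_m²` cancel. There remain friction, the
trace of the noise, and the linear term in `ξ` responsible for the whole difficulty at `ξ → -∞`. -/
theorem generator_hamiltonian (hU : IsNormal P U) (hx : x ∈ stateSpace U) :
    generator P U (hamiltonian P U) x =
      -(P.γ * ‖massInv P x.2.1‖ ^ 2) - P.kB * P.T * (k * N) * x.2.2 +
        P.σ * ∑ j : Fin N × Fin k, 1 / P.m j.1 := by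
  rw [generator_eq (contDiffAt_hamiltonian hU hx), momentumLaplacian_hamiltonian hU hx,
    fderiv_hamiltonian_apply hU hx, drift_eq]
  simp only [inner_sub_left, inner_smul_left, real_inner_self_eq_norm_sq, conj_trivial,
    ← massNormSq_eq_inner]
  have := P.a_pos.ne'
  field_simp
  ring

end Energy

/-! ### The thermostat perturbation. -/

section Confinement

variable {N k : ℕ} {P : Params N} {U : Conf N k → ℝ≥0∞} {x : Phase N k}

/-- The perturbation of the thermostat energy that favours large kinetic energy dissipation when
`ξ` is negative. -/
def thermostatFun (c ξ : ℝ) : ℝ := ∫ z in (0 : ℝ)..ξ, -(c * (nhScale z - 1))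

theorem hasDerivAt_thermostatFun (c ξ : ℝ) :
    HasDerivAt (thermostatFun c) (-(c * (nhScale ξ - 1))) ξ := by
  have hc : Continuous fun z => -(c * (nhScale z - 1)) := by
    have := contDiff_nhScale.continuous
    fun_prop
  exact (hc.integral_hasStrictDerivAt 0 ξ).hasDerivAt

theorem contDiff_thermostatFun (c : ℝ) : ContDiff ℝ 2 (thermostatFun c) := by
  have h : deriv (thermostatFun c) = fun ξ => -(c * (nhScale ξ - 1)) :=
    funext fun ξ => (hasDerivAt_thermostatFun c ξ).deriv
  have e : (2 : WithTop ℕ∞) = 1 + 1 := by norm_num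
  rw [e, contDiff_succ_iff_deriv, h]
  refine ⟨fun ξ => (hasDerivAt_thermostatFun c ξ).differentiableAt, by simp, ?_⟩
  exact (contDiff_const.mul ((contDiff_nhScale.of_le (by norm_cast)).sub contDiff_const)).neg

theorem nhScale_sub_one_le (ξ : ℝ) : nhScale ξ - 1 ≤ 2 * |ξ| := by
  have := sqrt_one_add_sq_le ξ
  unfold nhScale
  linarith [neg_abs_le ξ]

theorem abs_nhScale_sub_one_le (ξ : ℝ) : |nhScale ξ - 1| ≤ 2 * |ξ| := by
  have h1 := one_le_sqrt_one_add_sq ξ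
  refine abs_le.2 ⟨?_, nhScale_sub_one_le ξ⟩
  unfold nhScale
  linarith [le_abs_self ξ, abs_nonneg ξ]

/-- The integrand vanishes at `0` and grows at most linearly, which is why `1` is subtracted from
the scale: the result is dominated by `ξ²`, also near `0`. -/
theorem abs_thermostatFun_le {c : ℝ} (hc : 0 ≤ c) (ξ : ℝ) :
    |thermostatFun c ξ| ≤ 2 * c * ξ ^ 2 := by
  have h : ∀ z ∈ uIoc (0 : ℝ) ξ, ‖-(c * (nhScale z - 1))‖ ≤ c * (2 * |ξ|) := by
    intro z hz
    rw [norm_neg, norm_mul, Real.norm_of_nonneg hc, Real.norm_eq_abs]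
    have hz' : |z| ≤ |ξ| := by
      rcases le_total 0 ξ with h | h
      · rw [uIoc_of_le h] at hz
        rw [abs_of_pos hz.1, abs_of_nonneg h]; exact hz.2
      · rw [uIoc_of_ge h] at hz
        rw [abs_of_nonpos hz.2, abs_of_nonpos h]; linarith [hz.1]
    have := abs_nhScale_sub_one_le z
    gcongr
    linarith
  have := intervalIntegral.norm_integral_le_of_norm_le_const h
  rw [sub_zero, Real.norm_eq_abs] at this
  refine this.trans_eq ?_
  rw [← sq_abs ξ]; ring

theorem contDiff_thermostat (c : ℝ) : ContDiff ℝ 2 fun x : Phase N k => thermostatFun c x.2.2 :=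
  (contDiff_thermostatFun c).comp (contDiff_snd.comp contDiff_snd)

theorem fderiv_thermostat (c : ℝ) (x v : Phase N k) :
    fderiv ℝ (fun x : Phase N k => thermostatFun c x.2.2) x v =
      -(c * (nhScale x.2.2 - 1)) * v.2.2 := by
  refine fderiv_apply_eq_of_line ((contDiff_thermostat c).differentiable (by norm_num) x) ?_
  have h : HasDerivAt (thermostatFun c) (-(c * (nhScale x.2.2 - 1)))
      (x.2.2 + (0 : ℝ) • v.2.2) := by
    simpa using hasDerivAt_thermostatFun c x.2.2
  exact HasDerivAt.comp (h₂ := thermostatFun c) 0 h (hasDerivAt_line x.2.2 v.2.2 0)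

theorem fderiv_thermostat_momentumDir (c : ℝ) (x : Phase N k) (j : Fin N × Fin k) :
    fderiv ℝ (fun x : Phase N k => thermostatFun c x.2.2) x (momentumDir j) = 0 := by
  rw [fderiv_thermostat]; simp [momentumDir]

theorem generator_thermostat (δ : ℝ) (x : Phase N k) :
    generator P U (fun x => thermostatFun (δ * P.a) x.2.2) x =
      -(δ * (nhScale x.2.2 - 1)) * (massNormSq P x.2.1 - P.kB * P.T * (k * N)) := by
  have h : momentumLaplacian (fun x : Phase N k => thermostatFun (δ * P.a) x.2.2) x = 0 := by
    unfold momentumLaplacian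
    refine Finset.sum_eq_zero fun j _ => ?_
    simp only [fderiv_thermostat_momentumDir]
    simp
  rw [generator_eq (contDiff_thermostat _).contDiffAt, h, fderiv_thermostat, drift_eq]
  have := P.a_pos.ne'
  field_simp
  ring

end Confinement

/-! ### Assembling the exponent; scalar inequalities for either sign of `ξ`. -/

section Exponent

variable {N k : ℕ} {P : Params N} {U : Conf N k → ℝ≥0∞} {x : Phase N k}

theorem generator_const_mul {f : Phase N k → ℝ} (c : ℝ) (hf : ContDiffAt ℝ 2 f x) :
    generator P U (fun y => c * f y) x = c * generator P U f x := by
  have key : ∀ v, fderiv ℝ (fun y => fderiv ℝ (fun z => c * f z) y v) x v =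
      c * fderiv ℝ (fun y => fderiv ℝ f y v) x v := by
    intro v
    have e : (fun y => fderiv ℝ (fun z => c * f z) y v) =ᶠ[𝓝 x] fun y => c * fderiv ℝ f y v := by
      filter_upwards [eventually_differentiableAt hf] with y hy
      rw [fderiv_const_mul hy]; simp
    rw [e.fderiv_eq, fderiv_const_mul (differentiableAt_fderiv_apply hf v)]
    simp
  unfold generator
  rw [Finset.sum_congr rfl fun j _ => key (noise P j), ← Finset.mul_sum,
    fderiv_const_mul (hf.differentiableAt (by norm_num))]
  simp only [smul_apply, smul_eq_mul]
  ring

/-- Used with `u` the momentum gradient of `β₀H`, `v` that of the expanding perturbation and `w`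
that of the virial one. Since `‖w‖ ≤ 1`, every cross term becomes linear in `‖v‖` or `‖w‖` with a
common weight, which the generator estimates can absorb. -/
theorem norm_add_add_sq_le {E : Type*} [NormedAddCommGroup E] {u v w : E} {b r : ℝ}
    (hu : ‖u‖ ≤ b * r) (hb : 0 ≤ b) (hr : 0 ≤ r) (hw : ‖w‖ ≤ 1) :
    ‖u + v + w‖ ^ 2 ≤ ‖u‖ ^ 2 + (‖v‖ ^ 2 + 2 * (b + 1) * (1 + r) * ‖v‖) +
      2 * (b + 1) * (1 + r) * ‖w‖ := by
  have h1 : ‖u + v + w‖ ≤ ‖u‖ + ‖v‖ + ‖w‖ := norm_add₃_le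
  have h2 : ‖u + v + w‖ ^ 2 ≤ (‖u‖ + ‖v‖ + ‖w‖) ^ 2 := by gcongr
  have hv := norm_nonneg v
  have hw0 := norm_nonneg w
  have h3 := mul_le_mul_of_nonneg_right hu hv
  have h4 := mul_le_mul_of_nonneg_right hu hw0
  have h5 := mul_le_mul_of_nonneg_left hw hv
  have h6 := mul_le_mul_of_nonneg_left hw hw0
  have h7 : 0 ≤ r * ‖v‖ := by positivity
  have h8 : 0 ≤ r * ‖w‖ := by positivity
  have h9 : 0 ≤ b * ‖v‖ := by positivity
  have h10 : 0 ≤ b * ‖w‖ := by positivity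
  nlinarith

/-- The generator of the exponential, divided by the exponential, for a perturbed multiple of the
Hamiltonian. -/
theorem generator_perturbed_le (hU : IsNormal P U) {β₀ δ : ℝ} (hβ₀ : 0 ≤ β₀)
    {ψ₁ ψ₂ : Phase N k → ℝ} {D₁ D₂ : Conf N k} (hx : x ∈ stateSpace U)
    (h1 : ContDiffAt ℝ 2 ψ₁ x) (h2 : ContDiffAt ℝ 2 ψ₂ x)
    (hD1 : ∀ j, fderiv ℝ ψ₁ x (momentumDir j) = D₁ j)
    (hD2 : ∀ j, fderiv ℝ ψ₂ x (momentumDir j) = D₂ j) (hD2' : ‖D₂‖ ≤ 1) :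
    generator P U (fun y => β₀ * hamiltonian P U y + thermostatFun (δ * P.a) y.2.2 + ψ₁ y + ψ₂ y) x +
      P.σ * gradMomentumSq
        (fun y => β₀ * hamiltonian P U y + thermostatFun (δ * P.a) y.2.2 + ψ₁ y + ψ₂ y) x ≤
      -(β₀ * P.γ * (1 - β₀ * (P.kB * P.T)) * ‖massInv P x.2.1‖ ^ 2) -
      β₀ * (P.kB * P.T) * (k * N) * x.2.2 + β₀ * P.σ * ∑ j : Fin N × Fin k, 1 / P.m j.1 -
      δ * (nhScale x.2.2 - 1) * (massNormSq P x.2.1 - P.kB * P.T * (k * N)) +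
      (generator P U ψ₁ x + (P.σ * ‖D₁‖ ^ 2 +
        2 * P.σ * (β₀ * ‖massInv (k := k) P‖ + 1) * (1 + ‖x.2.1‖) * ‖D₁‖)) +
      (generator P U ψ₂ x +
        2 * P.σ * (β₀ * ‖massInv (k := k) P‖ + 1) * (1 + ‖x.2.1‖) * ‖D₂‖) := by
  have hH := contDiffAt_hamiltonian hU hx
  have hH' : ContDiffAt ℝ 2 (fun y => β₀ * hamiltonian P U y) x := contDiffAt_const.mul hH
  have h0 : ContDiffAt ℝ 2 (fun y : Phase N k => thermostatFun (δ * P.a) y.2.2) x :=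
    (contDiff_thermostat (δ * P.a)).contDiffAt
  have hg : gradMomentumSq
      (fun y => β₀ * hamiltonian P U y + thermostatFun (δ * P.a) y.2.2 + ψ₁ y + ψ₂ y) x =
      ‖β₀ • massInv P x.2.1 + D₁ + D₂‖ ^ 2 := by
    refine gradMomentumSq_eq fun j => ?_
    have d0 := (hH.differentiableAt (by norm_num))
    have d1 := (hH'.differentiableAt (by norm_num))
    have d2 := (h0.differentiableAt (by norm_num))
    have d3 := (h1.differentiableAt (by norm_num))
    have d4 := (h2.differentiableAt (by norm_num))
    rw [fderiv_fun_add ((d1.fun_add d2).fun_add d3) d4, fderiv_fun_add (d1.fun_add d2) d3,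
      fderiv_fun_add d1 d2, fderiv_const_mul d0]
    simp only [add_apply, smul_apply, smul_eq_mul, hD1, hD2, fderiv_thermostat_momentumDir,
      fderiv_hamiltonian_momentumDir hU hx, PiLp.add_apply, PiLp.smul_apply, add_zero]
  rw [hg, generator_add ((hH'.add h0).add h1) h2, generator_add (hH'.add h0) h1,
    generator_add hH' h0, generator_const_mul β₀ hH, generator_hamiltonian hU hx,
    generator_thermostat]
  have hu : ‖β₀ • massInv P x.2.1‖ ≤ β₀ * ‖massInv (k := k) P‖ * ‖x.2.1‖ := by
    rw [norm_smul, Real.norm_of_nonneg hβ₀, mul_assoc]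
    gcongr
    exact (massInv P).le_opNorm _
  have hs := mul_le_mul_of_nonneg_left (norm_add_add_sq_le (v := D₁) hu
    (mul_nonneg hβ₀ (norm_nonneg _)) (norm_nonneg _) hD2') P.σ_pos.le
  rw [norm_smul, Real.norm_of_nonneg hβ₀] at hs
  have e : P.σ * (β₀ * ‖massInv P x.2.1‖) ^ 2 =
      β₀ * P.γ * (β₀ * (P.kB * P.T)) * ‖massInv P x.2.1‖ ^ 2 := by
    unfold Params.σ; ring
  linarith

/-- Multiply by the conjugate: `(√(1 + ξ²) - ξ)(√(1 + ξ²) + ξ) = 1`. -/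
theorem one_le_nhScale_mul {ξ : ℝ} (h : 0 ≤ ξ) : 1 ≤ nhScale ξ * (1 + 2 * ξ) := by
  have h1 := sqrt_one_add_sq_le ξ
  rw [abs_of_nonneg h] at h1
  have h2 : nhScale ξ * (√(1 + ξ ^ 2) + ξ) = 1 := by
    have := Real.sq_sqrt (by positivity : 0 ≤ 1 + ξ ^ 2)
    unfold nhScale
    linear_combination this
  nlinarith [nhScale_pos ξ]

theorem le_nhScale_sub_one {ξ : ℝ} (h : ξ ≤ 0) : |ξ| ≤ nhScale ξ - 1 := by
  have h1 := one_le_sqrt_one_add_sq ξ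
  rw [abs_of_nonpos h]
  unfold nhScale
  linarith

/-- Here `r = |p|²`. For `ξ ≥ 0` the thermostat term may have the wrong sign, but `s ∈ [0, 1]`
limits it to `δM`; with the perturbation errors it uses up at most half of the friction. -/
theorem exponent_bound_of_nonneg {r s M D δ η μ c b : ℝ} (hr : 0 ≤ r) (hs0 : 0 ≤ s) (hs1 : s ≤ 1)
    (hM0 : 0 ≤ M) (hM : M ≤ μ * r) (hD : 0 ≤ D) (hδ : 0 ≤ δ) (hη : 0 ≤ η) (h1 : δ * μ ≤ c / 4)
    (h2 : 3 * η ≤ c / 4) (h3 : 3 * η ≤ 1) :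
    -(c * r) + b - δ * (s - 1) * (M - D) + η * (1 + r) + η * ((1 + s) * (1 + r)) ≤
      -(c / 2 * r) + (b + 1) := by
  have a1 : δ * (1 - s) * (M - D) ≤ c / 4 * r := by
    calc _ ≤ δ * (1 - s) * M := by
          refine mul_le_mul_of_nonneg_left (by linarith) (mul_nonneg hδ (by linarith))
      _ ≤ δ * 1 * M := by gcongr; linarith
      _ ≤ δ * 1 * (μ * r) := by gcongr
      _ = δ * μ * r := by ring
      _ ≤ _ := by gcongr
  have a2 : η * ((1 + s) * (1 + r)) ≤ η * (2 * (1 + r)) := by gcongr; linarith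
  have a3 := mul_le_mul_of_nonneg_right h2 hr
  linarith

/-- For `z = |ξ|`, `ξ ≤ 0`, the thermostat term dissipates at least `δκ z r`. Half of it absorbs the
errors of order `η z r`; the price is a small increase of the linear coefficient of `z`. -/
theorem exponent_bound_of_nonpos {r s z M D δ η κ c b : ℝ} (hr : 0 ≤ r) (hz : 0 ≤ z)
    (hs0 : z ≤ s - 1) (hs1 : s - 1 ≤ 2 * z) (hM0 : 0 ≤ M) (hM : κ * r ≤ M) (hD : 0 ≤ D)
    (hδ : 0 ≤ δ) (hη : 0 ≤ η) (h1 : 3 * η ≤ δ * κ / 2)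
    (h2 : 3 * η ≤ c / 4) (h3 : 3 * η ≤ 1) :
    -(c * r) + b - δ * (s - 1) * (M - D) + η * z * (1 + r) + η * (1 + r) +
        η * ((1 + s) * (1 + r)) ≤
      -(c / 2 * r) - δ * κ / 2 * z * r + (2 * δ * D + 3 * η) * z + (b + 1) := by
  have a1 : δ * (z * (κ * r)) ≤ δ * ((s - 1) * M) := by
    refine mul_le_mul_of_nonneg_left ?_ hδ
    exact (mul_le_mul_of_nonneg_left hM hz).trans (mul_le_mul_of_nonneg_right hs0 hM0)
  have a2 : δ * D * (s - 1) ≤ δ * D * (2 * z) := by gcongr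
  have a3 : η * ((1 + s) * (1 + r)) ≤ η * ((2 + 2 * z) * (1 + r)) :=
    mul_le_mul_of_nonneg_left (mul_le_mul_of_nonneg_right (by linarith) (by linarith)) hη
  have a4 := mul_le_mul_of_nonneg_right h2 hr
  have a5 := mul_le_mul_of_nonneg_right h1 (mul_nonneg hz hr)
  have a6 : 0 ≤ η * r := mul_nonneg hη hr
  linarith

end Exponent

/-! ### Choice of constants and conclusion. -/

section Main

variable {N k : ℕ} {P : Params N} {U : Conf N k → ℝ≥0∞}

theorem IsNormal.isCompact_box (hU : IsNormal P U) (M : ℕ) (ϖ a b : ℝ) :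
    IsCompact ({q : Conf N k | U q ≤ M} ×ˢ (Metric.closedBall (0 : Conf N k) ϖ ×ˢ Icc a b)) :=
  (hU.isCompact_le M).prod ((isCompact_closedBall 0 ϖ).prod isCompact_Icc)

theorem inv_sqrt_one_add_sq_anti {r ϖ : ℝ} (hr : 0 ≤ r) (h : r ≤ ϖ) :
    (√(1 + ϖ ^ 2))⁻¹ ≤ (√(1 + r ^ 2))⁻¹ := by
  gcongr

/-- Large `r` is handled by friction and large `ξ` by the linear term. Otherwise `G` is large, and
the virial gain applies with `s` bounded below by `1/(1 + 2Ξ)`. -/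
theorem le_neg_one_of_nonneg {T r ξ G s c θ Ξ C₃ ϖ C E n : ℝ} (hc : 0 < c) (hθ : 0 < θ)
    (hϖ : 1 ≤ ϖ) (hϖc : C₃ + 1 ≤ c / 2 * ϖ) (hΞ : C₃ + 1 ≤ θ * Ξ) (hC : 0 < C) (hn : 0 ≤ n)
    (hE : C₃ + 1 ≤ E) (hE0 : 0 ≤ E) (hξ : 0 ≤ ξ) (hs : 0 ≤ s) (hs1 : 1 ≤ s * (1 + 2 * ξ))
    (h0 : T ≤ -(c / 2 * r ^ 2) - θ * ξ + C₃)
    (hgain : r ≤ ϖ → C ≤ G → C * |ξ| ≤ G →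
      T ≤ -(c / 2 * r ^ 2) - θ * ξ + C₃ - s * ((1 + 2 * Ξ) * E))
    (hfar : r < ϖ → ξ ≤ Ξ → C * (1 + n + Ξ) < G) : T ≤ -1 := by
  have hθξ : 0 ≤ θ * ξ := by positivity
  have hcr : 0 ≤ c / 2 * r ^ 2 := by positivity
  rcases le_or_gt ϖ r with hp | hp
  · have : c / 2 * ϖ ≤ c / 2 * r ^ 2 := by
      gcongr
      nlinarith
    linarith
  rcases lt_or_ge Ξ ξ with hz | hz
  · have : θ * Ξ ≤ θ * ξ := by gcongr
    linarith
  have hG := hfar hp hz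
  have hCn : 0 ≤ C * n := by positivity
  have hCz : C * ξ ≤ C * Ξ := by gcongr
  have hCz0 : 0 ≤ C * ξ := by positivity
  have h1 := hgain hp.le (by linarith) (by rw [abs_of_nonneg hξ]; linarith)
  have h2 : 1 ≤ s * (1 + 2 * Ξ) := by
    refine hs1.trans ?_
    gcongr
  have h3 := mul_le_mul_of_nonneg_right h2 hE0
  linarith

/-- Large `r`: the term `b z r²` beats `L z`. Large `G` relative to `z`: the virial gain is at least
`(1 + z)E`. In the remaining case `z ≥ n` and `G ≤ C z`, where the expanding gain `d(z - 1)` beats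
`L z` because `L ≤ d - g/2`. -/
theorem le_neg_one_of_nonpos {T r z G s c b L Ξ C₃ ϖ C E d g n n₀ : ℝ} (hc : 0 < c) (hb : 0 < b)
    (hϖ : 1 ≤ ϖ) (hϖc : C₃ + 1 ≤ c / 2 * ϖ) (hϖL : L ≤ b * ϖ) (hC : 0 < C) (hΞ : 0 < Ξ)
    (hL : 0 < L) (hC₃ : 0 < C₃) (hLg : L ≤ d - g / 2) (hg : 0 < g) (hn₀ : 1 ≤ n₀) (hn : n₀ ≤ n)
    (hng : C₃ + d + 1 ≤ g / 2 * n) (hE : E = L + C₃ + 1) (hz : 0 ≤ z) (hs : z ≤ s - 1)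
    (h0 : T ≤ -(c / 2 * r ^ 2) - b * z * r ^ 2 + L * z + C₃)
    (hgain : r ≤ ϖ → C ≤ G → C * z ≤ G →
      T ≤ -(c / 2 * r ^ 2) - b * z * r ^ 2 + L * z + C₃ - s * ((1 + 2 * Ξ) * E))
    (hexp : n₀ ≤ z → G ≤ C * z →
      T ≤ -(c / 2 * r ^ 2) - b * z * r ^ 2 + L * z + C₃ - d * (z - 1))
    (hfar : r < ϖ → z < n → C * (1 + n + Ξ) < G) : T ≤ -1 := by
  have hcr : 0 ≤ c / 2 * r ^ 2 := by positivity
  have hbr : 0 ≤ b * z * r ^ 2 := by positivity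
  rcases le_or_gt ϖ r with hp | hp
  · have hr : ϖ ≤ r ^ 2 := by nlinarith
    have h1 : c / 2 * ϖ ≤ c / 2 * r ^ 2 := by gcongr
    have h2 : b * z * ϖ ≤ b * z * r ^ 2 := by gcongr
    have h3 : L * z ≤ b * ϖ * z := by gcongr
    linarith
  have hE0 : 0 < E := by linarith
  by_cases hG : C ≤ G ∧ C * z ≤ G
  · have h1 := hgain hp.le hG.1 hG.2
    have h2 : E ≤ (1 + 2 * Ξ) * E := le_mul_of_one_le_left hE0.le (by linarith)
    have h3 : (1 + z) * E ≤ s * ((1 + 2 * Ξ) * E) := by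
      refine mul_le_mul (by linarith) h2 hE0.le (by linarith)
    have h4 : 0 ≤ z * (C₃ + 1) := by positivity
    rw [hE] at h3 h1
    linarith
  have hzn : n ≤ z := by
    by_contra! h
    have h1 := hfar hp h
    have h2 : C * z ≤ C * n := by gcongr
    have h3 : 0 < C * Ξ := by positivity
    have h4 : 0 ≤ C * z := by positivity
    exact hG ⟨by linarith, by linarith⟩
  have hGz : G ≤ C * z := by
    by_contra! h
    refine hG ⟨?_, h.le⟩
    have : C * 1 ≤ C * z := by gcongr; linarith
    linarith
  have h1 := hexp (by linarith) hGz
  have h2 : L * z ≤ (d - g / 2) * z := by gcongr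
  have h3 : g / 2 * n ≤ g / 2 * z := by gcongr
  linarith

set_option maxHeartbeats 1000000 in
/-- Existence of the perturbations together with the bound on the exponent. -/
theorem exists_exponent_perturbations (hN : 1 ≤ N) (hk : 1 ≤ k) (hU : IsNormal P U) {ε β₀ : ℝ}
    (hε : 0 < ε) (hβ₀ : 0 < β₀) (hβ : β₀ * (P.kB * P.T) < 1 / 2) :
    ∃ ψ₀ ψ₁ ψ₂ : Phase N k → ℝ,
      (∀ x ∈ stateSpace U, ContDiffAt ℝ 2 ψ₀ x) ∧ (∀ x ∈ stateSpace U, ContDiffAt ℝ 2 ψ₁ x) ∧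
      (∀ x ∈ stateSpace U, ContDiffAt ℝ 2 ψ₂ x) ∧
      (∀ x, |ψ₀ x + ψ₁ x + ψ₂ x| ≤ ε * hamiltonian P U x) ∧
      ∃ (A : Set (Phase N k)) (B : ℝ), IsCompact A ∧ A ⊆ stateSpace U ∧ 0 ≤ B ∧
        (∀ x ∈ stateSpace U,
          generator P U (fun y => β₀ * hamiltonian P U y + ψ₀ y + ψ₁ y + ψ₂ y) x +
            P.σ * gradMomentumSq (fun y => β₀ * hamiltonian P U y + ψ₀ y + ψ₁ y + ψ₂ y) x ≤ B) ∧
        ∀ x ∈ stateSpace U, x ∉ A →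
          generator P U (fun y => β₀ * hamiltonian P U y + ψ₀ y + ψ₁ y + ψ₂ y) x +
            P.σ * gradMomentumSq (fun y => β₀ * hamiltonian P U y + ψ₀ y + ψ₁ y + ψ₂ y) x ≤ -1 := by
  have ha := P.a_pos
  have hγ := P.γ_pos
  have hσ := P.σ_pos
  have hkT : 0 < P.kB * P.T := mul_pos P.kB_pos P.T_pos
  have hd : 1 ≤ (k * N : ℝ) := by exact_mod_cast Nat.mul_le_mul hk hN
  obtain ⟨κ, hκ, hκM⟩ := exists_massNormSq_ge (k := k) P
  set μ := ‖massInv (k := k) P‖ with hμd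
  have hμ : 0 ≤ μ := norm_nonneg _
  set D := P.kB * P.T * (k * N) with hDd
  have hD : 0 < D := by positivity
  set θ := β₀ * (P.kB * P.T) * (k * N) with hθd
  have hθ : 0 < θ := by positivity
  -- The margin between the expansion gain `kN/2` and the energy growth `θ`; its positivity is
  -- exactly `β₀ k_B T < 1/2`.
  obtain ⟨g, hg, hgθ⟩ : ∃ g > 0, θ + g = k * N / 2 :=
    ⟨k * N / 2 - θ, by rw [hθd]; nlinarith, by ring⟩
  set c := β₀ * P.γ * (1 - β₀ * (P.kB * P.T)) * κ ^ 2 with hcd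
  have hc' : 0 < β₀ * P.γ * (1 - β₀ * (P.kB * P.T)) := by
    have : 0 < 1 - β₀ * (P.kB * P.T) := by linarith
    positivity
  have hc : 0 < c := mul_pos hc' (by positivity)
  obtain ⟨C₂, hC₂⟩ : ∃ C₂, C₂ = β₀ * P.σ * ∑ j : Fin N × Fin k, 1 / P.m j.1 := ⟨_, rfl⟩
  have hC₂0 : 0 ≤ C₂ := by
    rw [hC₂]
    have : 0 ≤ ∑ j : Fin N × Fin k, 1 / P.m j.1 :=
      Finset.sum_nonneg fun j _ => (one_div_pos.2 (P.m_pos j.1)).le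
    positivity
  -- Three demands on `δ`: a perturbation small against `εH`, a loss below the friction for `ξ ≥ 0`,
  -- and a linear loss within a quarter of the margin for `ξ ≤ 0`.
  obtain ⟨δ, hδ, hδε, hδμ, hδD⟩ : ∃ δ > 0, δ ≤ ε / 8 ∧ δ * μ ≤ c / 4 ∧ 2 * δ * D ≤ g / 4 := by
    refine ⟨min (ε / 8) (min (c / (4 * (μ + 1))) (g / (8 * D))), by positivity,
      min_le_left _ _, ?_, ?_⟩
    · have h : min (ε / 8) (min (c / (4 * (μ + 1))) (g / (8 * D))) ≤ c / (4 * (μ + 1)) :=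
        (min_le_right _ _).trans (min_le_left _ _)
      calc _ ≤ c / (4 * (μ + 1)) * (μ + 1) := by gcongr; linarith
        _ = c / 4 := by field_simp
    · have h : min (ε / 8) (min (c / (4 * (μ + 1))) (g / (8 * D))) ≤ g / (8 * D) :=
        (min_le_right _ _).trans (min_le_right _ _)
      calc _ ≤ 2 * (g / (8 * D)) * D := by gcongr
        _ = g / 4 := by field_simp; norm_num
  obtain ⟨η, hη, hη1, hηc, hηδ, hηg, hηε⟩ : ∃ η > 0, 3 * η ≤ 1 ∧ 3 * η ≤ c / 4 ∧
      3 * η ≤ δ * κ / 2 ∧ 3 * η ≤ g / 4 ∧ η ≤ ε * P.a / 4 := by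
    refine ⟨min (1 / 3) (min (c / 12) (min (δ * κ / 6) (min (g / 12) (ε * P.a / 4)))),
      by positivity, ?_, ?_, ?_, ?_, ?_⟩
    · linarith [min_le_left (1 / 3 : ℝ)
        (min (c / 12) (min (δ * κ / 6) (min (g / 12) (ε * P.a / 4))))]
    all_goals
      have h1 := min_le_right (1 / 3 : ℝ)
        (min (c / 12) (min (δ * κ / 6) (min (g / 12) (ε * P.a / 4))))
      have h2 := min_le_left (c / 12) (min (δ * κ / 6) (min (g / 12) (ε * P.a / 4)))
      have h3 := min_le_right (c / 12) (min (δ * κ / 6) (min (g / 12) (ε * P.a / 4)))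
      have h4 := min_le_left (δ * κ / 6) (min (g / 12) (ε * P.a / 4))
      have h5 := min_le_right (δ * κ / 6) (min (g / 12) (ε * P.a / 4))
      have h6 := min_le_left (g / 12) (ε * P.a / 4)
      have h7 := min_le_right (g / 12) (ε * P.a / 4)
      linarith
  set Λ := 2 * P.σ * (β₀ * μ + 1) with hΛd
  have hΛ : 0 < Λ := by positivity
  obtain ⟨η₂, hη₂, hη₂1, hη₂η, hη₂ε, hη₂Λ⟩ : ∃ η₂ > 0, η₂ ≤ 1 ∧ η₂ ≤ η ∧ η₂ ≤ ε ∧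
      Λ * (2 * η₂) ≤ η := by
    refine ⟨min 1 (min η (min ε (η / (2 * Λ)))), by positivity, min_le_left _ _,
      (min_le_right _ _).trans (min_le_left _ _),
      (min_le_right _ _).trans ((min_le_right _ _).trans (min_le_left _ _)), ?_⟩
    have h : min 1 (min η (min ε (η / (2 * Λ)))) ≤ η / (2 * Λ) :=
      (min_le_right _ _).trans ((min_le_right _ _).trans (min_le_right _ _))
    calc _ ≤ Λ * (2 * (η / (2 * Λ))) := by gcongr
      _ = η := by field_simp
  obtain ⟨L, hL⟩ : ∃ L, L = θ + (2 * δ * D + 3 * η) := ⟨_, rfl⟩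
  have hL0 : 0 < L := by rw [hL]; positivity
  have hLg : L ≤ k * N / 2 - g / 2 := by rw [← hgθ, hL]; linarith
  obtain ⟨C₃, hC₃⟩ : ∃ C₃, C₃ = C₂ + 1 := ⟨_, rfl⟩
  have hC₃0 : 0 < C₃ := by linarith
  obtain ⟨ϖ, hϖ1, hϖc, hϖL⟩ : ∃ ϖ : ℝ, 1 ≤ ϖ ∧ C₃ + 1 ≤ c / 2 * ϖ ∧ L ≤ δ * κ / 2 * ϖ := by
    have hδκ : 0 < δ * κ / 2 := by positivity
    refine ⟨max 1 (max ((C₃ + 1) / (c / 2)) (L / (δ * κ / 2))), le_max_left _ _, ?_, ?_⟩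
    · rw [← div_le_iff₀' (by positivity)]
      exact (le_max_left _ _).trans (le_max_right _ _)
    · rw [← div_le_iff₀' hδκ]
      exact (le_max_right _ _).trans (le_max_right _ _)
  obtain ⟨Ξ, hΞ0, hΞ⟩ : ∃ Ξ : ℝ, 0 < Ξ ∧ C₃ + 1 ≤ θ * Ξ :=
    ⟨(C₃ + 1) / θ, by positivity, by field_simp; rfl⟩
  set hm := (√(1 + ϖ ^ 2))⁻¹ with hhm
  have hm0 : 0 < hm := inv_sqrt_one_add_sq_pos ϖ
  -- On `|p| ≤ ϖ` the virial gain is at least `(K/3) hm³` times the scale. The factor `1 + 2Ξ`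
  -- compensates for the decay of the scale on `0 ≤ ξ ≤ Ξ`. Only now is `C` fixed, and after it the
  -- expanding perturbation, which depends on `C`.
  obtain ⟨K, hK, hKe⟩ : ∃ K > 0, K / 3 * hm ^ 3 = (1 + 2 * Ξ) * (L + C₃ + 1) :=
    ⟨3 * ((1 + 2 * Ξ) * (L + C₃ + 1)) / hm ^ 3, by positivity, by field_simp⟩
  obtain ⟨C, hC⟩ := exists_virial_perturbation hU hK hη₂
  obtain ⟨hC0, v1, v2, v3, v4, v5, v6⟩ := hC C le_rfl
  obtain ⟨n₀, ψ₁, D₁, hn₀, e1, e2, e3, e4, e5, e6⟩ :=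
    exists_expanding_perturbation hU hN hk hC0 hΛ.le hη
  obtain ⟨n₁, hn₁0, hn₁, hn₁g⟩ : ∃ n₁ : ℝ, 0 ≤ n₁ ∧ (n₀ : ℝ) ≤ n₁ ∧
      C₃ + k * N / 2 + 1 ≤ g / 2 * n₁ := by
    refine ⟨max n₀ ((C₃ + k * N / 2 + 1) / (g / 2)), le_max_of_le_left (Nat.cast_nonneg _),
      le_max_left _ _, ?_⟩
    rw [← div_le_iff₀' (by positivity)]
    exact le_max_right _ _
  -- Above the level `M` of `U`, the gradient dominates both `C` and `C|ξ|` for all `ξ` in `[-n₁,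
  -- Ξ]`.
  obtain ⟨M, hM⟩ := hU.exists_lt_norm_gradient (C * (1 + n₁ + Ξ))
  set ψ₂ := virialFun U K C with hψ₂
  set ψ₀ := fun x : Phase N k => thermostatFun (δ * P.a) x.2.2 with hψ₀
  set V := fun y => β₀ * hamiltonian P U y + ψ₀ y + ψ₁ y + ψ₂ y with hV
  have key : ∀ x ∈ stateSpace U, generator P U V x + P.σ * gradMomentumSq V x ≤
      -(c * ‖x.2.1‖ ^ 2) + (-(θ * x.2.2) + C₂) - δ * (nhScale x.2.2 - 1) * (massNormSq P x.2.1 - D) +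
      (generator P U ψ₁ x + (P.σ * ‖D₁ x‖ ^ 2 + Λ * (1 + ‖x.2.1‖) * ‖D₁ x‖)) +
      (generator P U ψ₂ x + η * (1 + ‖x.2.1‖ ^ 2)) := by
    intro x hx
    have h := generator_perturbed_le (δ := δ) hU hβ₀.le hx (e1 x hx) (v1 x hx) (e3 x hx) (v4 x hx)
      ((v3 x).trans hη₂1)
    rw [← hμd, ← hΛd, ← hC₂] at h
    have h1 : c * ‖x.2.1‖ ^ 2 ≤
        β₀ * P.γ * (1 - β₀ * (P.kB * P.T)) * ‖massInv P x.2.1‖ ^ 2 := by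
      rw [hcd, mul_assoc, ← mul_pow]
      have := le_norm_massInv (hκM x.2.1)
      gcongr
    have h2 : Λ * (1 + ‖x.2.1‖) * ‖virialGrad U K C x‖ ≤ η * (1 + ‖x.2.1‖ ^ 2) := by
      have h3 : 1 + ‖x.2.1‖ ≤ 2 * (1 + ‖x.2.1‖ ^ 2) := by nlinarith only [sq_nonneg (‖x.2.1‖ - 1 / 4)]
      calc _ ≤ Λ * (2 * (1 + ‖x.2.1‖ ^ 2)) * η₂ := by
            gcongr
            exact v3 x
        _ = Λ * (2 * η₂) * (1 + ‖x.2.1‖ ^ 2) := by ring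
        _ ≤ _ := by gcongr
    refine h.trans ?_
    linarith only [h1, h2]
  have pos : ∀ x ∈ stateSpace U, 0 ≤ x.2.2 → ∀ G, generator P U ψ₂ x ≤
      -G + η₂ * ((1 + nhScale x.2.2) * (1 + ‖x.2.1‖ ^ 2)) →
      generator P U V x + P.σ * gradMomentumSq V x ≤
        -(c / 2 * ‖x.2.1‖ ^ 2) - θ * x.2.2 + C₃ - G := by
    intro x hx hξ G hG
    have hs := nhScale_pos x.2.2
    have h1 := exponent_bound_of_nonneg (b := -(θ * x.2.2) + C₂) (sq_nonneg ‖x.2.1‖) hs.le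
      (nhScale_le_one hξ) (massNormSq_nonneg P x.2.1) (massNormSq_le P x.2.1) hD.le hδ.le hη.le
      hδμ hηc hη1
    have h2 : η₂ * ((1 + nhScale x.2.2) * (1 + ‖x.2.1‖ ^ 2)) ≤
        η * ((1 + nhScale x.2.2) * (1 + ‖x.2.1‖ ^ 2)) := by gcongr
    linarith only [key x hx, e4 x hx hξ, h1, h2, hG, hC₃]
  have neg : ∀ x ∈ stateSpace U, x.2.2 ≤ 0 → ∀ G₁ G₂,
      generator P U ψ₁ x + (P.σ * ‖D₁ x‖ ^ 2 + Λ * (1 + ‖x.2.1‖) * ‖D₁ x‖) ≤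
        -G₁ + η * |x.2.2| * (1 + ‖x.2.1‖ ^ 2) →
      generator P U ψ₂ x ≤ -G₂ + η₂ * ((1 + nhScale x.2.2) * (1 + ‖x.2.1‖ ^ 2)) →
      generator P U V x + P.σ * gradMomentumSq V x ≤
        -(c / 2 * ‖x.2.1‖ ^ 2) - δ * κ / 2 * |x.2.2| * ‖x.2.1‖ ^ 2 + L * |x.2.2| + C₃ -
          G₁ - G₂ := by
    intro x hx hξ G₁ G₂ hG₁ hG₂
    have hs := nhScale_pos x.2.2
    have h1 := exponent_bound_of_nonpos (b := -(θ * x.2.2) + C₂) (sq_nonneg ‖x.2.1‖)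
      (abs_nonneg x.2.2) (le_nhScale_sub_one hξ) (nhScale_sub_one_le _)
      (massNormSq_nonneg P x.2.1) (hκM x.2.1) hD.le hδ.le hη.le hηδ hηc hη1
    have h2 : η₂ * ((1 + nhScale x.2.2) * (1 + ‖x.2.1‖ ^ 2)) ≤
        η * ((1 + nhScale x.2.2) * (1 + ‖x.2.1‖ ^ 2)) := by gcongr
    have h3 : x.2.2 = -|x.2.2| := by rw [abs_of_nonpos hξ, neg_neg]
    have h4 : θ * x.2.2 = -(θ * |x.2.2|) := by
      conv_lhs => rw [h3]
      ring
    rw [h4] at h1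
    have h5 := key x hx
    rw [h4] at h5
    rw [hL, hC₃]
    linarith only [h1, h2, h5, hG₁, hG₂]
  have gain : ∀ x ∈ stateSpace U, ‖x.2.1‖ ≤ ϖ → C ≤ ‖gradient (pot U) x.1‖ →
      C * |x.2.2| ≤ ‖gradient (pot U) x.1‖ → generator P U ψ₂ x ≤
        -(nhScale x.2.2 * ((1 + 2 * Ξ) * (L + C₃ + 1))) +
          η₂ * ((1 + nhScale x.2.2) * (1 + ‖x.2.1‖ ^ 2)) := by
    intro x hx hp h1 h2
    refine (v6 x hx h1 h2).trans (add_le_add_left (neg_le_neg ?_) _)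
    have hs := nhScale_pos x.2.2
    have := inv_sqrt_one_add_sq_anti (norm_nonneg x.2.1) hp
    rw [← hKe]
    calc _ = K * nhScale x.2.2 / 3 * hm ^ 3 := by ring
      _ ≤ _ := by gcongr
  have hLC : 0 < L + C₃ + 1 := by linarith
  set A := {q : Conf N k | U q ≤ M} ×ˢ (Metric.closedBall (0 : Conf N k) ϖ ×ˢ Icc (-n₁) Ξ) with hA
  have off : ∀ x ∈ stateSpace U, x ∉ A →
      generator P U V x + P.σ * gradMomentumSq V x ≤ -1 := by
    intro x hx hxA
    have hxA' : ‖x.2.1‖ < ϖ → -n₁ ≤ x.2.2 → x.2.2 ≤ Ξ → C * (1 + n₁ + Ξ) <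
        ‖gradient (pot U) x.1‖ := fun h1 h2 h3 => by
      refine hM x.1 hx (not_le.1 fun h => hxA ⟨h, by simpa using h1.le, h2, h3⟩)
    rcases le_total 0 x.2.2 with hξ | hξ
    · refine le_neg_one_of_nonneg (E := L + C₃ + 1) hc hθ hϖ1 hϖc hΞ hC0 hn₁0 (by linarith)
        hLC.le hξ (nhScale_pos _).le (one_le_nhScale_mul hξ) ?_
        (fun h1 h2 h3 => pos x hx hξ _ (gain x hx h1 h2 h3))
        (fun h1 h2 => hxA' h1 (by linarith) h2)
      have h := pos x hx hξ 0 ((v5 x hx).trans_eq (by rw [neg_zero, zero_add]))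
      rwa [sub_zero] at h
    · have e5' := (e5 x hx).trans_eq (by rw [neg_zero, zero_add] :
        _ = -0 + η * |x.2.2| * (1 + ‖x.2.1‖ ^ 2))
      have v5' := (v5 x hx).trans_eq (by rw [neg_zero, zero_add] :
        _ = -0 + η₂ * ((1 + nhScale x.2.2) * (1 + ‖x.2.1‖ ^ 2)))
      refine le_neg_one_of_nonpos (d := k * N / 2) hc (by positivity) hϖ1 hϖc hϖL hC0 hΞ0 hL0 hC₃0
        hLg hg (by exact_mod_cast hn₀ : (1 : ℝ) ≤ n₀) hn₁ hn₁g rfl (abs_nonneg x.2.2)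
        (le_nhScale_sub_one hξ) ?_ (fun h1 h2 h3 => ?_) (fun h1 h2 => ?_)
        (fun h1 h2 => hxA' h1 ?_ (by linarith))
      · have h := neg x hx hξ 0 0 e5' v5'
        rwa [sub_zero, sub_zero] at h
      · have h := neg x hx hξ 0 _ e5' (gain x hx h1 h2 h3)
        rwa [sub_zero] at h
      · rw [abs_of_nonpos hξ] at h1
        have h := neg x hx hξ _ 0 (e6 x hx (by linarith) h2) v5'
        rwa [sub_zero] at h
      · rw [abs_of_nonpos hξ] at h2
        linarith
  have on : ∀ x ∈ stateSpace U, x ∈ A →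
      generator P U V x + P.σ * gradMomentumSq V x ≤ L * n₁ + C₃ := by
    intro x hx hxA
    have v5' := (v5 x hx).trans_eq (by rw [neg_zero, zero_add] :
      _ = -0 + η₂ * ((1 + nhScale x.2.2) * (1 + ‖x.2.1‖ ^ 2)))
    have e5' := (e5 x hx).trans_eq (by rw [neg_zero, zero_add] :
      _ = -0 + η * |x.2.2| * (1 + ‖x.2.1‖ ^ 2))
    have hcr : 0 ≤ c / 2 * ‖x.2.1‖ ^ 2 := by positivity
    rcases le_total 0 x.2.2 with hξ | hξ
    · have h0 := pos x hx hξ 0 v5'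
      have h1 : 0 ≤ θ * x.2.2 := by positivity
      have h2 : 0 ≤ L * n₁ := by positivity
      linarith only [h0, h1, h2, hcr]
    · have h0 := neg x hx hξ 0 0 e5' v5'
      have h1 : 0 ≤ δ * κ / 2 * |x.2.2| * ‖x.2.1‖ ^ 2 := by positivity
      have h2 : L * |x.2.2| ≤ L * n₁ := by
        gcongr
        rw [abs_of_nonpos hξ]
        linarith only [hxA.2.2.1]
      linarith only [h0, h1, h2, hcr]
  refine ⟨ψ₀, ψ₁, ψ₂, fun x _ => (contDiff_thermostat _).contDiffAt, e1, v1, fun x => ?_,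
    A, L * n₁ + C₃, hU.isCompact_box M ϖ (-n₁) Ξ, fun x hx => le_subset_finiteSet U M hx.1,
    by positivity, fun x hx => ?_, off⟩
  · have h0 : |ψ₀ x| ≤ 2 * (δ * P.a) * x.2.2 ^ 2 := abs_thermostatFun_le (by positivity) _
    have h1 := e2 x
    have h2 := v2 x
    have h3 : |ψ₀ x + ψ₁ x + ψ₂ x| ≤ |ψ₀ x| + |ψ₁ x| + |ψ₂ x| := abs_add_three _ _ _
    have h4 := mul_nonneg hε.le (massNormSq_nonneg P x.2.1)
    have h5 : 2 * (δ * P.a) * x.2.2 ^ 2 ≤ 2 * (ε / 8 * P.a) * x.2.2 ^ 2 := by gcongr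
    have h6 : η * x.2.2 ^ 2 ≤ ε * P.a / 4 * x.2.2 ^ 2 := by gcongr
    have h7 : η₂ * pot U x.1 ≤ ε * pot U x.1 :=
      mul_le_mul_of_nonneg_right hη₂ε (pot_nonneg U x.1)
    unfold hamiltonian
    linarith
  · by_cases hxA : x ∈ A
    · exact on x hx hxA
    · have h1 := off x hx hxA
      have h2 : 0 < L * n₁ + C₃ := by positivity
      linarith

theorem exists_lyapunov (hN : 1 ≤ N) (hk : 1 ≤ k) (hU : IsNormal P U) {ε β₀ : ℝ}
    (hε : 0 < ε) (hβ₀ : 0 < β₀) (hβ : β₀ * (P.kB * P.T) < 1 / 2) :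
    ∃ ψ₀ ψ₁ ψ₂ V W : Phase N k → ℝ,
      (∀ x, V x = β₀ * hamiltonian P U x + ψ₀ x + ψ₁ x + ψ₂ x) ∧
      (∀ x, W x = Real.exp (V x)) ∧
      ContDiffOn ℝ 2 ψ₀ (stateSpace U) ∧
      ContDiffOn ℝ 2 ψ₁ (stateSpace U) ∧
      ContDiffOn ℝ 2 ψ₂ (stateSpace U) ∧
      (∀ x ∈ stateSpace U, |ψ₀ x + ψ₁ x + ψ₂ x| ≤ ε * hamiltonian P U x) ∧
      (∃ A : Set (Phase N k), ∃ α K : ℝ, IsCompact A ∧ A ⊆ stateSpace U ∧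
        0 < α ∧ 0 < K ∧ ∀ x ∈ stateSpace U,
          generator P U V x + P.γ * P.kB * P.T * gradMomentumSq V x
            ≤ -α + K * A.indicator 1 x) ∧
      ContDiffOn ℝ 2 W (stateSpace U) ∧
      (∀ x ∈ stateSpace U,
        Real.exp ((β₀ - ε) * hamiltonian P U x) ≤ W x ∧
        W x ≤ Real.exp ((β₀ + ε) * hamiltonian P U x)) ∧
      (∃ α K : ℝ, 0 < α ∧ 0 < K ∧ ∀ x ∈ stateSpace U,
        generator P U W x ≤ -α * W x + K) := by
  obtain ⟨ψ₀, ψ₁, ψ₂, h0, h1, h2, hψ, A, B, hA, hAX, hB, hVB, hVA⟩ :=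
    exists_exponent_perturbations hN hk hU hε hβ₀ hβ
  set V := fun y => β₀ * hamiltonian P U y + ψ₀ y + ψ₁ y + ψ₂ y with hV
  have hVc : ∀ x ∈ stateSpace U, ContDiffAt ℝ 2 V x := fun x hx =>
    (((contDiffAt_const.mul (contDiffAt_hamiltonian hU hx)).add (h0 x hx)).add (h1 x hx)).add
      (h2 x hx)
  have hWc : ∀ x ∈ stateSpace U, ContDiffAt ℝ 2 (fun y => Real.exp (V y)) x := fun x hx =>
    (hVc x hx).exp
  obtain ⟨R, hR⟩ := hA.exists_bound_of_continuousOn (f := fun y => Real.exp (V y)) fun x hx =>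
    (hWc x (hAX hx)).continuousAt.continuousWithinAt
  refine ⟨ψ₀, ψ₁, ψ₂, V, fun y => Real.exp (V y), fun x => rfl, fun x => rfl,
    fun x hx => (h0 x hx).contDiffWithinAt, fun x hx => (h1 x hx).contDiffWithinAt,
    fun x hx => (h2 x hx).contDiffWithinAt, fun x _ => hψ x,
    ⟨A, 1, B + 1, hA, hAX, one_pos, by positivity, fun x hx => ?_⟩,
    fun x hx => (hWc x hx).contDiffWithinAt, fun x _ => ?_,
    1, (B + 1) * (|R| + 1), one_pos, by positivity, fun x hx => ?_⟩
  · by_cases hxA : x ∈ A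
    · rw [indicator_of_mem hxA, Pi.one_apply]
      have := hVB x hx
      unfold Params.σ at this
      linarith
    · rw [indicator_of_notMem hxA]
      have := hVA x hx hxA
      unfold Params.σ at this
      linarith
  · have := abs_le.1 (hψ x)
    rw [Real.exp_le_exp, Real.exp_le_exp, hV]
    constructor <;> linarith
  -- Off `A` this gives `ℒW ≤ -W`; on `A`, `W` is bounded by `|R|`, and the constant absorbs `(B +
  -- 1)W`.
  · rw [generator_exp (hVc x hx)]
    have hpos := Real.exp_pos (V x)
    by_cases hxA : x ∈ A
    · have a1 := hR x hxA
      rw [Real.norm_of_nonneg hpos.le] at a1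
      have a2 : Real.exp (V x) * (generator P U V x + P.σ * gradMomentumSq V x) ≤
          Real.exp (V x) * B := by
        gcongr
        exact hVB x hx
      have a3 : Real.exp (V x) * (B + 1) ≤ (|R| + 1) * (B + 1) := by
        gcongr
        linarith [le_abs_self R]
      linarith
    · have a2 : Real.exp (V x) * (generator P U V x + P.σ * gradMomentumSq V x) ≤
          Real.exp (V x) * (-1) := by
        gcongr
        exact hVA x hx hxA
      have a3 : 0 ≤ (B + 1) * (|R| + 1) := by positivity
      linarith

end Main

end NHB

end

theorem theorem2 {N k : ℕ} (hN : 1 ≤ N) (hk : 1 ≤ k) (P : NHB.Params N)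
    (U : NHB.Conf N k → ℝ≥0∞) (hU : NHB.IsNormal P U)
    (ε β₀ : ℝ) (hε : 0 < ε) (hβ₀ : 0 < β₀) (hβ₀_lt : β₀ < P.βStar) :
    ∃ ψ₀ ψ₁ ψ₂ V W : NHB.Phase N k → ℝ,
      (∀ x, V x = β₀ * NHB.hamiltonian P U x + ψ₀ x + ψ₁ x + ψ₂ x) ∧
      (∀ x, W x = Real.exp (V x)) ∧
      -- the perturbations are twice continuously differentiable and small relative to `H`
      ContDiffOn ℝ 2 ψ₀ (NHB.stateSpace U) ∧
      ContDiffOn ℝ 2 ψ₁ (NHB.stateSpace U) ∧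
      ContDiffOn ℝ 2 ψ₂ (NHB.stateSpace U) ∧
      (∀ x ∈ NHB.stateSpace U, |ψ₀ x + ψ₁ x + ψ₂ x| ≤ ε * NHB.hamiltonian P U x) ∧
      -- the bound on the exponent `V`, with a compact exceptional set
      (∃ A : Set (NHB.Phase N k), ∃ α K : ℝ, IsCompact A ∧ A ⊆ NHB.stateSpace U ∧
        0 < α ∧ 0 < K ∧ ∀ x ∈ NHB.stateSpace U,
          NHB.generator P U V x + P.γ * P.kB * P.T * NHB.gradMomentumSq V x
            ≤ -α + K * A.indicator 1 x) ∧
      -- the Lyapunov function `W`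
      ContDiffOn ℝ 2 W (NHB.stateSpace U) ∧
      (∀ x ∈ NHB.stateSpace U,
        Real.exp ((β₀ - ε) * NHB.hamiltonian P U x) ≤ W x ∧
        W x ≤ Real.exp ((β₀ + ε) * NHB.hamiltonian P U x)) ∧
      (∃ α K : ℝ, 0 < α ∧ 0 < K ∧ ∀ x ∈ NHB.stateSpace U,
        NHB.generator P U W x ≤ -α * W x + K) := by
  exact NHB.exists_lyapunov hN hk hU hε hβ₀ (NHB.mul_lt_half_of_lt_βStar hβ₀_lt)
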